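/- Let $n\ge 1$, $p\in\mathbb N$, $0<\alpha_k<1$, $\eta_k\ge -1/2$, $\lambda_k\in\mathbb R$ and $b_k>0$ for $k=1,\dots,n$, and let $\Omega^n=\prod_{k=1}^n(0,b_k)$. Write $$B^{x_k}_{\nu}=\frac{\partial^2}{\partial x_k^2}+\frac{2\nu+1}{x_k}\frac{\partial}{\partial x_k}$$ for the Bessel operator in $x_k$, $\bar I_\nu(z)=\Gamma(\nu+1)(z/2)^{-\nu}I_\nu(z)$ (with $\bar I_\nu(0)=1$), where $I_\nu$ is the modified Bessel function, and let $$J_\lambda^{-1}\binom{\alpha}{\eta} f(x)=\left[\prod_{k=1}^n\frac{x_k^{-2\eta_k}}{\Gamma(1-\alpha_k)}\,\frac1{x_k}\frac{\partial}{\partial x_k}\right]\int_0^{x_1}\!\!\cdots\int_0^{x_n}\prod_{k=1}^n\left[t_k^{2(\eta_k+\alpha_k)+1}(x_k^2-t_k^2)^{-\alpha_k}\,\bar I_{-\alpha_k}\!\left(\lambda_k\sqrt{x_k^2-t_k^2}\right)\right]f(t)\,dt_1\cdots dt_n$$ be the inverse of the multidimensional generalized Erdélyi–Kober operator. We say that $J_\lambda^{-1}$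 is applicable to $f$ if the integral converges absolutely for every $x\in\Omega^n$ and, as a function of $x\in\Omega^n$, has all mixed partial derivatives in pairwise distinct variables, and these are continuous. Let $g\in C^{2p}(\Omega^n)$ be such that, for $l=0,\dots,p-1$ and $k=1,\dots,n$, the function $\frac{\partial}{\partial x_k}[B^{x_k}_{\eta_k+\alpha_k}]^l g(x)$ is, as a function of $x_k$ with the other variables fixed, integrable at $x_k=0$, and $$\lim_{x_k\to 0}x_k^{2(\eta_k+\alpha_k)+1}\frac{\partial}{\partial x_k}\left[B^{x_k}_{\eta_k+\alpha_k}\right]^l g(x)=0 .$$ 1. For every $k$ such that $J_\lambda^{-1}$ is applicable to $[B^{x_k}_{\eta_k+\alpha_k}]^l g$ for $l=0,\dots,p$, on $\Omega^n$ $$\left[B^{x_k}_{\eta_k}-\lambda_k^2\right]^pJ_\lambda^{-1}\binom{\alpha}{\eta} g=J_\lambda^{-1}\binom{\alpha}{\eta}\left[B^{x_k}_{\eta_k+\alpha_k}\right]^pg,\qquad \left[B^{x_k}_{\eta_k}\right]^pJ_\lambda^{-1}\binom{\alpha}{\eta} g=J_\lambda^{-1}\binom{\alpha}{\eta}\left[B^{x_k}_{\eta_k+\alpha_k}+\lambda_k^2\right]^pg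 .$$ 2. In particular, for $\lambda=0$, for every $k$ such that $J_0^{-1}$ is applicable to $[B^{x_k}_{\eta_k+\alpha_k}]^l g$ for $l=0,\dots,p$, on $\Omega^n$ $$\left[B^{x_k}_{\eta_k}\right]^pJ_0^{-1}\binom{\alpha}{\eta} g=J_0^{-1}\binom{\alpha}{\eta}\left[B^{x_k}_{\eta_k+\alpha_k}\right]^pg .$$ 3. If $\lambda=0$, $\eta_k=-1/2$ for all $k$, and $J_0^{-1}$ is applicable to $B^{x_{k_1}}_{\alpha_{k_1}-1/2}\cdots B^{x_{k_r}}_{\alpha_{k_r}-1/2}\,g$ for all $0\le r\le p$ and all $k_1,\dots,k_r$, then on $\Omega^n$ $$\Delta^pJ_0^{-1}\binom{\alpha}{-1/2} g=J_0^{-1}\binom{\alpha}{-1/2}\Delta_B^p\,g,\qquad \Delta=\sum_{k=1}^n\frac{\partial^2}{\partial x_k^2},\quad \Delta_B=\sum_{k=1}^n B^{x_k}_{\alpha_k-1/2}.$$ In all these identities the partial derivatives on the left-hand side exist and $J_\lambda^{-1}$ (respectively $J_0^{-1}$) is applicable to the function on the right-hand side. -/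

import Mathlib

namespace ErdelyiKober

open Set Filter Topology MeasureTheory

/-- The open box `(0, b₁) × ⋯ × (0, bₙ)`. -/
def box {n : ℕ} (b : Fin n → ℝ) : Set (Fin n → ℝ) :=
  Set.univ.pi fun k => Ioo 0 (b k)

/-- The partial derivative `∂f/∂x_k`. -/
noncomputable def pd {n : ℕ} (k : Fin n) (f : (Fin n → ℝ) → ℝ) (x : Fin n → ℝ) : ℝ :=
  deriv (fun t => f (Function.update x k t)) (x k)

/-- `f` has a partial derivative in `x_k` at `x`. -/
def HasPd {n : ℕ} (k : Fin n) (f : (Fin n → ℝ) → ℝ) (x : Fin n → ℝ) : Prop :=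
  DifferentiableAt ℝ (fun t => f (Function.update x k t)) (x k)

/-- `f` has a first and a second partial derivative in `x_k` at every point of `Ω`. -/
def TwicePd {n : ℕ} (Ω : Set (Fin n → ℝ)) (k : Fin n) (f : (Fin n → ℝ) → ℝ) : Prop :=
  ∀ x ∈ Ω, HasPd k f x ∧ HasPd k (pd k f) x

/-- The Bessel operator `∂²/∂x_k² + ((2ν + 1) / x_k) ∂/∂x_k`. -/
noncomputable def bessel {n : ℕ} (ν : ℝ) (k : Fin n) (f : (Fin n → ℝ) → ℝ) :
    (Fin n → ℝ) → ℝ :=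
  fun x => pd k (pd k f) x + (2 * ν + 1) / x k * pd k f x

/-- The Laplacian `∑ₖ ∂²/∂x_k²`. -/
noncomputable def laplacian {n : ℕ} (f : (Fin n → ℝ) → ℝ) : (Fin n → ℝ) → ℝ :=
  fun x => ∑ k, pd k (pd k f) x

/-- `∑ₖ B_{ν_k}` with the Bessel operator `B_{ν_k}` acting in the variable `x_k`. -/
noncomputable def besselLaplacian {n : ℕ} (ν : Fin n → ℝ) (f : (Fin n → ℝ) → ℝ) :
    (Fin n → ℝ) → ℝ :=
  fun x => ∑ k, bessel (ν k) k f x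

/-- The normalized modified Bessel function `Γ(ν+1) (z/2)^{-ν} I_ν(z)`, given by its power series,
so that its value at `z = 0` is `1`. -/
noncomputable def besselIBar (ν z : ℝ) : ℝ :=
  ∑' j : ℕ, Real.Gamma (ν + 1) / (j.factorial * Real.Gamma (ν + 1 + j)) * (z / 2) ^ (2 * j)

/-- The kernel
`∏ₖ t_k^{2(η_k+α_k)+1} (x_k² - t_k²)^{-α_k} Ī_{-α_k}(λ_k √(x_k² - t_k²))`. -/
noncomputable def kernel {n : ℕ} (α η lam x t : Fin n → ℝ) : ℝ :=
  ∏ k, (t k ^ (2 * (η k + α k) + 1) * (x k ^ 2 - t k ^ 2) ^ (-α k) *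
    besselIBar (-α k) (lam k * √(x k ^ 2 - t k ^ 2)))

/-- `∫₀^{x₁} ⋯ ∫₀^{xₙ} kernel(x, t) f(t) dt`. -/
noncomputable def kernelInt {n : ℕ} (α η lam : Fin n → ℝ) (f : (Fin n → ℝ) → ℝ)
    (x : Fin n → ℝ) : ℝ :=
  ∫ t in box x, kernel α η lam x t * f t

/-- The inverse `J_λ⁻¹` of the multidimensional generalized Erdélyi–Kober operator, for orders
`0 < α_k < 1`: the operators `(x_k^{-2η_k} / Γ(1 - α_k)) (1/x_k) ∂/∂x_k`, `k = 1, …, n`, applied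
to `kernelInt`. -/
noncomputable def invEK {n : ℕ} (α η lam : Fin n → ℝ) (f : (Fin n → ℝ) → ℝ) :
    (Fin n → ℝ) → ℝ :=
  (List.finRange n).foldr
    (fun k φ => fun x => x k ^ (-2 * η k) / Real.Gamma (1 - α k) * (1 / x k * pd k φ x))
    (kernelInt α η lam f)

/-- `J_λ⁻¹ f` makes sense on the box: the integral converges absolutely at every point, and as a
function of `x` it has all the mixed partial derivatives in pairwise distinct variables, and they
are continuous. -/
def Applicable {n : ℕ} (b α η lam : Fin n → ℝ) (f : (Fin n → ℝ) → ℝ) : Prop :=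
  (∀ x ∈ box b, IntegrableOn (fun t => kernel α η lam x t * f t) (box x)) ∧
  ∀ L : List (Fin n), L.Nodup →
    ContinuousOn (L.foldr pd (kernelInt α η lam f)) (box b) ∧
    ∀ k, k ∉ L → ∀ x ∈ box b, HasPd k (L.foldr pd (kernelInt α η lam f)) x

end ErdelyiKober

/-!
The integral `F = kernelInt f` is studied one variable at a time. In the variables `y = x_k²` and
`s = x_k² - t_k²` the kernel is `κ(s) = s^{-α} Ī_{-α}(λ √s)`, a multiple of `s^{-α}` times a
Bessel–Clifford function, and `adj` is the transposed operator `φ ↦ ∫ κ(s) φ(· + s) ds` acting on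
test functions. The differential equation of `κ` gives the intertwining relation for the transposed
operator, `adj_intertwine`. Paired with `f` on lines parallel to the `x_k`-axis by Fubini's theorem
(`integral_mul_kernelInt`) and Green's identity (`integral_green`), whose boundary terms at `x_k = 0`
vanish because the flux `x_k^{2(η_k+α_k)+1} ∂_k f` does, it becomes the weak form (`weak_intertwine`)
of
`∂_k (x_k^{-2η_k-1} ∂_k F) = x_k^{-2η_k-1} (kernelInt (B f) + λ_k² F)`, `B = B_{η_k+α_k}` in `x_k`.
Everything in sight is continuous where `J⁻¹` is applicable to `f` and to `B f`, so by the lemma of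
du Bois-Reymond the equation holds classically (`hasDerivAt_rpow_mul_pd_kernelInt`). In this way no
singular integral has to be differentiated.

Schwarz's theorem in the form of Peano transfers the equation to the mixed derivatives of `F` in the
other variables (`hasDerivAt_rpow_mul_foldr`), and differentiating once more yields
`B_{η_k} J⁻¹ f = J⁻¹ B_{η_k+α_k} f + λ_k² J⁻¹ f` (`bessel_invEK`). Summing over a set of variables
and iterating gives the relation for powers (`besselSum_iterate_invEK`), of which all the claims are
special cases.

The iteration needs the vanishing of the flux for all functions to which the operators are applied.
For powers of a single Bessel operator this is assumed, but for the Laplacian it is needed for all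
products of Bessel operators as well. There it follows from the integrability of the product with one
further factor (`VanishingFlux.bessel_of_ne`): the flux of `B_j f` in `x_k` has a limit on almost
every line, and that limit is obtained by applying `B_j`, in a weak sense, to the limit `0` of the
flux of `f`.
-/

namespace ErdelyiKober

open Set Filter Topology MeasureTheory

/-! ### Partial derivatives on the box -/

section Box

variable {n : ℕ} {b : Fin n → ℝ}

theorem mem_box {x : Fin n → ℝ} : x ∈ box b ↔ ∀ k, 0 < x k ∧ x k < b k := by
  simp [box, Set.mem_pi]

theorem isOpen_box : IsOpen (box b) := isOpen_set_pi finite_univ fun _ _ => isOpen_Ioo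

theorem measurableSet_box : MeasurableSet (box b) := isOpen_box.measurableSet

theorem box_subset_box {x : Fin n → ℝ} (hx : x ∈ box b) : box x ⊆ box b := fun _ ht =>
  mem_box.2 fun k => ⟨(mem_box.1 ht k).1, (mem_box.1 ht k).2.trans (mem_box.1 hx k).2⟩

theorem update_mem_box {x : Fin n → ℝ} (hx : x ∈ box b) {k : Fin n} {r : ℝ} (h0 : 0 < r)
    (h1 : r < b k) : Function.update x k r ∈ box b := by
  refine mem_box.2 fun j => ?_
  by_cases h : j = k
  · subst h; simp [h0, h1]
  · simpa [h] using mem_box.1 hx j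

theorem eventually_update_mem_box {x : Fin n → ℝ} (hx : x ∈ box b) (k : Fin n) :
    ∀ᶠ r in 𝓝 (x k), Function.update x k r ∈ box b := by
  have h := mem_box.1 hx k
  filter_upwards [Ioo_mem_nhds h.1 h.2] with r hr using update_mem_box hx hr.1 hr.2

theorem HasPd.hasDerivAt {k : Fin n} {f : (Fin n → ℝ) → ℝ} {x : Fin n → ℝ} (h : HasPd k f x) :
    HasDerivAt (fun t => f (Function.update x k t)) (pd k f x) (x k) :=
  DifferentiableAt.hasDerivAt h

theorem HasPd.hasDerivAt_update {k : Fin n} {f : (Fin n → ℝ) → ℝ} {x : Fin n → ℝ} {r : ℝ}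
    (h : HasPd k f (Function.update x k r)) :
    HasDerivAt (fun t => f (Function.update x k t)) (pd k f (Function.update x k r)) r := by
  have := h.hasDerivAt
  simpa using this

theorem pd_eq_of_hasDerivAt {k : Fin n} {f : (Fin n → ℝ) → ℝ} {x : Fin n → ℝ} {d : ℝ}
    (h : HasDerivAt (fun t => f (Function.update x k t)) d (x k)) : pd k f x = d :=
  h.deriv

theorem eventuallyEq_update {f g : (Fin n → ℝ) → ℝ} (h : EqOn f g (box b)) {x : Fin n → ℝ}
    (hx : x ∈ box b) (k : Fin n) :
    (fun t => f (Function.update x k t)) =ᶠ[𝓝 (x k)] fun t => g (Function.update x k t) := by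
  filter_upwards [eventually_update_mem_box hx k] with r hr using h hr

theorem pd_congr {f g : (Fin n → ℝ) → ℝ} (h : EqOn f g (box b)) (k : Fin n) :
    EqOn (pd k f) (pd k g) (box b) := fun _ hx => (eventuallyEq_update h hx k).deriv_eq

theorem HasPd.congr {f g : (Fin n → ℝ) → ℝ} (h : EqOn f g (box b)) {k : Fin n} {x : Fin n → ℝ}
    (hx : x ∈ box b) (hf : HasPd k f x) : HasPd k g x :=
  (DifferentiableAt.congr_of_eventuallyEq hf (eventuallyEq_update h hx k).symm)

theorem foldr_pd_congr {f g : (Fin n → ℝ) → ℝ} (h : EqOn f g (box b)) (L : List (Fin n)) :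
    EqOn (L.foldr pd f) (L.foldr pd g) (box b) := by
  induction L with
  | nil => exact h
  | cons k L ih => exact pd_congr ih k

theorem bessel_congr {ν : ℝ} {f g : (Fin n → ℝ) → ℝ} (h : EqOn f g (box b)) (k : Fin n) :
    EqOn (bessel ν k f) (bessel ν k g) (box b) := fun x hx => by
  simp only [bessel, pd_congr h k hx, pd_congr (pd_congr h k) k hx]

theorem TwicePd.congr {f g : (Fin n → ℝ) → ℝ} (h : EqOn f g (box b)) {k : Fin n}
    (hf : TwicePd (box b) k f) : TwicePd (box b) k g := fun x hx =>
  ⟨(hf x hx).1.congr h hx, (hf x hx).2.congr (pd_congr h k) hx⟩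

theorem HasPd.add {k : Fin n} {f g : (Fin n → ℝ) → ℝ} {x : Fin n → ℝ} (hf : HasPd k f x)
    (hg : HasPd k g x) : HasPd k (f + g) x :=
  DifferentiableAt.add hf hg

theorem HasPd.smul {k : Fin n} {f : (Fin n → ℝ) → ℝ} {x : Fin n → ℝ} (hf : HasPd k f x) (c : ℝ) :
    HasPd k (c • f) x :=
  DifferentiableAt.const_mul hf c

theorem pd_add {k : Fin n} {f g : (Fin n → ℝ) → ℝ} {x : Fin n → ℝ} (hf : HasPd k f x)
    (hg : HasPd k g x) : pd k (f + g) x = pd k f x + pd k g x :=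
  deriv_add hf hg

theorem pd_smul {k : Fin n} {f : (Fin n → ℝ) → ℝ} {x : Fin n → ℝ} (c : ℝ) :
    pd k (c • f) x = c * pd k f x :=
  deriv_const_mul_field c

theorem continuousOn_update {f : (Fin n → ℝ) → ℝ} (hf : ContinuousOn f (box b)) {x : Fin n → ℝ}
    (hx : x ∈ box b) (k : Fin n) :
    ContinuousOn (fun s => f (Function.update x k s)) (Ioo 0 (b k)) := by
  refine hf.comp (by fun_prop) fun s hs => update_mem_box hx hs.1 hs.2

/-- Schwarz's theorem in the form of Peano: if `∂_k u`, `∂_j u` and a continuous `∂_j ∂_k u` exist,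
then `∂_k ∂_j u` exists and equals `∂_j ∂_k u`. -/
theorem hasDerivAt_pd_comm {j k : Fin n} (hjk : j ≠ k) {u : (Fin n → ℝ) → ℝ}
    (hk : ∀ x ∈ box b, HasPd k u x) (hj : ∀ x ∈ box b, HasPd j u x)
    (hjk' : ∀ x ∈ box b, HasPd j (pd k u) x) (hc : ContinuousOn (pd k u) (box b))
    (hc' : ContinuousOn (pd j (pd k u)) (box b)) {x : Fin n → ℝ} (hx : x ∈ box b) :
    HasDerivAt (fun t => pd j u (Function.update x k t)) (pd j (pd k u) x) (x k) := by
  have hxk := mem_box.1 hx k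
  have hxj := mem_box.1 hx j
  have hsub : ∀ s ∈ Ioo 0 (b k), uIcc (x k) s ⊆ Ioo 0 (b k) := fun s hs =>
    (convex_Ioo 0 (b k)).ordConnected.uIcc_subset hxk hs
  have key : ∀ s ∈ Ioo 0 (b k), pd j u (Function.update x k s) =
      pd j u x + ∫ r in (x k)..s, pd j (pd k u) (Function.update x k r) := by
    intro s hs
    obtain ⟨y0, hy0, hy0'⟩ := exists_between hxj.1
    obtain ⟨y1, hy1, hy1'⟩ := exists_between hxj.2
    have hyI : Icc y0 y1 ⊆ Ioo 0 (b j) := fun y hy => ⟨hy0.trans_le hy.1, hy.2.trans_lt hy1'⟩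
    have hmem : ∀ r ∈ Ioo 0 (b k), ∀ y ∈ Ioo 0 (b j),
        Function.update (Function.update x k r) j y ∈ box b := fun r hr y hy =>
      update_mem_box (update_mem_box hx hr.1 hr.2) hy.1 hy.2
    have hcomm : ∀ r y, Function.update (Function.update x k r) j y =
      Function.update (Function.update x j y) k r := fun r y => Function.update_comm hjk.symm _ _ _
    have hI1 : ∀ y ∈ Ioo 0 (b j), u (Function.update (Function.update x k s) j y) =
        u (Function.update x j y) +
          ∫ r in (x k)..s, pd k u (Function.update (Function.update x k r) j y) := by
      intro y hy
      have hxy : Function.update x j y ∈ box b := update_mem_box hx hy.1 hy.2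
      have := intervalIntegral.integral_eq_sub_of_hasDerivAt (a := x k) (b := s)
        (f := fun r => u (Function.update (Function.update x j y) k r))
        (f' := fun r => pd k u (Function.update (Function.update x j y) k r)) ?_ ?_
      · simp only [hcomm]
        rw [this]
        have e : Function.update (Function.update x j y) k (x k) = Function.update x j y := by
          rw [← hcomm]; simp
        rw [e]; ring
      · intro r hr
        exact (hk _ (by rw [← hcomm]; exact hmem r (hsub s hs hr) y hy)).hasDerivAt_update
      · exact ((continuousOn_update hc hxy k).mono (hsub s hs)).intervalIntegrable
    obtain ⟨C, hC⟩ : ∃ C, ∀ p ∈ (uIcc (x k) s ×ˢ Icc y0 y1 : Set (ℝ × ℝ)),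
        ‖pd j (pd k u) (Function.update (Function.update x k p.1) j p.2)‖ ≤ C := by
      refine (isCompact_uIcc.prod isCompact_Icc).exists_bound_of_continuousOn ?_
      refine hc'.comp (by fun_prop) fun p hp => hmem _ (hsub s hs hp.1) _ (hyI hp.2)
    have hD := intervalIntegral.hasDerivAt_integral_of_dominated_loc_of_deriv_le (𝕜 := ℝ)
      (μ := volume) (a := x k) (b := s) (x₀ := x j) (s := Icc y0 y1) (bound := fun _ => C)
      (F := fun y r => pd k u (Function.update (Function.update x k r) j y))
      (F' := fun y r => pd j (pd k u) (Function.update (Function.update x k r) j y))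
      (Icc_mem_nhds hy0' hy1) ?_ ?_ ?_ ?_ (by simp) ?_
    · have h1 : HasDerivAt (fun y => u (Function.update (Function.update x k s) j y))
          (pd j u (Function.update x k s)) (x j) := by
        have := (hj _ (update_mem_box hx hs.1 hs.2)).hasDerivAt
        simpa [hjk] using this
      have h2 : HasDerivAt (fun y => u (Function.update x j y)) (pd j u x) (x j) :=
        (hj x hx).hasDerivAt
      have h3 := (h2.add hD.2).congr_of_eventuallyEq
        (f₁ := fun y => u (Function.update (Function.update x k s) j y)) (by
          filter_upwards [Ioo_mem_nhds hxj.1 hxj.2] with y hy using hI1 y hy)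
      have h4 := h1.unique h3
      have e : ∀ r, Function.update (Function.update x k r) j (x j) = Function.update x k r := by
        intro r; rw [hcomm]; simp
      simpa [e] using h4
    · filter_upwards [Ioo_mem_nhds hxj.1 hxj.2] with y hy
      have hxy : Function.update x j y ∈ box b := update_mem_box hx hy.1 hy.2
      simp only [hcomm]
      exact (((continuousOn_update hc hxy k).mono (hsub s hs)).mono
        uIoc_subset_uIcc).aestronglyMeasurable measurableSet_uIoc
    · have := ((continuousOn_update hc (update_mem_box hx hxj.1 hxj.2 : Function.update x j (x j) ∈ _)
        k).mono (hsub s hs)).intervalIntegrable (μ := volume)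
      simpa only [hcomm] using this
    · have := ((continuousOn_update hc' (update_mem_box hx hxj.1 hxj.2 : Function.update x j (x j) ∈ _)
        k).mono (hsub s hs)).mono (uIoc_subset_uIcc) |>.aestronglyMeasurable (μ := volume)
          measurableSet_uIoc
      simpa only [hcomm] using this
    · exact ae_of_all _ fun r hr y hy => hC (r, y) ⟨uIoc_subset_uIcc hr, hy⟩
    · refine ae_of_all _ fun r hr y hy => ?_
      exact (hjk' _ (hmem r (hsub s hs (uIoc_subset_uIcc hr)) y (hyI hy))).hasDerivAt_update
  have hcont := continuousOn_update hc' hx k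
  have hF : HasDerivAt (fun s => pd j u x +
      ∫ r in (x k)..s, pd j (pd k u) (Function.update x k r)) (pd j (pd k u) x) (x k) := by
    have := intervalIntegral.integral_hasDerivAt_right (a := x k) (b := x k)
      (f := fun r => pd j (pd k u) (Function.update x k r)) (by simp)
      (hcont.stronglyMeasurableAtFilter isOpen_Ioo _ hxk)
      (hcont.continuousAt (Ioo_mem_nhds hxk.1 hxk.2))
    simpa using this.const_add (pd j u x)
  refine hF.congr_of_eventuallyEq ?_
  filter_upwards [Ioo_mem_nhds hxk.1 hxk.2] with s hs using key s hs

theorem hasPd_of_contDiffOn {f : (Fin n → ℝ) → ℝ} {m : WithTop ℕ∞} (hf : ContDiffOn ℝ m f (box b))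
    (hm : 1 ≤ m) (k : Fin n) {x : Fin n → ℝ} (hx : x ∈ box b) : HasPd k f x := by
  have h : DifferentiableAt ℝ f x :=
    ((hf.differentiableOn (by rintro rfl; simp at hm)).differentiableAt (isOpen_box.mem_nhds hx))
  have h2 : DifferentiableAt ℝ (fun t => Function.update x k t) (x k) :=
    (hasDerivAt_update x k (x k)).differentiableAt
  exact DifferentiableAt.comp (x k) (by simpa using h) h2

theorem pd_eq_fderiv {f : (Fin n → ℝ) → ℝ} {x : Fin n → ℝ} (h : DifferentiableAt ℝ f x)
    (k : Fin n) : pd k f x = fderiv ℝ f x (Pi.single k 1) := by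
  apply pd_eq_of_hasDerivAt
  have h' : HasFDerivAt f (fderiv ℝ f x) (Function.update x k (x k)) := by
    simpa using h.hasFDerivAt
  exact h'.comp_hasDerivAt (x k) (hasDerivAt_update x k (x k))

theorem contDiffOn_pd {f : (Fin n → ℝ) → ℝ} {m : ℕ} (hf : ContDiffOn ℝ ((m + 1 : ℕ)) f (box b))
    (k : Fin n) : ContDiffOn ℝ m (pd k f) (box b) := by
  have h1 : ContDiffOn ℝ m (fderiv ℝ f) (box b) := hf.fderiv_of_isOpen isOpen_box (by norm_cast)
  refine (h1.clm_apply (contDiffOn_const (c := (Pi.single k 1 : Fin n → ℝ)))).congr fun x hx => ?_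
  exact pd_eq_fderiv ((hf.differentiableOn (by norm_cast)).differentiableAt
    (isOpen_box.mem_nhds hx)) k

theorem contDiffOn_bessel {ν : ℝ} {f : (Fin n → ℝ) → ℝ} {m : ℕ}
    (hf : ContDiffOn ℝ ((m + 2 : ℕ)) f (box b)) (k : Fin n) :
    ContDiffOn ℝ m (bessel ν k f) (box b) := by
  have h1 : ContDiffOn ℝ ((m + 1 : ℕ)) (pd k f) (box b) := contDiffOn_pd (m := m + 1) hf k
  have h2 : ContDiffOn ℝ m (pd k (pd k f)) (box b) := contDiffOn_pd h1 k
  have h3 : ContDiffOn ℝ m (fun x : Fin n → ℝ => (2 * ν + 1) / x k) (box b) :=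
    contDiffOn_const.div (contDiff_apply ℝ ℝ k).contDiffOn
      fun x hx => (mem_box.1 hx k).1.ne'
  exact h2.add (h3.mul (h1.of_le (by norm_cast; omega)))

theorem twicePd_of_contDiffOn {f : (Fin n → ℝ) → ℝ} {m : ℕ} (hm : 2 ≤ m)
    (hf : ContDiffOn ℝ m f (box b)) (k : Fin n) : TwicePd (box b) k f := fun x hx =>
  ⟨hasPd_of_contDiffOn hf (by norm_cast; omega) k hx,
    hasPd_of_contDiffOn (contDiffOn_pd (m := 1) (hf.of_le (by norm_cast)) k) le_rfl k hx⟩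

theorem bessel_add {ν : ℝ} {f g : (Fin n → ℝ) → ℝ} {k : Fin n} (hf : TwicePd (box b) k f)
    (hg : TwicePd (box b) k g) :
    EqOn (bessel ν k (f + g)) (bessel ν k f + bessel ν k g) (box b) := fun x hx => by
  have h1 : EqOn (pd k (f + g)) (pd k f + pd k g) (box b) := fun y hy =>
    pd_add (hf y hy).1 (hg y hy).1
  simp only [bessel, Pi.add_apply, h1 hx, pd_congr h1 k hx, pd_add (hf x hx).2 (hg x hx).2]
  ring

theorem bessel_smul {ν : ℝ} {f : (Fin n → ℝ) → ℝ} {k : Fin n} (c : ℝ) :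
    bessel ν k (c • f) = c • bessel ν k f := by
  have h1 : pd k (c • f) = c • pd k f := funext fun y => pd_smul c
  funext x
  simp only [bessel, h1, pd_smul, Pi.smul_apply, smul_eq_mul]
  ring

theorem pd_pd_comm {f : (Fin n → ℝ) → ℝ} (hf : ContDiffOn ℝ ((2 : ℕ)) f (box b)) (j k : Fin n) :
    EqOn (pd k (pd j f)) (pd j (pd k f)) (box b) := fun x hx => by
  by_cases hjk : j = k
  · rw [hjk]
  have h1 := fun i => contDiffOn_pd (m := 1) hf i
  exact (hasDerivAt_pd_comm hjk (fun x hx => hasPd_of_contDiffOn hf (by norm_cast) k hx)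
    (fun x hx => hasPd_of_contDiffOn hf (by norm_cast) j hx)
    (fun x hx => hasPd_of_contDiffOn (h1 k) (by norm_cast) j hx) (h1 k).continuousOn
    (contDiffOn_pd (m := 0) (h1 k) j).continuousOn hx).deriv

theorem pd_bessel_comm {ν : ℝ} {f : (Fin n → ℝ) → ℝ} (hf : ContDiffOn ℝ ((3 : ℕ)) f (box b))
    {j k : Fin n} (hjk : j ≠ k) :
    EqOn (pd k (bessel ν j f)) (bessel ν j (pd k f)) (box b) := fun x hx => by
  have h2 : ∀ i, ContDiffOn ℝ ((2 : ℕ)) (pd i f) (box b) := fun i => contDiffOn_pd (m := 2) hf i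
  have h1 : ∀ i i', ContDiffOn ℝ ((1 : ℕ)) (pd i (pd i' f)) (box b) := fun i i' =>
    contDiffOn_pd (m := 1) (h2 i') i
  have e1 : EqOn (pd k (pd j f)) (pd j (pd k f)) (box b) :=
    pd_pd_comm (hf.of_le (by norm_cast)) j k
  have e2 : EqOn (pd k (pd j (pd j f))) (pd j (pd j (pd k f))) (box b) := fun y hy => by
    rw [pd_pd_comm (h2 j) j k hy, pd_congr e1 j hy]
  have d1 := (hasPd_of_contDiffOn (h1 j j) (by norm_cast) k hx).hasDerivAt
  have d2 := (hasPd_of_contDiffOn (h2 j) (by norm_cast) k hx).hasDerivAt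
  have d3 : HasDerivAt (fun t => bessel ν j f (Function.update x k t))
      (pd k (pd j (pd j f)) x + (2 * ν + 1) / x j * pd k (pd j f) x) (x k) := by
    have := d1.add (d2.const_mul ((2 * ν + 1) / x j))
    refine this.congr_of_eventuallyEq (Eventually.of_forall fun t => ?_)
    simp [bessel, hjk]
  rw [pd_eq_of_hasDerivAt d3, e2 hx, e1 hx, bessel]

theorem bessel_bessel_comm {ν ν' : ℝ} {f : (Fin n → ℝ) → ℝ}
    (hf : ContDiffOn ℝ ((4 : ℕ)) f (box b)) {j k : Fin n} (hjk : j ≠ k) :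
    EqOn (bessel ν' k (bessel ν j f)) (bessel ν j (bessel ν' k f)) (box b) := fun x hx => by
  have h3 : ∀ i, ContDiffOn ℝ ((3 : ℕ)) (pd i f) (box b) := fun i => contDiffOn_pd (m := 3) hf i
  have e1 := pd_bessel_comm (ν := ν) (hf.of_le (by norm_cast)) hjk
  have e2 : EqOn (pd k (pd k (bessel ν j f))) (bessel ν j (pd k (pd k f))) (box b) := fun y hy => by
    rw [pd_congr e1 k hy, pd_bessel_comm (h3 k) hjk hy]
  have a1 : TwicePd (box b) j (pd k f) := twicePd_of_contDiffOn (by norm_num) (h3 k) j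
  have a2 : TwicePd (box b) j (pd k (pd k f)) :=
    twicePd_of_contDiffOn le_rfl (contDiffOn_pd (m := 2) (h3 k) k) j
  -- the coefficient `(2 ν' + 1) / x k` is constant along `x j`
  have hd : ∀ φ : (Fin n → ℝ) → ℝ,
      pd j (fun y => (2 * ν' + 1) / y k * φ y) = fun y => (2 * ν' + 1) / y k * pd j φ y := by
    intro φ
    funext y
    simp only [pd, Function.update_of_ne hjk.symm]
    exact deriv_const_mul_field _
  have a3 : TwicePd (box b) j (fun y => (2 * ν' + 1) / y k * pd k f y) := by
    intro y hy
    refine ⟨?_, ?_⟩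
    · simp only [HasPd, Function.update_of_ne hjk.symm]
      exact DifferentiableAt.const_mul (a1 y hy).1 _
    · rw [hd]
      simp only [HasPd, Function.update_of_ne hjk.symm]
      exact DifferentiableAt.const_mul (a1 y hy).2 _
  have e3 : bessel ν' k f = pd k (pd k f) + fun y => (2 * ν' + 1) / y k * pd k f y := rfl
  rw [e3, bessel_add a2 a3 hx]
  conv_lhs => rw [bessel, e2 hx, e1 hx]
  rw [Pi.add_apply]
  congr 1
  simp only [bessel, hd]
  ring

end Box

/-! ### The one-dimensional kernel and its Bessel equation -/

section Kernel

/-- The Bessel–Clifford function `∑ⱼ (c s)ʲ / (j! Γ(q + j))`; up to the factor `Γ(q)`, it is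
`s ↦ Ī_{q-1}(2 √(c s))`. -/
noncomputable def clifford (q c s : ℝ) : ℝ :=
  ∑' j : ℕ, (c * s) ^ j / (j.factorial * Real.Gamma (q + j))

theorem exists_inv_Gamma_add_nat_le {q : ℝ} (hq : 0 < q) :
    ∃ C, 0 ≤ C ∧ ∀ j : ℕ, (Real.Gamma (q + j))⁻¹ ≤ C := by
  have h1 : ∀ j : ℕ, Real.Gamma (q + 1) ≤ Real.Gamma (q + (j + 1 : ℕ)) := by
    intro j
    induction j with
    | zero => simp
    | succ j ih =>
      refine ih.trans ?_
      have e : q + ((j + 1 + 1 : ℕ) : ℝ) = (q + (j + 1 : ℕ)) + 1 := by push_cast; ring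
      have hpos : 0 < q + ((j + 1 : ℕ) : ℝ) := by positivity
      rw [e, Real.Gamma_add_one hpos.ne']
      have : (1 : ℝ) ≤ q + ((j + 1 : ℕ) : ℝ) := by
        push_cast; linarith [(Nat.cast_nonneg j : (0 : ℝ) ≤ j)]
      exact le_mul_of_one_le_left (Real.Gamma_pos_of_pos hpos).le this
  have h0 := Real.Gamma_pos_of_pos hq
  have h2 : 0 < Real.Gamma (q + 1) := Real.Gamma_pos_of_pos (by linarith)
  refine ⟨(Real.Gamma q)⁻¹ + (Real.Gamma (q + 1))⁻¹, by positivity, fun j => ?_⟩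
  cases j with
  | zero => simp [h2.le]
  | succ j =>
    have := inv_anti₀ h2 (h1 j)
    have := inv_pos.2 h0
    linarith

theorem summable_clifford {q : ℝ} (hq : 0 < q) (c s : ℝ) :
    Summable fun j : ℕ => (c * s) ^ j / (j.factorial * Real.Gamma (q + j)) := by
  obtain ⟨C, hC0, hC⟩ := exists_inv_Gamma_add_nat_le hq
  refine Summable.of_norm_bounded ((Real.summable_pow_div_factorial |c * s|).mul_left C)
    fun j => ?_
  have hG : 0 < Real.Gamma (q + j) := Real.Gamma_pos_of_pos (by positivity)
  rw [norm_div, norm_pow, norm_mul (j.factorial : ℝ), Real.norm_of_nonneg hG.le, Real.norm_natCast,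
    Real.norm_eq_abs, mul_comm C, ← div_div, div_eq_mul_inv _ (Real.Gamma _)]
  exact mul_le_mul_of_nonneg_left (hC j) (by positivity)

theorem hasDerivAt_clifford {q : ℝ} (hq : 0 < q) (c s : ℝ) :
    HasDerivAt (clifford q c) (c * clifford (q + 1) c s) s := by
  obtain ⟨C, hC0, hC⟩ := exists_inv_Gamma_add_nat_le hq
  set R := |s| + 1 with hR
  have hterm : ∀ j : ℕ, ∀ y : ℝ, HasDerivAt
      (fun y => (c * y) ^ j / (j.factorial * Real.Gamma (q + j)))
      ((j * (c * y) ^ (j - 1) * c) / (j.factorial * Real.Gamma (q + j))) y := by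
    intro j y
    have := (((hasDerivAt_id y).const_mul c).pow j).div_const (j.factorial * Real.Gamma (q + j))
    simpa using this
  have hsum : Summable fun j : ℕ => (j : ℝ) * (|c| * R) ^ (j - 1) * |c| / j.factorial * C := by
    refine Summable.mul_right _ ((summable_nat_add_iff 1).1 ?_)
    refine ((Real.summable_pow_div_factorial (|c| * R)).mul_left |c|).congr fun j => ?_
    rw [Nat.factorial_succ]
    have h1 : (j.factorial : ℝ) ≠ 0 := by positivity
    have h2 : ((j : ℝ) + 1) ≠ 0 := by positivity
    push_cast
    field_simp
  have hbound : ∀ j : ℕ, ∀ y ∈ Metric.ball (0 : ℝ) R,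
      ‖(j * (c * y) ^ (j - 1) * c) / (j.factorial * Real.Gamma (q + j))‖ ≤
        (j : ℝ) * (|c| * R) ^ (j - 1) * |c| / j.factorial * C := by
    intro j y hy
    have hG : 0 < Real.Gamma (q + j) := Real.Gamma_pos_of_pos (by positivity)
    rw [← div_div, div_eq_mul_inv _ (Real.Gamma _), norm_mul, norm_inv, Real.norm_of_nonneg hG.le]
    refine mul_le_mul ?_ (hC j) (by positivity) (by positivity)
    rw [norm_div, norm_mul, norm_mul, norm_pow, norm_mul, Real.norm_natCast, Real.norm_natCast]
    have : ‖y‖ ≤ R := by simpa using (Metric.mem_ball.1 hy).le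
    simp only [Real.norm_eq_abs] at this ⊢
    gcongr
  have hsR : s ∈ Metric.ball (0 : ℝ) R := by simp [hR]
  have hmain := hasDerivAt_tsum_of_isPreconnected (𝕜 := ℝ) (F := ℝ) (t := Metric.ball (0 : ℝ) R)
    (y₀ := 0) (y := s) hsum Metric.isOpen_ball (convex_ball (0 : ℝ) R).isPreconnected
    (fun j y _ => hterm j y) hbound (by simp [hR]; positivity) (summable_clifford hq c 0) hsR
  refine hmain.congr_deriv ?_
  rw [(Summable.of_norm_bounded hsum fun j => hbound j s hsR).tsum_eq_zero_add, clifford,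
    ← tsum_mul_left]
  simp only [Nat.cast_zero, zero_mul, zero_div, zero_add]
  refine tsum_congr fun j => ?_
  have e : q + 1 + (j : ℝ) = q + ((j + 1 : ℕ) : ℝ) := by push_cast; ring
  rw [e, Nat.factorial_succ]
  have h2 : ((j : ℝ) + 1) ≠ 0 := by positivity
  have hG : Real.Gamma (q + ((j + 1 : ℕ) : ℝ)) ≠ 0 :=
    (Real.Gamma_pos_of_pos (by positivity)).ne'
  have h1 : (j.factorial : ℝ) ≠ 0 := by positivity
  push_cast at hG ⊢
  field_simp

theorem continuous_clifford {q : ℝ} (hq : 0 < q) (c : ℝ) : Continuous (clifford q c) :=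
  continuous_iff_continuousAt.2 fun s => (hasDerivAt_clifford hq c s).continuousAt

/-- With `hasDerivAt_clifford`, this is the differential equation of the Bessel–Clifford functions. -/
theorem clifford_recurrence {q : ℝ} (hq : 0 < q) (c s : ℝ) :
    clifford q c s = q * clifford (q + 1) c s + c * s * clifford (q + 2) c s := by
  have h2 := (summable_clifford (q := q + 2) (by linarith) c s).mul_left (c * s)
  have h3 := (summable_clifford (q := q + 1) (by linarith) c s).mul_left q
  have hg : Summable fun j : ℕ => (j : ℝ) * ((c * s) ^ j /
      (j.factorial * Real.Gamma (q + 1 + j))) := by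
    refine (summable_nat_add_iff 1).1 (h2.congr fun j => ?_)
    have e : q + 2 + (j : ℝ) = q + 1 + ((j + 1 : ℕ) : ℝ) := by push_cast; ring
    rw [Nat.factorial_succ, e, pow_succ]
    have h2 : ((j : ℝ) + 1) ≠ 0 := by positivity
    push_cast
    field_simp
  have h4 : c * s * clifford (q + 2) c s =
      ∑' j : ℕ, (j : ℝ) * ((c * s) ^ j / (j.factorial * Real.Gamma (q + 1 + j))) := by
    rw [hg.tsum_eq_zero_add, clifford, ← tsum_mul_left]
    simp only [Nat.cast_zero, zero_mul, zero_add]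
    refine tsum_congr fun j => ?_
    have e : q + 2 + (j : ℝ) = q + 1 + ((j + 1 : ℕ) : ℝ) := by push_cast; ring
    rw [Nat.factorial_succ, e, pow_succ]
    have h2 : ((j : ℝ) + 1) ≠ 0 := by positivity
    push_cast
    field_simp
  rw [h4, clifford, clifford, ← tsum_mul_left, ← h3.tsum_add hg]
  refine tsum_congr fun j => ?_
  have e : q + 1 + (j : ℝ) = (q + j) + 1 := by ring
  have hp : 0 < q + (j : ℝ) := by positivity
  have hG : Real.Gamma (q + j) ≠ 0 := (Real.Gamma_pos_of_pos hp).ne'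
  rw [e, Real.Gamma_add_one hp.ne']
  have h1 : (j.factorial : ℝ) ≠ 0 := by positivity
  field_simp

theorem besselIBar_mul_sqrt (α lam : ℝ) {s : ℝ} (hs : 0 ≤ s) :
    besselIBar (-α) (lam * √s) = Real.Gamma (1 - α) * clifford (1 - α) (lam ^ 2 / 4) s := by
  rw [besselIBar, clifford, ← tsum_mul_left]
  refine tsum_congr fun j => ?_
  have e : (lam * √s / 2) ^ (2 * j) = (lam ^ 2 / 4 * s) ^ j := by
    rw [pow_mul, div_pow, mul_pow, Real.sq_sqrt hs]; ring
  rw [e, neg_add_eq_sub]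
  ring

theorem one_le_besselIBar {α : ℝ} (hα : α < 1) (lam : ℝ) {s : ℝ} (hs : 0 ≤ s) :
    1 ≤ besselIBar (-α) (lam * √s) := by
  have hq : 0 < 1 - α := by linarith
  have hG := Real.Gamma_pos_of_pos hq
  rw [besselIBar_mul_sqrt α lam hs, clifford]
  have h := (summable_clifford hq (lam ^ 2 / 4) s).le_tsum 0 fun j _ => by
    have : 0 < Real.Gamma (1 - α + j) := Real.Gamma_pos_of_pos (by positivity)
    positivity
  simp only [pow_zero, Nat.factorial_zero, Nat.cast_one, Nat.cast_zero, add_zero, one_mul] at h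
  calc (1 : ℝ) = Real.Gamma (1 - α) * (1 / Real.Gamma (1 - α)) := by field_simp
    _ ≤ _ := by gcongr

/-- The kernel `s^{-α} Ī_{-α}(λ √s)` of the one-dimensional operator in the variable
`s = x² - t²`, extended by `0` to `s ≤ 0`. -/
noncomputable def kap (α lam : ℝ) : ℝ → ℝ :=
  (Ioi 0).indicator fun s => s ^ (-α) * besselIBar (-α) (lam * √s)

theorem kap_of_pos {α lam s : ℝ} (hs : 0 < s) :
    kap α lam s = s ^ (-α) * besselIBar (-α) (lam * √s) := indicator_of_mem (mem_Ioi.2 hs) _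

theorem kap_of_nonpos {α lam s : ℝ} (hs : s ≤ 0) : kap α lam s = 0 :=
  indicator_of_notMem (by simpa using hs) _

theorem kap_eq_clifford {α lam s : ℝ} (hs : 0 < s) :
    kap α lam s = Real.Gamma (1 - α) * (s ^ (-α) * clifford (1 - α) (lam ^ 2 / 4) s) := by
  rw [kap_of_pos hs, besselIBar_mul_sqrt α lam hs.le]; ring

theorem kap_nonneg {α lam : ℝ} (hα : α < 1) (s : ℝ) : 0 ≤ kap α lam s := by
  rcases le_or_gt s 0 with hs | hs
  · rw [kap_of_nonpos hs]
  · rw [kap_of_pos hs]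
    exact mul_nonneg (by positivity) (zero_le_one.trans (one_le_besselIBar hα lam hs.le))

/-- The kernel is bounded below on bounded intervals, so that integrability against it is
inherited by the remaining factors. -/
theorem rpow_neg_le_kap {α lam s Y : ℝ} (hα0 : 0 < α) (hα : α < 1) (hs : 0 < s) (hsY : s ≤ Y) :
    Y ^ (-α) ≤ kap α lam s := by
  rw [kap_of_pos hs]
  have h1 : Y ^ (-α) ≤ s ^ (-α) := Real.rpow_le_rpow_of_nonpos hs hsY (by linarith)
  exact h1.trans (le_mul_of_one_le_right (by positivity) (one_le_besselIBar hα lam hs.le))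

theorem locallyIntegrable_kap {α : ℝ} (lam : ℝ) (hα : α < 1) :
    LocallyIntegrable (kap α lam) := by
  have h : LocallyIntegrable fun s : ℝ => s ^ (-α) := by
    refine (locallyIntegrable_iff).2 fun K hK => ?_
    obtain ⟨M, hM⟩ := hK.isBounded.subset_closedBall 0
    have : IntervalIntegrable (fun s : ℝ => s ^ (-α)) volume (-M) M :=
      intervalIntegral.intervalIntegrable_rpow' (by linarith)
    rcases le_or_gt 0 M with h0 | h0
    · refine (((intervalIntegrable_iff_integrableOn_Icc_of_le (by linarith)).1 this)).mono_set ?_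
      rwa [Real.closedBall_eq_Icc, zero_sub, zero_add] at hM
    · rw [Metric.closedBall_eq_empty.2 h0, subset_empty_iff] at hM
      simp [hM]
  have h2 : LocallyIntegrable fun s : ℝ =>
      (Real.Gamma (1 - α) * clifford (1 - α) (lam ^ 2 / 4) s) * s ^ (-α) := by
    refine (locallyIntegrable_iff).2 fun K hK => ?_
    exact ((h.integrableOn_isCompact hK).continuousOn_mul (K := K)
      ((continuous_const.mul (continuous_clifford (by linarith) _)).continuousOn) hK)
  have e : kap α lam = (Ioi 0).indicator fun s : ℝ =>
      (Real.Gamma (1 - α) * clifford (1 - α) (lam ^ 2 / 4) s) * s ^ (-α) := by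
    funext s
    by_cases hs : 0 < s
    · rw [kap_eq_clifford hs, indicator_of_mem (mem_Ioi.2 hs)]; ring
    · rw [kap_of_nonpos (not_lt.1 hs), indicator_of_notMem (by simpa using hs)]
  rw [e]
  exact (locallyIntegrable_iff).2 fun K hK =>
    (h2.integrableOn_isCompact hK).indicator measurableSet_Ioi

theorem measurable_kap {α : ℝ} (lam : ℝ) (hα : α < 1) : Measurable (kap α lam) := by
  have e : kap α lam = (Ioi 0).indicator fun s : ℝ =>
      (Real.Gamma (1 - α) * (s ^ (-α) * clifford (1 - α) (lam ^ 2 / 4) s)) := by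
    funext s
    by_cases hs : 0 < s
    · rw [kap_eq_clifford hs, indicator_of_mem (mem_Ioi.2 hs)]
    · rw [kap_of_nonpos (not_lt.1 hs), indicator_of_notMem (by simpa using hs)]
  rw [e]
  refine Measurable.indicator ?_ measurableSet_Ioi
  have := (continuous_clifford (q := 1 - α) (by linarith) (lam ^ 2 / 4)).measurable
  fun_prop

/-- The adjoint of the one-dimensional integral operator in the variable `y = t²`:
`y ↦ ∫₀^∞ s^{-α} Ī_{-α}(λ √s) φ(y + s) ds`. -/
noncomputable def adj (α lam : ℝ) (φ : ℝ → ℝ) (y : ℝ) : ℝ := ∫ s, kap α lam s * φ (y + s)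

theorem adj_eq_convolution (α lam : ℝ) (φ : ℝ → ℝ) :
    adj α lam φ = convolution (fun u => kap α lam (-u)) φ (ContinuousLinearMap.lsmul ℝ ℝ)
      volume := by
  funext y
  rw [adj, convolution_def, ← integral_neg_eq_self]
  simp [sub_eq_add_neg]

theorem locallyIntegrable_kap_neg {α : ℝ} (lam : ℝ) (hα : α < 1) :
    LocallyIntegrable fun u => kap α lam (-u) := by
  refine (locallyIntegrable_iff).2 fun K hK => ?_
  have h := (locallyIntegrable_kap lam hα).integrableOn_isCompact hK.neg
  have := (Measure.measurePreserving_neg (volume : Measure ℝ)).integrableOn_comp_preimage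
    (Homeomorph.neg ℝ).measurableEmbedding |>.2 h
  simpa [Function.comp_def] using this

theorem integrable_kap_mul {α : ℝ} (lam : ℝ) (hα : α < 1) {φ : ℝ → ℝ} (hφ : Continuous φ)
    (hs : HasCompactSupport φ) (y : ℝ) : Integrable fun s => kap α lam s * φ (y + s) := by
  have h := (locallyIntegrable_kap lam hα).integrable_smul_right_of_hasCompactSupport
    (g := fun s => φ (y + s)) (by fun_prop)
    (hs.comp_homeomorph (Homeomorph.addLeft y))
  simpa using h

theorem hasDerivAt_adj {α : ℝ} (lam : ℝ) (hα : α < 1) {φ : ℝ → ℝ} (hφ : ContDiff ℝ 1 φ)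
    (hs : HasCompactSupport φ) (y : ℝ) :
    HasDerivAt (adj α lam φ) (adj α lam (deriv φ) y) y := by
  rw [adj_eq_convolution, adj_eq_convolution]
  exact hs.hasDerivAt_convolution_right _ (locallyIntegrable_kap_neg lam hα) hφ y

/-- The intertwining relation in its dual, one-dimensional form: integration against the kernel
turns `(η+2) β' + y β''` into `y (·)'' + (η+α+1) (·)' + λ²/4`. The integrand of the difference is
the derivative of `m(s) β(y+s) - s κ(s) β'(y+s)`, where `κ` is the kernel and `m` the antiderivative
of `(λ²/4) κ` vanishing at `0`, which satisfies `(s κ)' = (1-α) κ + m` by the Bessel equation. -/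
theorem adj_intertwine {α : ℝ} (η lam : ℝ) (hα : α < 1) {β : ℝ → ℝ} (hβ : ContDiff ℝ 2 β)
    (hs : HasCompactSupport β) (y : ℝ) :
    adj α lam (fun z => (η + 2) * deriv β z + z * deriv (deriv β) z) y =
      y * adj α lam (deriv (deriv β)) y + (η + α + 1) * adj α lam (deriv β) y +
        lam ^ 2 / 4 * adj α lam β y := by
  set c := lam ^ 2 / 4 with hc
  have hq : 0 < 1 - α := by linarith
  have hβ1 : ContDiff ℝ 1 (deriv β) := ((contDiff_succ_iff_deriv (n := 1)).1 hβ).2.2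
  have hβ2 : Continuous (deriv (deriv β)) := ((contDiff_succ_iff_deriv (n := 0)).1 hβ1).2.2.continuous
  have hs1 : HasCompactSupport (deriv β) := hs.deriv
  have hs2 : HasCompactSupport (deriv (deriv β)) := hs1.deriv
  have i0 := integrable_kap_mul lam hα hβ.continuous hs y
  have i1 := integrable_kap_mul lam hα hβ1.continuous hs1 y
  have i2 := integrable_kap_mul lam hα hβ2 hs2 y
  have i3 : Integrable fun s => kap α lam s * ((y + s) * deriv (deriv β) (y + s)) :=
    integrable_kap_mul lam hα (φ := fun z => z * deriv (deriv β) z) (by fun_prop) hs2.mul_left y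
  set G := Real.Gamma (1 - α)
  -- `U s = m(s) β(y+s) - s κ(s) β'(y+s)`
  let U : ℝ → ℝ := fun s => c * (G * (s ^ (1 - α) * clifford (1 - α + 1) c s)) * β (y + s) -
    G * (s ^ (1 - α) * clifford (1 - α) c s) * deriv β (y + s)
  have hU : ∀ s ∈ Ioi (0 : ℝ), HasDerivAt U (c * (kap α lam s * β (y + s)) +
      (η + α + 1) * (kap α lam s * deriv β (y + s)) + y * (kap α lam s * deriv (deriv β) (y + s))
      - (η + 2) * (kap α lam s * deriv β (y + s))
      - kap α lam s * ((y + s) * deriv (deriv β) (y + s))) s := by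
    intro s hs
    have hs0 : 0 < s := hs
    have d0 : HasDerivAt (fun s : ℝ => s ^ (1 - α)) ((1 - α) * s ^ (1 - α - 1)) s :=
      Real.hasDerivAt_rpow_const (Or.inl hs0.ne')
    have dy : HasDerivAt (fun s => y + s) 1 s := (hasDerivAt_id s).const_add y
    have d1 : HasDerivAt (fun s => β (y + s)) (deriv β (y + s)) s := by
      have := ((hβ.differentiable (by norm_num)) (y + s)).hasDerivAt.comp s dy
      simpa [Function.comp_def] using this
    have d2 : HasDerivAt (fun s => deriv β (y + s)) (deriv (deriv β) (y + s)) s := by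
      have := ((hβ1.differentiable (by norm_num)) (y + s)).hasDerivAt.comp s dy
      simpa [Function.comp_def] using this
    have d3 := hasDerivAt_clifford (q := 1 - α + 1) (by linarith) c s
    have d4 := hasDerivAt_clifford hq c s
    have := (((((d0.mul d3).const_mul G).const_mul c)).mul d1).sub
      (((d0.mul d4).const_mul G).mul d2)
    refine this.congr_deriv ?_
    simp only [Pi.mul_apply]
    have e1 : s ^ (1 - α) = s * s ^ (-α) := by
      rw [sub_eq_add_neg, Real.rpow_add hs0, Real.rpow_one]
    have e2 : s ^ (1 - α - 1) = s ^ (-α) := by ring_nf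
    rw [kap_eq_clifford hs0, ← hc, e1, e2]
    have hrec := clifford_recurrence hq c s
    have e3 : 1 - α + 1 + 1 = 1 - α + 2 := by ring
    rw [e3]
    linear_combination (-c * G * s ^ (-α) * β (y + s)) * hrec
  have hint : IntegrableOn (fun s => c * (kap α lam s * β (y + s)) +
      (η + α + 1) * (kap α lam s * deriv β (y + s)) + y * (kap α lam s * deriv (deriv β) (y + s))
      - (η + 2) * (kap α lam s * deriv β (y + s))
      - kap α lam s * ((y + s) * deriv (deriv β) (y + s))) (Ioi 0) :=
    (((((i0.const_mul c).add (i1.const_mul _)).add (i2.const_mul y)).sub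
      (i1.const_mul _)).sub i3).integrableOn
  have hcont : ContinuousWithinAt U (Ici 0) 0 := by
    have c1 : Continuous fun s : ℝ => s ^ (1 - α) := Real.continuous_rpow_const hq.le
    have c2 := continuous_clifford (q := 1 - α + 1) (by linarith) c
    have c3 := continuous_clifford hq c
    have c4 := hβ.continuous
    have c5 := hβ1.continuous
    have : Continuous U := by fun_prop
    exact this.continuousWithinAt
  have hlim : Tendsto U atTop (𝓝 0) := by
    obtain ⟨M, hM⟩ := hs.isCompact.isBounded.subset_closedBall 0
    refine tendsto_const_nhds.congr' ?_
    filter_upwards [eventually_gt_atTop (M - y)] with s hs'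
    have hn : y + s ∉ tsupport β := fun h => by
      have := hM h
      rw [Metric.mem_closedBall, dist_zero_right, Real.norm_eq_abs] at this
      linarith [le_abs_self (y + s)]
    have h1 : β (y + s) = 0 := image_eq_zero_of_notMem_tsupport hn
    have h2 : deriv β (y + s) = 0 :=
      image_eq_zero_of_notMem_tsupport fun h => hn (closure_minimal support_deriv_subset (isClosed_tsupport _) h)
    simp [U, h1, h2]
  have hmain := integral_Ioi_of_hasDerivAt_of_tendsto hcont hU hint hlim
  have hU0 : U 0 = 0 := by simp [U, Real.zero_rpow hq.ne']
  rw [hU0, sub_zero, setIntegral_eq_integral_of_forall_compl_eq_zero] at hmain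
  · rw [integral_sub, integral_sub, integral_add, integral_add, integral_const_mul,
      integral_const_mul, integral_const_mul, integral_const_mul] at hmain
    · have e : adj α lam (fun z => (η + 2) * deriv β z + z * deriv (deriv β) z) y =
          (η + 2) * (∫ s, kap α lam s * deriv β (y + s)) +
            ∫ s, kap α lam s * ((y + s) * deriv (deriv β) (y + s)) := by
        rw [adj, ← integral_const_mul, ← integral_add (i1.const_mul _) i3]
        exact integral_congr_ae (Eventually.of_forall fun s => by ring)
      rw [e]
      simp only [adj]
      linarith
    · exact i0.const_mul c
    · exact i1.const_mul _
    · exact (i0.const_mul c).add (i1.const_mul _)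
    · exact i2.const_mul y
    · exact ((i0.const_mul c).add (i1.const_mul _)).add (i2.const_mul y)
    · exact i1.const_mul _
    · exact (((i0.const_mul c).add (i1.const_mul _)).add (i2.const_mul y)).sub (i1.const_mul _)
    · exact i3
  · intro s hs
    have : kap α lam s = 0 := kap_of_nonpos (by simpa using hs)
    simp [this]

end Kernel

/-! ### Slicing the box and Fubini's theorem for the kernel -/

section Slices

variable {n : ℕ}

/-- Replacing the `k`-th coordinate by an independent one with the same, normalized, distribution
does not change a product measure. -/
theorem pi_eq_map_update (μ : Fin n → Measure ℝ) [∀ i, IsFiniteMeasure (μ i)] (k : Fin n)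
    (hk : μ k univ ≠ 0) :
    Measure.pi μ = (μ k univ)⁻¹ • Measure.map
      (fun p : (Fin n → ℝ) × ℝ => Function.update p.1 k p.2) ((Measure.pi μ).prod (μ k)) := by
  have hm : Measurable fun p : (Fin n → ℝ) × ℝ => Function.update p.1 k p.2 := by
    have : Continuous fun p : (Fin n → ℝ) × ℝ => Function.update p.1 k p.2 := by fun_prop
    exact this.measurable
  refine Measure.pi_eq fun s hs => ?_
  have hpre : (fun p : (Fin n → ℝ) × ℝ => Function.update p.1 k p.2) ⁻¹' univ.pi s =
      univ.pi (Function.update s k univ) ×ˢ s k := by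
    ext ⟨t, r⟩
    simp only [mem_preimage, Set.mem_pi, mem_univ, true_imp_iff, mem_prod]
    constructor
    · intro h
      refine ⟨fun i => ?_, by simpa using h k⟩
      by_cases hi : i = k
      · subst hi; simp
      · simpa [hi] using h i
    · rintro ⟨h1, h2⟩ i
      by_cases hi : i = k
      · subst hi; simpa using h2
      · simpa [hi] using h1 i
  rw [Measure.smul_apply, Measure.map_apply hm (MeasurableSet.univ_pi hs), hpre,
    Measure.prod_prod, Measure.pi_pi, ← Finset.mul_prod_erase _ _ (Finset.mem_univ k),
    ← Finset.mul_prod_erase _ (fun i => μ i (s i)) (Finset.mem_univ k)]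
  have e : ∏ i ∈ Finset.univ.erase k, μ i (Function.update s k univ i) =
      ∏ i ∈ Finset.univ.erase k, μ i (s i) :=
    Finset.prod_congr rfl fun i hi => by simp [Finset.ne_of_mem_erase hi]
  rw [e, Function.update_self, smul_eq_mul]
  rw [mul_assoc, ← mul_assoc, ENNReal.inv_mul_cancel hk (measure_ne_top _ _), one_mul, mul_comm]

/-- Lebesgue measure on the box is, up to a factor, the image of the product measure under
replacing the `k`-th coordinate. This makes Fubini's theorem available in terms of
`Function.update`. -/
theorem restrict_box_eq (x : Fin n → ℝ) {k : Fin n} (hk : 0 < x k) :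
    (volume : Measure (Fin n → ℝ)).restrict (box x) = (ENNReal.ofReal (x k))⁻¹ • Measure.map
      (fun p : (Fin n → ℝ) × ℝ => Function.update p.1 k p.2)
      ((volume.restrict (box x)).prod (volume.restrict (Ioo 0 (x k)))) := by
  have h1 : (volume : Measure (Fin n → ℝ)).restrict (box x) =
      Measure.pi fun i => volume.restrict (Ioo 0 (x i)) := Measure.restrict_pi_pi _ _
  have : ∀ i, IsFiniteMeasure (volume.restrict (Ioo 0 (x i))) := fun i => inferInstance
  have := pi_eq_map_update (fun i => volume.restrict (Ioo 0 (x i))) k (by simp [hk])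
  rw [h1]
  conv_lhs => rw [this]
  simp

theorem measurable_update_pair (k : Fin n) :
    Measurable fun p : (Fin n → ℝ) × ℝ => Function.update p.1 k p.2 := by
  have : Continuous fun p : (Fin n → ℝ) × ℝ => Function.update p.1 k p.2 := by fun_prop
  exact this.measurable

theorem inv_ofReal_ne {r : ℝ} : (ENNReal.ofReal r)⁻¹ ≠ 0 := by simp

theorem integrable_update {x : Fin n → ℝ} {k : Fin n} (hk : 0 < x k) {φ : (Fin n → ℝ) → ℝ}
    (h : IntegrableOn φ (box x)) :
    Integrable (fun p : (Fin n → ℝ) × ℝ => φ (Function.update p.1 k p.2))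
      ((volume.restrict (box x)).prod (volume.restrict (Ioo 0 (x k)))) := by
  rw [IntegrableOn, restrict_box_eq x hk, integrable_smul_measure inv_ofReal_ne (by simpa)] at h
  exact (integrable_map_measure h.1 (measurable_update_pair k).aemeasurable).1 h

theorem ae_integrableOn_update {x : Fin n → ℝ} {k : Fin n} (hk : 0 < x k) {φ : (Fin n → ℝ) → ℝ}
    (h : IntegrableOn φ (box x)) :
    ∀ᵐ t ∂volume.restrict (box x),
      IntegrableOn (fun s => φ (Function.update t k s)) (Ioo 0 (x k)) :=
  (integrable_update hk h).prod_right_ae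

theorem setIntegral_box_eq_zero {x : Fin n → ℝ} {k : Fin n} (hk : 0 < x k) {φ : (Fin n → ℝ) → ℝ}
    (h : IntegrableOn φ (box x))
    (h0 : ∀ᵐ t ∂volume.restrict (box x), ∫ s in Ioo 0 (x k), φ (Function.update t k s) = 0) :
    ∫ t in box x, φ t = 0 := by
  have hi := integrable_update hk h
  have h' := h
  rw [IntegrableOn, restrict_box_eq x hk, integrable_smul_measure inv_ofReal_ne (by simpa)] at h'
  rw [restrict_box_eq x hk, integral_smul_measure,
    integral_map (measurable_update_pair k).aemeasurable h'.1, integral_prod _ hi,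
    integral_congr_ae h0]
  simp

theorem ae_ae_update {x : Fin n → ℝ} {k : Fin n} (hk : 0 < x k) {P : (Fin n → ℝ) → Prop}
    (h : ∀ᵐ t ∂volume.restrict (box x), P t) :
    ∀ᵐ t ∂volume.restrict (box x), ∀ᵐ s ∂volume.restrict (Ioo 0 (x k)),
      P (Function.update t k s) := by
  rw [restrict_box_eq x hk, Measure.ae_ennreal_smul_measure_iff inv_ofReal_ne] at h
  exact Measure.ae_ae_of_ae_prod (ae_of_ae_map (measurable_update_pair k).aemeasurable h)

theorem ae_of_ae_ae_update {x : Fin n → ℝ} {k : Fin n} (hk : 0 < x k) {A : Set (Fin n → ℝ)}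
    (hA : MeasurableSet A)
    (h : ∀ᵐ t ∂volume.restrict (box x), ∀ᵐ s ∂volume.restrict (Ioo 0 (x k)),
      Function.update t k s ∈ A) :
    ∀ᵐ t ∂volume.restrict (box x), t ∈ A := by
  rw [restrict_box_eq x hk, Measure.ae_ennreal_smul_measure_iff inv_ofReal_ne,
    ae_map_iff (measurable_update_pair k).aemeasurable (by exact hA)]
  refine (Measure.measure_prod_null ((measurable_update_pair k) hA.compl)).2 ?_
  filter_upwards [h] with t ht using ht

end Slices

section Fubini

variable {n : ℕ}

/-- The part of the kernel that does not depend on `x_k`: all of it but the factor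
`(x_k² - t_k²)^{-α_k} Ī_{-α_k}(λ_k √(x_k² - t_k²))`. -/
noncomputable def wt (α η lam : Fin n → ℝ) (k : Fin n) (x t : Fin n → ℝ) : ℝ :=
  t k ^ (2 * (η k + α k) + 1) * ∏ j ∈ Finset.univ.erase k,
    (t j ^ (2 * (η j + α j) + 1) * (x j ^ 2 - t j ^ 2) ^ (-α j) *
      besselIBar (-α j) (lam j * √(x j ^ 2 - t j ^ 2)))

variable {α η lam : Fin n → ℝ}

theorem kernel_update {k : Fin n} {x t : Fin n → ℝ} {r : ℝ} (h0 : 0 < t k) (h1 : t k < r) :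
    kernel α η lam (Function.update x k r) t =
      wt α η lam k x t * kap (α k) (lam k) (r ^ 2 - t k ^ 2) := by
  have hpos : 0 < r ^ 2 - t k ^ 2 := by nlinarith
  rw [kernel, wt, kap_of_pos hpos, ← Finset.mul_prod_erase _ _ (Finset.mem_univ k)]
  have e : ∏ j ∈ Finset.univ.erase k, (t j ^ (2 * (η j + α j) + 1) *
      (Function.update x k r j ^ 2 - t j ^ 2) ^ (-α j) *
      besselIBar (-α j) (lam j * √(Function.update x k r j ^ 2 - t j ^ 2))) =
      ∏ j ∈ Finset.univ.erase k, (t j ^ (2 * (η j + α j) + 1) *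
      (x j ^ 2 - t j ^ 2) ^ (-α j) * besselIBar (-α j) (lam j * √(x j ^ 2 - t j ^ 2))) :=
    Finset.prod_congr rfl fun j hj => by simp [Finset.ne_of_mem_erase hj]
  rw [e, Function.update_self]
  ring

theorem wt_update {k : Fin n} {x t : Fin n → ℝ} {s : ℝ} :
    wt α η lam k x (Function.update t k s) = s ^ (2 * (η k + α k) + 1) *
      ∏ j ∈ Finset.univ.erase k, (t j ^ (2 * (η j + α j) + 1) * (x j ^ 2 - t j ^ 2) ^ (-α j) *
        besselIBar (-α j) (lam j * √(x j ^ 2 - t j ^ 2))) := by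
  rw [wt, Function.update_self]
  congr 1
  exact Finset.prod_congr rfl fun j hj => by simp [Finset.ne_of_mem_erase hj]

theorem mem_box_update {k : Fin n} {x t : Fin n → ℝ} {r : ℝ} :
    t ∈ box (Function.update x k r) ↔ (0 < t k ∧ t k < r) ∧ ∀ j ≠ k, 0 < t j ∧ t j < x j := by
  rw [mem_box]
  constructor
  · intro h
    refine ⟨by simpa using h k, fun j hj => by simpa [hj] using h j⟩
  · rintro ⟨h1, h2⟩ j
    by_cases hj : j = k
    · subst hj; simpa using h1
    · simpa [hj] using h2 j hj

/-- For all `x_k = r ≤ X`, the integral extends over one and the same box, since `kap` vanishes on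
the negative half-axis. -/
theorem kernelInt_update {k : Fin n} {x : Fin n → ℝ} {r X : ℝ} (h0 : 0 < r) (h1 : r ≤ X)
    (f : (Fin n → ℝ) → ℝ) :
    kernelInt α η lam f (Function.update x k r) =
      ∫ t in box (Function.update x k X),
        wt α η lam k x t * kap (α k) (lam k) (r ^ 2 - t k ^ 2) * f t := by
  rw [kernelInt]
  have hsub : box (Function.update x k r) ⊆ box (Function.update x k X) := fun t ht => by
    rw [mem_box_update] at ht ⊢
    exact ⟨⟨ht.1.1, ht.1.2.trans_le h1⟩, ht.2⟩
  rw [setIntegral_eq_of_subset_of_forall_sdiff_eq_zero measurableSet_box hsub]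
  · refine setIntegral_congr_fun measurableSet_box fun t ht => ?_
    rw [mem_box_update] at ht
    simp only [kernel_update ht.1.1 ht.1.2]
  · rintro t ⟨ht, ht'⟩
    rw [mem_box_update] at ht ht'
    have : r ≤ t k := by
      by_contra hlt
      exact ht' ⟨⟨ht.1.1, not_le.1 hlt⟩, ht.2⟩
    rw [kap_of_nonpos (by nlinarith)]
    simp

theorem integrableOn_wt_mul {k : Fin n} {x : Fin n → ℝ} {X : ℝ} (hα : 0 < α k ∧ α k < 1)
    (hX : 0 < X) {f : (Fin n → ℝ) → ℝ}
    (h : IntegrableOn (fun t => kernel α η lam (Function.update x k X) t * f t)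
      (box (Function.update x k X))) :
    IntegrableOn (fun t => wt α η lam k x t * f t) (box (Function.update x k X)) := by
  have hlow : ∀ t ∈ box (Function.update x k X),
      0 < (X ^ 2) ^ (-α k) ∧ (X ^ 2) ^ (-α k) ≤ kap (α k) (lam k) (X ^ 2 - t k ^ 2) := fun t ht => by
    rw [mem_box_update] at ht
    exact ⟨by positivity, rpow_neg_le_kap hα.1 hα.2 (by nlinarith [ht.1.1, ht.1.2]) (by nlinarith)⟩
  have hm : Measurable fun t : Fin n → ℝ => (kap (α k) (lam k) (X ^ 2 - t k ^ 2))⁻¹ :=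
    ((measurable_kap (lam k) hα.2).comp (by fun_prop)).inv
  refine (h.bdd_mul (c := ((X ^ 2) ^ (-α k))⁻¹) hm.aestronglyMeasurable ?_).congr ?_
  · filter_upwards [ae_restrict_mem measurableSet_box] with t ht
    obtain ⟨h1, h2⟩ := hlow t ht
    rw [norm_inv, Real.norm_of_nonneg (h1.le.trans h2)]
    exact inv_anti₀ h1 h2
  · filter_upwards [ae_restrict_mem measurableSet_box] with t ht
    obtain ⟨h1, h2⟩ := hlow t ht
    have h3 := (h1.trans_le h2).ne'
    rw [mem_box_update] at ht
    rw [kernel_update ht.1.1 ht.1.2]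
    field_simp

theorem continuous_adj {a : ℝ} (l : ℝ) (ha : a < 1) {φ : ℝ → ℝ} (hφ : Continuous φ)
    (hs : HasCompactSupport φ) : Continuous (adj a l φ) := by
  rw [adj_eq_convolution]
  exact hs.continuous_convolution_right _ (locallyIntegrable_kap_neg l ha) hφ

theorem integrable_kap_sub_mul {a : ℝ} (l : ℝ) (ha : a < 1) {φ : ℝ → ℝ} (hφ : Continuous φ)
    (hs : HasCompactSupport φ) (z : ℝ) : Integrable fun y => kap a l (y - z) * φ y := by
  simpa using (integrable_kap_mul l ha hφ hs z).comp_sub_right z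

theorem integral_kap_sub_mul (a l : ℝ) (φ : ℝ → ℝ) (z : ℝ) :
    ∫ y, kap a l (y - z) * φ y = adj a l φ z := by
  rw [adj, ← integral_sub_right_eq_self (fun s => kap a l s * φ (z + s)) z]
  simp

theorem integrableOn_mul_adj {k : Fin n} {x : Fin n → ℝ} (hα : α k < 1) {F : (Fin n → ℝ) → ℝ}
    (h : IntegrableOn F (box x)) {φ : ℝ → ℝ} (hφ : Continuous φ) (hs : HasCompactSupport φ) :
    IntegrableOn (fun t => F t * adj (α k) (lam k) φ (t k ^ 2)) (box x) := by
  have hc := continuous_adj (lam k) hα hφ hs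
  obtain ⟨C, hC⟩ := (isCompact_Icc (a := (0 : ℝ)) (b := x k ^ 2)).exists_bound_of_continuousOn
    hc.continuousOn
  have hm : Continuous fun t : Fin n → ℝ => adj (α k) (lam k) φ (t k ^ 2) := by fun_prop
  refine h.mul_bdd (c := C) hm.aestronglyMeasurable ?_
  filter_upwards [ae_restrict_mem measurableSet_box] with t ht
  have := mem_box.1 ht k
  exact hC _ ⟨by positivity, by nlinarith⟩

/-- Fubini's theorem: in the variable `y = x_k²`, integrating `kernelInt f` against `φ` amounts to
integrating `f` against the adjoint operator applied to `φ`. -/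
theorem integral_mul_kernelInt {k : Fin n} {x : Fin n → ℝ} {X : ℝ} (hα : α k < 1) (hX : 0 < X)
    {f : (Fin n → ℝ) → ℝ}
    (h : IntegrableOn (fun t => wt α η lam k x t * f t) (box (Function.update x k X)))
    {φ : ℝ → ℝ} (hφ : Continuous φ) (hs : HasCompactSupport φ)
    (hφ0 : ∀ y ∉ Ioo 0 (X ^ 2), φ y = 0) :
    ∫ y, φ y * kernelInt α η lam f (Function.update x k √y) =
      ∫ t in box (Function.update x k X),
        wt α η lam k x t * f t * adj (α k) (lam k) φ (t k ^ 2) := by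
  have e1 : ∀ y, φ y * kernelInt α η lam f (Function.update x k √y) =
      ∫ t in box (Function.update x k X),
        wt α η lam k x t * f t * (kap (α k) (lam k) (y - t k ^ 2) * φ y) := by
    intro y
    by_cases hy : y ∈ Ioo 0 (X ^ 2)
    · rw [kernelInt_update (Real.sqrt_pos.2 hy.1) ((Real.sqrt_le_left hX.le).2 hy.2.le),
        ← integral_const_mul]
      refine integral_congr_ae (Eventually.of_forall fun t => ?_)
      simp only [Real.sq_sqrt hy.1.le]
      ring
    · simp [hφ0 y hy]
  simp only [e1]
  rw [integral_integral_swap]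
  · refine integral_congr_ae (Eventually.of_forall fun t => ?_)
    simp only [integral_const_mul, integral_kap_sub_mul]
  · have hm : AEStronglyMeasurable (Function.uncurry fun y t =>
        wt α η lam k x t * f t * (kap (α k) (lam k) (y - t k ^ 2) * φ y))
        (volume.prod (volume.restrict (box (Function.update x k X)))) := by
      have m1 : Measurable fun p : ℝ × (Fin n → ℝ) => kap (α k) (lam k) (p.1 - p.2 k ^ 2) * φ p.1 :=
        ((measurable_kap (lam k) hα).comp (by fun_prop)).mul (hφ.measurable.comp measurable_fst)
      exact (h.1.comp_snd).mul m1.aestronglyMeasurable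
    rw [integrable_prod_iff' hm]
    refine ⟨Eventually.of_forall fun t => ?_, ?_⟩
    · exact (integrable_kap_sub_mul (lam k) hα hφ hs (t k ^ 2)).const_mul (wt α η lam k x t * f t)
    have h2 := integrableOn_mul_adj (lam := lam) hα h.norm hφ.norm hs.norm
    refine h2.congr (Eventually.of_forall fun t => ?_)
    simp only [Function.uncurry, norm_mul (wt α η lam k x t * f t), integral_const_mul,
      ← integral_kap_sub_mul, norm_mul (kap _ _ _), Real.norm_of_nonneg (kap_nonneg hα _)]

end Fubini

/-! ### Weak derivatives on an interval -/

section Weak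

open scoped ContDiff

theorem tsupport_deriv_subset_tsupport {β : ℝ → ℝ} : tsupport (deriv β) ⊆ tsupport β :=
  closure_minimal support_deriv_subset (isClosed_tsupport _)

theorem continuous_mul_of_tsupport_subset {U : Set ℝ} (hU : IsOpen U) {g φ : ℝ → ℝ}
    (hg : ContinuousOn g U) (hφ : Continuous φ) (hs : tsupport φ ⊆ U) :
    Continuous fun y => g y * φ y :=
  (hg.mul hφ.continuousOn).continuous_of_tsupport_subset hU ((tsupport_mul_subset_right).trans hs)

theorem integrable_mul_of_tsupport_subset {U : Set ℝ} (hU : IsOpen U) {g φ : ℝ → ℝ}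
    (hg : ContinuousOn g U) (hφ : Continuous φ) (hc : HasCompactSupport φ) (hs : tsupport φ ⊆ U) :
    Integrable fun y => g y * φ y :=
  (continuous_mul_of_tsupport_subset hU hg hφ hs).integrable_of_hasCompactSupport hc.mul_left

theorem integral_mul_deriv_eq_neg {U : Set ℝ} (hU : IsOpen U) {u u' β : ℝ → ℝ}
    (hu : ∀ y ∈ U, HasDerivAt u (u' y) y) (hu' : ContinuousOn u' U) (hβ : ContDiff ℝ 1 β)
    (hc : HasCompactSupport β) (hs : tsupport β ⊆ U) :
    ∫ y, u y * deriv β y = -∫ y, u' y * β y := by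
  have hcu : ContinuousOn u U := fun y hy => (hu y hy).continuousAt.continuousWithinAt
  have hβ' : Continuous (deriv β) := hβ.continuous_deriv le_rfl
  have hs' : tsupport (deriv β) ⊆ U := tsupport_deriv_subset_tsupport.trans hs
  have i1 := integrable_mul_of_tsupport_subset hU hcu hβ' hc.deriv hs'
  have i2 := integrable_mul_of_tsupport_subset hU hu' hβ.continuous hc hs
  have i3 := integrable_mul_of_tsupport_subset hU hcu hβ.continuous hc hs
  have hd : ∀ y, HasDerivAt (fun y => u y * β y) (u' y * β y + u y * deriv β y) y := by
    intro y
    by_cases hy : y ∈ tsupport β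
    · exact (hu y (hs hy)).mul (hβ.differentiable (by norm_num) y).hasDerivAt
    · have h1 : β y = 0 := image_eq_zero_of_notMem_tsupport hy
      have h2 : deriv β y = 0 :=
        image_eq_zero_of_notMem_tsupport fun h => hy (tsupport_deriv_subset_tsupport h)
      rw [h1, h2, mul_zero, mul_zero, add_zero]
      refine (hasDerivAt_const y (0 : ℝ)).congr_of_eventuallyEq ?_
      filter_upwards [(isClosed_tsupport β).isOpen_compl.mem_nhds hy] with z hz
      rw [image_eq_zero_of_notMem_tsupport hz, mul_zero]
  have := integral_eq_zero_of_hasDerivAt_of_integrable hd (i2.add i1) i3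
  rw [integral_add i2 i1] at this
  linarith

/-- A continuous function with vanishing weak derivative on an interval is constant. -/
theorem exists_const_of_integral_mul_deriv_eq_zero {A B : ℝ} {w : ℝ → ℝ} (hAB : A < B)
    (hw : ContinuousOn w (Ioo A B))
    (h : ∀ β : ℝ → ℝ, ContDiff ℝ ∞ β → HasCompactSupport β → tsupport β ⊆ Ioo A B →
      ∫ y, w y * deriv β y = 0) :
    ∃ c, ∀ y ∈ Ioo A B, w y = c := by
  -- a test function of integral one
  obtain ⟨θ₀, hθ₀, hθ₀c, hθ₀s, hθ₀i⟩ : ∃ θ : ℝ → ℝ, ContDiff ℝ ∞ θ ∧ HasCompactSupport θ ∧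
      tsupport θ ⊆ Ioo A B ∧ ∫ y, θ y = 1 := by
    let r := (B - A) / 4
    have hr : 0 < r := by simp only [r]; linarith
    let bump : ContDiffBump ((A + B) / 2) := ⟨r / 2, r, by linarith, by linarith⟩
    refine ⟨bump.normed volume, bump.contDiff_normed, bump.hasCompactSupport_normed, ?_,
      bump.integral_normed⟩
    rw [bump.tsupport_normed_eq, Real.closedBall_eq_Icc]
    intro y hy
    simp only [bump, r] at hy
    constructor <;> linarith [hy.1, hy.2]
  refine ⟨∫ y, w y * θ₀ y, ?_⟩
  set c := ∫ y, w y * θ₀ y with hc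
  have hw' : ContinuousOn (fun y => w y - c) (Ioo A B) := hw.sub continuousOn_const
  have hae : ∀ᵐ y, y ∈ Ioo A B → w y - c = 0 := by
    refine isOpen_Ioo.ae_eq_zero_of_integral_contDiff_smul_eq_zero
      (hw'.locallyIntegrableOn measurableSet_Ioo) fun θ hθ hθc hθs => ?_
    -- `ξ` has integral zero, hence a compactly supported primitive `ψ`
    set m := ∫ y, θ y with hm
    let ξ : ℝ → ℝ := fun y => θ y - m * θ₀ y
    have hξ : ContDiff ℝ ∞ ξ := hθ.sub (contDiff_const.mul hθ₀)
    have hξs : tsupport ξ ⊆ tsupport θ ∪ tsupport θ₀ := by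
      refine (tsupport_sub θ fun y => m * θ₀ y).trans (union_subset_union_right _ ?_)
      exact tsupport_mul_subset_right
    have hK : IsCompact (tsupport θ ∪ tsupport θ₀) := hθc.isCompact.union hθ₀c.isCompact
    have hKs : tsupport θ ∪ tsupport θ₀ ⊆ Ioo A B := union_subset hθs hθ₀s
    have hξc : HasCompactSupport ξ := hK.of_isClosed_subset (isClosed_tsupport _) hξs
    have hξi : ∫ y, ξ y = 0 := by
      rw [integral_sub (hθ.continuous.integrable_of_hasCompactSupport hθc)
        ((hθ₀.continuous.integrable_of_hasCompactSupport hθ₀c).const_mul m), integral_const_mul,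
        hθ₀i, ← hm]
      ring
    obtain ⟨A', hA', B', hB', hsub⟩ : ∃ A' > A, ∃ B' < B, tsupport ξ ⊆ Icc A' B' := by
      rcases (tsupport ξ).eq_empty_or_nonempty with he | hne
      · exact ⟨B, hAB, A, hAB, by simp [he]⟩
      · have hcp : IsCompact (tsupport ξ) := hξc
        obtain ⟨a₁, ha₁, hmin⟩ := hcp.exists_isLeast hne
        obtain ⟨a₂, ha₂, hmax⟩ := hcp.exists_isGreatest hne
        exact ⟨a₁, (hKs (hξs ha₁)).1, a₂, (hKs (hξs ha₂)).2, fun y hy => ⟨hmin hy, hmax hy⟩⟩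
    have hξ0 : ∀ y ∉ Icc A' B', ξ y = 0 := fun y hy =>
      image_eq_zero_of_notMem_tsupport fun h' => hy (hsub h')
    have hξint := hξ.continuous.integrable_of_hasCompactSupport (μ := volume) hξc
    let ψ : ℝ → ℝ := fun y => ∫ z in A..y, ξ z
    have hψd : ∀ y, HasDerivAt ψ (ξ y) y := fun y =>
      intervalIntegral.integral_hasDerivAt_right (hξ.continuous.intervalIntegrable _ _)
        (hξ.continuous.stronglyMeasurableAtFilter _ _) hξ.continuous.continuousAt
    have hψ' : deriv ψ = ξ := funext fun y => (hψd y).deriv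
    have hψ : ContDiff ℝ ∞ ψ := by
      rw [contDiff_infty_iff_deriv, hψ']
      exact ⟨fun y => (hψd y).differentiableAt, hξ⟩
    have hψ0 : ∀ y ∉ Icc A' B', ψ y = 0 := by
      intro y hy
      rw [mem_Icc, not_and_or, not_le, not_le] at hy
      rcases hy with hy | hy
      · refine intervalIntegral.integral_zero_ae (Eventually.of_forall fun z hz => hξ0 z ?_)
        have : z ≤ max A y := (mem_Ioc.1 hz).2
        have : max A y < A' := max_lt hA' hy
        exact fun hz' => by linarith [hz'.1]
      · by_cases hAy : A ≤ y
        · have : ψ y = ∫ z, ξ z := by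
            simp only [ψ]
            rw [intervalIntegral.integral_of_le hAy]
            refine setIntegral_eq_integral_of_forall_compl_eq_zero fun z hz => hξ0 z fun hz' => ?_
            exact hz ⟨hA'.trans_le hz'.1, hz'.2.trans hy.le⟩
          rw [this, hξi]
        · refine intervalIntegral.integral_zero_ae (Eventually.of_forall fun z hz => hξ0 z ?_)
          have : z ≤ max A y := (mem_Ioc.1 hz).2
          rw [max_eq_left (not_le.1 hAy).le] at this
          exact fun hz' => by linarith [hz'.1]
    have hψsub : tsupport ψ ⊆ Icc A' B' := closure_minimal
      (fun y hy => by_contra fun h' => hy (hψ0 y h')) isClosed_Icc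
    have h0 := h ψ hψ (isCompact_Icc.of_isClosed_subset (isClosed_tsupport _) hψsub)
      (hψsub.trans fun y hy => ⟨hA'.trans_le hy.1, hy.2.trans_lt hB'⟩)
    rw [hψ'] at h0
    have i1 := integrable_mul_of_tsupport_subset isOpen_Ioo hw hθ.continuous hθc hθs
    have i2 := integrable_mul_of_tsupport_subset isOpen_Ioo hw hθ₀.continuous hθ₀c hθ₀s
    have e1 : ∫ y, w y * ξ y = (∫ y, w y * θ y) - m * c := by
      rw [hc, ← integral_const_mul, ← integral_sub i1 (i2.const_mul m)]
      exact integral_congr_ae (Eventually.of_forall fun y => by simp only [ξ]; ring)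
    have e2 : ∫ y, θ y • (w y - c) = (∫ y, w y * θ y) - c * m := by
      rw [hm, ← integral_const_mul, ← integral_sub i1
        ((hθ.continuous.integrable_of_hasCompactSupport hθc).const_mul c)]
      exact integral_congr_ae (Eventually.of_forall fun y => by simp only [smul_eq_mul]; ring)
    rw [e2]
    linarith
  have := Measure.eqOn_open_of_ae_eq (μ := (volume : Measure ℝ)) (f := w) (g := fun _ => c)
    (U := Ioo A B) ((ae_restrict_iff' measurableSet_Ioo).2 (hae.mono fun y hy hy' =>
      sub_eq_zero.1 (hy hy'))) isOpen_Ioo hw continuousOn_const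
  exact this

/-- The lemma of du Bois-Reymond: a continuous weak derivative is a derivative. -/
theorem hasDerivAt_of_weak {A B : ℝ} {u v : ℝ → ℝ} (hu : ContinuousOn u (Ioo A B))
    (hv : ContinuousOn v (Ioo A B))
    (h : ∀ β : ℝ → ℝ, ContDiff ℝ ∞ β → HasCompactSupport β → tsupport β ⊆ Ioo A B →
      ∫ y, u y * deriv β y = -∫ y, v y * β y) {y : ℝ} (hy : y ∈ Ioo A B) :
    HasDerivAt u (v y) y := by
  have hV : ∀ z ∈ Ioo A B, HasDerivAt (fun z => ∫ s in y..z, v s) (v z) z := fun z hz =>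
    intervalIntegral.integral_hasDerivAt_right
      ((hv.mono ((convex_Ioo A B).ordConnected.uIcc_subset hy hz)).intervalIntegrable)
      (hv.stronglyMeasurableAtFilter isOpen_Ioo z hz) (hv.continuousAt (isOpen_Ioo.mem_nhds hz))
  have hVc : ContinuousOn (fun z => ∫ s in y..z, v s) (Ioo A B) := fun z hz =>
    (hV z hz).continuousAt.continuousWithinAt
  obtain ⟨c, hc⟩ := exists_const_of_integral_mul_deriv_eq_zero (hy.1.trans hy.2) (hu.sub hVc)
    fun β hβ hβc hβs => by
      have hβ1 : ContDiff ℝ 1 β := hβ.of_le (by exact_mod_cast le_top)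
      have hβ' : Continuous (deriv β) := hβ1.continuous_deriv le_rfl
      have hs' := tsupport_deriv_subset_tsupport.trans hβs
      have e := integral_mul_deriv_eq_neg isOpen_Ioo hV hv hβ1 hβc hβs
      have i1 := integrable_mul_of_tsupport_subset isOpen_Ioo hu hβ' hβc.deriv hs'
      have i2 := integrable_mul_of_tsupport_subset isOpen_Ioo hVc hβ' hβc.deriv hs'
      simp only [Pi.sub_apply, sub_mul]
      rw [integral_sub i1 i2, e, h β hβ hβc hβs, sub_self]
  refine ((hV y hy).const_add c).congr_of_eventuallyEq ?_
  filter_upwards [isOpen_Ioo.mem_nhds hy] with z hz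
  have := hc z hz
  simp only [Pi.sub_apply] at this
  linarith

end Weak

/-! ### The integral as a weak solution of an ordinary differential equation -/

section Ode

open scoped ContDiff

/-- If the flux `s^μ f'(s)` tends to `0`, then `f` grows slowly enough at `0` for the other boundary
term in Green's identity to vanish as well: by the mean value inequality `f(s) = O(s^{-μ})`. -/
theorem tendsto_rpow_mul_of_flux {μ X : ℝ} (hμ : 0 ≤ μ) (hX : 0 < X) {f f' : ℝ → ℝ}
    (hf : ∀ s ∈ Ioc 0 X, HasDerivAt f (f' s) s)
    (hlim : Tendsto (fun s : ℝ => s ^ μ * f' s) (𝓝[>] 0) (𝓝 0)) :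
    Tendsto (fun s : ℝ => s ^ μ * s * f s) (𝓝[>] 0) (𝓝 0) := by
  have h1 : ∀ᶠ s in 𝓝[>] (0 : ℝ), |s ^ μ * f' s| < 1 := by
    have := hlim.abs
    rw [abs_zero] at this
    exact this.eventually (gt_mem_nhds one_pos)
  obtain ⟨δ, hδ, hδ'⟩ := mem_nhdsGT_iff_exists_Ioo_subset.1 h1
  have hδ0 : 0 < δ := hδ
  set a := min (δ / 2) X with ha
  have ha0 : 0 < a := lt_min (by linarith) hX
  have haδ : a < δ := (min_le_left _ _).trans_lt (by linarith)
  have haX : a ≤ X := min_le_right _ _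
  have hbd : ∀ s ∈ Ioo 0 a, ‖s ^ μ * s * f s‖ ≤ s ^ μ * s * |f a| + s * a := by
    intro s hs
    have hs0 : 0 < s := hs.1
    have hpos : 0 < s ^ μ := Real.rpow_pos_of_pos hs0 μ
    have hD : ‖f a - f s‖ ≤ (s ^ μ)⁻¹ * ‖a - s‖ := by
      refine (convex_Icc s a).norm_image_sub_le_of_norm_hasDerivWithin_le
        (fun r hr => (hf r ⟨hs0.trans_le hr.1, hr.2.trans haX⟩).hasDerivWithinAt) (fun r hr => ?_)
        (left_mem_Icc.2 hs.2.le) (right_mem_Icc.2 hs.2.le)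
      have hr0 : 0 < r := hs0.trans_le hr.1
      have h2 : |r ^ μ * f' r| < 1 := hδ' ⟨hr0, hr.2.trans_lt haδ⟩
      have h3 : s ^ μ ≤ r ^ μ := Real.rpow_le_rpow hs0.le hr.1 hμ
      rw [abs_mul, abs_of_pos (Real.rpow_pos_of_pos hr0 μ)] at h2
      rw [Real.norm_eq_abs, ← one_div, le_div_iff₀ hpos]
      nlinarith [abs_nonneg (f' r)]
    have h4 : |a - s| ≤ a := by rw [abs_of_pos (by linarith [hs.2])]; linarith
    have h5 : |f s| ≤ |f a| + (s ^ μ)⁻¹ * a := by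
      have := abs_sub_abs_le_abs_sub (f s) (f a)
      rw [abs_sub_comm] at this
      have h6 : (s ^ μ)⁻¹ * |a - s| ≤ (s ^ μ)⁻¹ * a := by gcongr
      rw [Real.norm_eq_abs, Real.norm_eq_abs] at hD
      linarith
    rw [norm_mul, Real.norm_of_nonneg (by positivity), Real.norm_eq_abs]
    calc s ^ μ * s * |f s| ≤ s ^ μ * s * (|f a| + (s ^ μ)⁻¹ * a) := by gcongr
      _ = _ := by field_simp
  refine squeeze_zero_norm' (a := fun s => s ^ μ * s * |f a| + s * a)
    (by filter_upwards [Ioo_mem_nhdsGT ha0] with s hs using hbd s hs) ?_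
  have hc : Continuous fun s : ℝ => s ^ μ * s * |f a| + s * a := by
    have := Real.continuous_rpow_const hμ
    fun_prop
  have := hc.tendsto 0
  simp only [mul_zero, zero_mul, add_zero] at this
  exact this.mono_left nhdsWithin_le_nhds

theorem adj_eq_zero {α lam : ℝ} {φ : ℝ → ℝ} {Y y : ℝ} (h : ∀ z, Y ≤ z → φ z = 0) (hy : Y ≤ y) :
    adj α lam φ y = 0 := by
  rw [adj]
  refine integral_eq_zero_of_ae (Eventually.of_forall fun s => ?_)
  rcases le_or_gt s 0 with hs | hs
  · simp [kap_of_nonpos hs]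
  · simp [h (y + s) (by linarith)]

/-- Green's identity on a line parallel to the `x_k`-axis: with `μ = 2 (η + α) + 1`, the integrand
is the derivative of `s^μ (2 s f(s) (adj β')(s²) - f'(s) (adj β)(s²))`, which vanishes at both ends
of the interval. -/
theorem integral_green {α η lam : ℝ} (hα : 0 < α ∧ α < 1) (hη : -1 / 2 ≤ η) {f f' f'' : ℝ → ℝ}
    {X : ℝ} (hX : 0 < X) (hf : ∀ s ∈ Ioc 0 X, HasDerivAt f (f' s) s)
    (hf' : ∀ s ∈ Ioc 0 X, HasDerivAt f' (f'' s) s)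
    (hlim : Tendsto (fun s : ℝ => s ^ (2 * (η + α) + 1) * f' s) (𝓝[>] 0) (𝓝 0)) {β : ℝ → ℝ}
    (hβ : ContDiff ℝ 2 β) (hβc : HasCompactSupport β) (hβ0 : ∀ z, X ^ 2 ≤ z → β z = 0)
    (hβ0' : ∀ z, X ^ 2 ≤ z → deriv β z = 0) (C : ℝ)
    (hint : IntegrableOn (fun s => C * (s ^ (2 * (η + α) + 1) *
      (f s * (4 * adj α lam (fun z => (η + 2) * deriv β z + z * deriv (deriv β) z) (s ^ 2)) -
        (f'' s + (2 * (η + α) + 1) / s * f' s + lam ^ 2 * f s) * adj α lam β (s ^ 2))))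
      (Ioo 0 X)) :
    ∫ s in Ioo 0 X, C * (s ^ (2 * (η + α) + 1) *
      (f s * (4 * adj α lam (fun z => (η + 2) * deriv β z + z * deriv (deriv β) z) (s ^ 2)) -
        (f'' s + (2 * (η + α) + 1) / s * f' s + lam ^ 2 * f s) * adj α lam β (s ^ 2))) = 0 := by
  have hβ1 : ContDiff ℝ 1 (deriv β) := ((contDiff_succ_iff_deriv (n := 1)).1 hβ).2.2
  have hβ01 : ContDiff ℝ 1 β := hβ.of_le (by norm_num)
  have hμ : 0 ≤ 2 * (η + α) + 1 := by linarith [hα.1]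
  have cβ := continuous_adj lam hα.2 hβ.continuous hβc
  have cβ' := continuous_adj lam hα.2 hβ1.continuous hβc.deriv
  let U : ℝ → ℝ := fun s => C * (s ^ (2 * (η + α) + 1) *
    (f s * (2 * s * adj α lam (deriv β) (s ^ 2)) - f' s * adj α lam β (s ^ 2)))
  have hd : ∀ s ∈ Ioc 0 X, HasDerivAt U (C * (s ^ (2 * (η + α) + 1) *
      (f s * (4 * adj α lam (fun z => (η + 2) * deriv β z + z * deriv (deriv β) z) (s ^ 2)) -
        (f'' s + (2 * (η + α) + 1) / s * f' s + lam ^ 2 * f s) * adj α lam β (s ^ 2)))) s := by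
    intro s hs
    have hs0 : 0 < s := hs.1
    have d0 : HasDerivAt (fun s : ℝ => s ^ (2 * (η + α) + 1))
        ((2 * (η + α) + 1) * s ^ (2 * (η + α) + 1 - 1)) s :=
      Real.hasDerivAt_rpow_const (Or.inl hs0.ne')
    have dsq : HasDerivAt (fun s : ℝ => s ^ 2) (2 * s) s := by simpa using hasDerivAt_pow 2 s
    have d1 : HasDerivAt (fun s => adj α lam β (s ^ 2)) (adj α lam (deriv β) (s ^ 2) * (2 * s)) s :=
      HasDerivAt.comp (h := fun s : ℝ => s ^ 2) s (hasDerivAt_adj lam hα.2 hβ01 hβc (s ^ 2)) dsq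
    have d2 : HasDerivAt (fun s => adj α lam (deriv β) (s ^ 2))
        (adj α lam (deriv (deriv β)) (s ^ 2) * (2 * s)) s :=
      HasDerivAt.comp (h := fun s : ℝ => s ^ 2) s (hasDerivAt_adj lam hα.2 hβ1 hβc.deriv (s ^ 2)) dsq
    have d3 : HasDerivAt (fun s : ℝ => 2 * s) 2 s := by simpa using (hasDerivAt_id s).const_mul 2
    have := (d0.mul (((hf s hs).mul (d3.mul d2)).sub ((hf' s hs).mul d1))).const_mul C
    refine this.congr_deriv ?_
    simp only [Pi.mul_apply, Pi.sub_apply]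
    have e2 : s ^ (2 * (η + α) + 1 - 1) = s ^ (2 * (η + α) + 1) / s := by
      rw [Real.rpow_sub_one hs0.ne']
    rw [e2, adj_intertwine η lam hα.2 hβ hβc]
    field_simp
    ring
  have hU0 : Tendsto U (𝓝[>] 0) (𝓝 0) := by
    have t1 := tendsto_rpow_mul_of_flux hμ hX hf hlim
    have t2 : Tendsto (fun s : ℝ => 2 * adj α lam (deriv β) (s ^ 2)) (𝓝[>] 0)
        (𝓝 (2 * adj α lam (deriv β) (0 ^ 2))) :=
      ((by fun_prop : Continuous fun s : ℝ => 2 * adj α lam (deriv β) (s ^ 2)).tendsto 0).mono_left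
        nhdsWithin_le_nhds
    have t3 : Tendsto (fun s : ℝ => adj α lam β (s ^ 2)) (𝓝[>] 0) (𝓝 (adj α lam β (0 ^ 2))) :=
      ((by fun_prop : Continuous fun s : ℝ => adj α lam β (s ^ 2)).tendsto 0).mono_left
        nhdsWithin_le_nhds
    have := ((t1.mul t2).sub (hlim.mul t3)).const_mul C
    simp only [zero_mul, sub_zero, mul_zero] at this
    refine this.congr fun s => ?_
    simp only [U]
    ring
  have hUX : Tendsto U (𝓝[<] X) (𝓝 0) := by
    have hX' : X ∈ Ioc 0 X := ⟨hX, le_rfl⟩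
    have := (hd X hX').continuousAt.tendsto
    have e : U X = 0 := by
      simp only [U]
      rw [adj_eq_zero hβ0 le_rfl, adj_eq_zero hβ0' le_rfl]
      ring
    rw [e] at this
    exact this.mono_left nhdsWithin_le_nhds
  have := intervalIntegral.integral_eq_sub_of_hasDerivAt_of_tendsto hX
    (fun s hs => hd s ⟨hs.1, hs.2.le⟩)
    ((intervalIntegrable_iff_integrableOn_Ioo_of_le hX.le).2 hint) hU0 hUX
  rw [intervalIntegral.integral_of_le hX.le, integral_Ioc_eq_integral_Ioo, sub_zero] at this
  exact this

variable {n : ℕ} {b α η lam : Fin n → ℝ}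

/-- On almost every line parallel to the `x_k`-axis, `x_k^{2ν+1} ∂f/∂x_k` tends to `0` as
`x_k → 0`. It is not required on every line, since only the weaker property passes from `f` to
`B_j f`. -/
def VanishingFlux (b : Fin n → ℝ) (ν : ℝ) (k : Fin n) (f : (Fin n → ℝ) → ℝ) : Prop :=
  ∀ x ∈ box b, ∀ᵐ t ∂volume.restrict (box x),
    Tendsto (fun s : ℝ => s ^ (2 * ν + 1) * pd k f (Function.update t k s)) (𝓝[>] 0) (𝓝 0)

theorem exists_sq_bound_of_tsupport_subset {B : ℝ} (hB : 0 < B) {β : ℝ → ℝ}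
    (hc : HasCompactSupport β) (hs : tsupport β ⊆ Ioo 0 (B ^ 2)) :
    ∃ X, 0 < X ∧ X < B ∧ tsupport β ⊆ Ioo 0 (X ^ 2) := by
  have key : ∀ a : ℝ, 0 < a → a < B ^ 2 → (∀ y ∈ tsupport β, y ≤ a) →
      ∃ X, 0 < X ∧ X < B ∧ tsupport β ⊆ Ioo 0 (X ^ 2) := by
    intro a ha haB hm
    have h1 : √a < B := (Real.sqrt_lt' hB).2 haB
    obtain ⟨X, hX1, hX2⟩ := exists_between h1
    have hX0 : 0 < X := (Real.sqrt_nonneg a).trans_lt hX1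
    refine ⟨X, hX0, hX2, fun y hy => ⟨(hs hy).1, (hm y hy).trans_lt ?_⟩⟩
    exact (Real.sqrt_lt' hX0).1 hX1
  rcases (tsupport β).eq_empty_or_nonempty with he | hne
  · exact key (B ^ 2 / 2) (by positivity) (by have : 0 < B ^ 2 := by positivity
                                              linarith) (by simp [he])
  · have hcp : IsCompact (tsupport β) := hc
    obtain ⟨a, ha, hmax⟩ := hcp.exists_isGreatest hne
    exact key a (hs ha).1 (hs ha).2 fun y hy => hmax hy

/-- The intertwining relation in weak form, in the variable `y = x_k²`. -/
theorem weak_intertwine (hα : ∀ k, 0 < α k ∧ α k < 1) (hη : ∀ k, -1 / 2 ≤ η k) {k : Fin n}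
    {f : (Fin n → ℝ) → ℝ} (hf : TwicePd (box b) k f) (hflux : VanishingFlux b (η k + α k) k f)
    (hF : ∀ x ∈ box b, IntegrableOn (fun t => kernel α η lam x t * f t) (box x))
    (hBF : ∀ x ∈ box b, IntegrableOn
      (fun t => kernel α η lam x t * bessel (η k + α k) k f t) (box x))
    {x : Fin n → ℝ} (hx : x ∈ box b) {β : ℝ → ℝ} (hβ : ContDiff ℝ 2 β)
    (hβc : HasCompactSupport β) (hβs : tsupport β ⊆ Ioo 0 (b k ^ 2)) :
    ∫ y, (4 * ((η k + 2) * deriv β y + y * deriv (deriv β) y)) *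
        kernelInt α η lam f (Function.update x k √y) =
      (∫ y, β y * kernelInt α η lam (bessel (η k + α k) k f) (Function.update x k √y)) +
        lam k ^ 2 * ∫ y, β y * kernelInt α η lam f (Function.update x k √y) := by
  have hbk : 0 < b k := (mem_box.1 hx k).1.trans (mem_box.1 hx k).2
  obtain ⟨X, hX0, hXb, hXs⟩ := exists_sq_bound_of_tsupport_subset hbk hβc hβs
  have hβ1 : ContDiff ℝ 1 (deriv β) := ((contDiff_succ_iff_deriv (n := 1)).1 hβ).2.2
  have hβ2 : Continuous (deriv (deriv β)) := hβ1.continuous_deriv le_rfl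
  have z0 : ∀ y ∉ Ioo 0 (X ^ 2), β y = 0 := fun y hy =>
    image_eq_zero_of_notMem_tsupport fun h => hy (hXs h)
  have z1 : ∀ y ∉ Ioo 0 (X ^ 2), deriv β y = 0 := fun y hy =>
    image_eq_zero_of_notMem_tsupport fun h => hy (hXs (tsupport_deriv_subset_tsupport h))
  have z2 : ∀ y ∉ Ioo 0 (X ^ 2), deriv (deriv β) y = 0 := fun y hy =>
    image_eq_zero_of_notMem_tsupport fun h =>
      hy (hXs (tsupport_deriv_subset_tsupport (tsupport_deriv_subset_tsupport h)))
  set γ : ℝ → ℝ := fun z => (η k + 2) * deriv β z + z * deriv (deriv β) z with hγ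
  have hγ1 : Continuous γ := by have := hβ1.continuous; fun_prop
  have hγc : HasCompactSupport γ := (hβc.deriv.mul_left).add hβc.deriv.deriv.mul_left
  have hxX : Function.update x k X ∈ box b := update_mem_box hx hX0 hXb
  have iF := integrableOn_wt_mul (hα k) hX0 (hF _ hxX)
  have iB := integrableOn_wt_mul (hα k) hX0 (hBF _ hxX)
  have e1 := integral_mul_kernelInt (hα k).2 hX0 iF hγ1 hγc
    (fun y hy => by simp [hγ, z1 y hy, z2 y hy])
  have e2 := integral_mul_kernelInt (hα k).2 hX0 iB hβ.continuous hβc z0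
  have e3 := integral_mul_kernelInt (hα k).2 hX0 iF hβ.continuous hβc z0
  have j1 := integrableOn_mul_adj (lam := lam) (hα k).2 iF hγ1 hγc
  have j2 := integrableOn_mul_adj (lam := lam) (hα k).2 iB hβ.continuous hβc
  have j3 := integrableOn_mul_adj (lam := lam) (hα k).2 iF hβ.continuous hβc
  simp only [mul_assoc (4 : ℝ), integral_const_mul]
  rw [e1, e2, e3]
  have hXk : 0 < Function.update x k X k := by simpa using hX0
  have jj := ((j1.const_mul 4).sub j2).sub (j3.const_mul (lam k ^ 2))
  -- Green's identity makes the integral vanish on almost every line parallel to the `x_k`-axis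
  have hzero := setIntegral_box_eq_zero (k := k) hXk jj ?_
  · simp only [Pi.sub_apply] at hzero
    rw [integral_sub, integral_sub, integral_const_mul, integral_const_mul] at hzero
    · linarith
    · exact j1.const_mul 4
    · exact j2
    · exact (j1.const_mul 4).sub j2
    · exact j3.const_mul _
  · filter_upwards [ae_restrict_mem measurableSet_box, hflux _ hxX, ae_integrableOn_update hXk jj]
      with t ht htl hti
    have htb : t ∈ box b := box_subset_box hxX ht
    rw [Function.update_self] at hti ⊢
    have hmem : ∀ s ∈ Ioc 0 X, Function.update t k s ∈ box b := fun s hs =>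
      update_mem_box htb hs.1 (hs.2.trans_lt hXb)
    set C := ∏ j ∈ Finset.univ.erase k, (t j ^ (2 * (η j + α j) + 1) *
      (x j ^ 2 - t j ^ 2) ^ (-α j) * besselIBar (-α j) (lam j * √(x j ^ 2 - t j ^ 2))) with hC
    have eqn : ∀ s, ((fun t => 4 * (wt α η lam k x t * f t * adj (α k) (lam k) γ (t k ^ 2))) -
        (fun t => wt α η lam k x t * bessel (η k + α k) k f t * adj (α k) (lam k) β (t k ^ 2)) -
        fun t => lam k ^ 2 * (wt α η lam k x t * f t * adj (α k) (lam k) β (t k ^ 2)))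
        (Function.update t k s) =
        C * (s ^ (2 * (η k + α k) + 1) * (f (Function.update t k s) *
          (4 * adj (α k) (lam k) γ (s ^ 2)) - (pd k (pd k f) (Function.update t k s) +
          (2 * (η k + α k) + 1) / s * pd k f (Function.update t k s) +
          lam k ^ 2 * f (Function.update t k s)) * adj (α k) (lam k) β (s ^ 2))) := by
      intro s
      simp only [Pi.sub_apply, wt_update, Function.update_self, ← hC, bessel]
      ring
    have hti' := hti.congr_fun (fun s _ => eqn s) measurableSet_Ioo
    simp only [eqn]
    exact integral_green (hα k) (hη k) hX0
      (fun s hs => (hf _ (hmem s hs)).1.hasDerivAt_update)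
      (fun s hs => (hf _ (hmem s hs)).2.hasDerivAt_update) htl hβ hβc
      (fun z hz => z0 z fun h => by linarith [h.2])
      (fun z hz => z1 z fun h => by linarith [h.2]) C hti'

/-- The intertwining relation for the integral itself: `F = kernelInt f` solves
`∂_k (x_k^{-2η-1} ∂_k F) = x_k^{-2η-1} (kernelInt (B f) + λ² F)`. -/
theorem hasDerivAt_rpow_mul_pd_kernelInt (hα : ∀ k, 0 < α k ∧ α k < 1)
    (hη : ∀ k, -1 / 2 ≤ η k) {k : Fin n} {f : (Fin n → ℝ) → ℝ} (hf : TwicePd (box b) k f)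
    (hflux : VanishingFlux b (η k + α k) k f) (hF : Applicable b α η lam f)
    (hBF : Applicable b α η lam (bessel (η k + α k) k f)) {x : Fin n → ℝ} (hx : x ∈ box b) :
    HasDerivAt (fun r => r ^ (-2 * η k - 1) *
        pd k (kernelInt α η lam f) (Function.update x k r))
      (x k ^ (-2 * η k - 1) * (kernelInt α η lam (bessel (η k + α k) k f) x +
        lam k ^ 2 * kernelInt α η lam f x)) (x k) := by
  set F := kernelInt α η lam f with hFdef
  set G := kernelInt α η lam (bessel (η k + α k) k f) with hGdef
  have hbx := mem_box.1 hx k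
  have hbk : 0 < b k := hbx.1.trans hbx.2
  have cF : ContinuousOn F (box b) := (hF.2 [] List.nodup_nil).1
  have cG : ContinuousOn G (box b) := (hBF.2 [] List.nodup_nil).1
  have cF' : ContinuousOn (pd k F) (box b) := (hF.2 [k] (List.nodup_singleton k)).1
  have dF : ∀ z ∈ box b, HasPd k F z := (hF.2 [] List.nodup_nil).2 k (by simp)
  set I := Ioo (0 : ℝ) (b k ^ 2) with hI
  have hsq : ∀ y ∈ I, 0 < √y ∧ √y < b k := fun y hy =>
    ⟨Real.sqrt_pos.2 hy.1, (Real.sqrt_lt' hbk).2 hy.2⟩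
  have hmem : ∀ y ∈ I, Function.update x k √y ∈ box b := fun y hy =>
    update_mem_box hx (hsq y hy).1 (hsq y hy).2
  have ccomp : ∀ g : (Fin n → ℝ) → ℝ, ContinuousOn g (box b) →
      ContinuousOn (fun y => g (Function.update x k √y)) I := fun g hg =>
    hg.comp (by fun_prop) fun y hy => hmem y hy
  -- the derivative of `y ↦ F(x)`, `x_k = √y`; the equation reads `(4 y Φ')' = G + λ² F + 4 (η + 1) Φ'`
  let Φ' : ℝ → ℝ := fun y => pd k F (Function.update x k √y) * (1 / (2 * √y))
  have dΦ : ∀ y ∈ I, HasDerivAt (fun y => F (Function.update x k √y)) (Φ' y) y := fun y hy =>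
    ((dF _ (hmem y hy)).hasDerivAt_update).comp y (Real.hasDerivAt_sqrt hy.1.ne')
  have cΦ' : ContinuousOn Φ' I := (ccomp _ cF').mul
    (continuousOn_const.div (by fun_prop) fun y hy => by have := (hsq y hy).1; positivity)
  have cu : ContinuousOn (fun y => 4 * y * Φ' y) I := ContinuousOn.mul (by fun_prop) cΦ'
  have cv : ContinuousOn (fun y => G (Function.update x k √y) +
      lam k ^ 2 * F (Function.update x k √y) + 4 * (η k + 1) * Φ' y) I :=
    ((ccomp _ cG).add (continuousOn_const.mul (ccomp _ cF))).add (continuousOn_const.mul cΦ')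
  have hweak : ∀ β : ℝ → ℝ, ContDiff ℝ ∞ β → HasCompactSupport β → tsupport β ⊆ I →
      ∫ y, 4 * y * Φ' y * deriv β y = -∫ y, (G (Function.update x k √y) +
      lam k ^ 2 * F (Function.update x k √y) + 4 * (η k + 1) * Φ' y) * β y := by
    intro β hβ hβc hβs
    have hβ2 : ContDiff ℝ 2 β := contDiff_infty.1 hβ 2
    have hβ1 : ContDiff ℝ 1 (deriv β) := ((contDiff_succ_iff_deriv (n := 1)).1 hβ2).2.2
    have hw := weak_intertwine hα hη hf hflux hF.1 hBF.1 hx hβ2 hβc hβs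
    rw [← hFdef, ← hGdef] at hw
    -- `W' = (η + 2) β' + y β''`
    let W : ℝ → ℝ := fun y => (η k + 1) * β y + y * deriv β y
    have hW : ContDiff ℝ 1 W :=
      (contDiff_const.mul (hβ2.of_le (by norm_num))).add (contDiff_id.mul hβ1)
    have hWd : deriv W = fun y => (η k + 2) * deriv β y + y * deriv (deriv β) y := by
      funext y
      have d1 := (hβ2.differentiable (by norm_num) y).hasDerivAt
      have d2 := (hβ1.differentiable (by norm_num) y).hasDerivAt
      have := (d1.const_mul (η k + 1)).add ((hasDerivAt_id y).mul d2)
      refine this.deriv.trans ?_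
      simp only [id]
      ring
    have hWc : HasCompactSupport W := hβc.mul_left.add hβc.deriv.mul_left
    have hWs : tsupport W ⊆ I := by
      refine (tsupport_add _ _).trans (union_subset ?_ ?_)
      · exact tsupport_mul_subset_right.trans hβs
      · exact tsupport_mul_subset_right.trans (tsupport_deriv_subset_tsupport.trans hβs)
    have hibp := integral_mul_deriv_eq_neg isOpen_Ioo dΦ cΦ' hW hWc hWs
    have hs' : tsupport (deriv β) ⊆ I := tsupport_deriv_subset_tsupport.trans hβs
    have i1 := integrable_mul_of_tsupport_subset isOpen_Ioo cu hβ1.continuous hβc.deriv hs'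
    have i2 := integrable_mul_of_tsupport_subset isOpen_Ioo cΦ' hβ.continuous hβc hβs
    have i3 := integrable_mul_of_tsupport_subset isOpen_Ioo (ccomp _ cG) hβ.continuous hβc hβs
    have i4 := integrable_mul_of_tsupport_subset isOpen_Ioo (ccomp _ cF) hβ.continuous hβc hβs
    have e1 : ∫ y, (4 * ((η k + 2) * deriv β y + y * deriv (deriv β) y)) *
        F (Function.update x k √y) = 4 * ∫ y, F (Function.update x k √y) * deriv W y := by
      rw [hWd, ← integral_const_mul]
      exact integral_congr_ae (Eventually.of_forall fun y => by ring)
    have e2 : 4 * ∫ y, Φ' y * W y =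
        4 * (η k + 1) * (∫ y, Φ' y * β y) + ∫ y, 4 * y * Φ' y * deriv β y := by
      rw [← integral_const_mul, ← integral_const_mul, ← integral_add (i2.const_mul _) i1]
      exact integral_congr_ae (Eventually.of_forall fun y => by simp only [W]; ring)
    have e3 : ∫ y, (G (Function.update x k √y) + lam k ^ 2 * F (Function.update x k √y) +
        4 * (η k + 1) * Φ' y) * β y = (∫ y, β y * G (Function.update x k √y)) +
        lam k ^ 2 * (∫ y, β y * F (Function.update x k √y)) +
        4 * (η k + 1) * ∫ y, Φ' y * β y := by
      simp only [mul_comm (β _)]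
      have i5 : Integrable fun y => G (Function.update x k √y) * β y +
          lam k ^ 2 * (F (Function.update x k √y) * β y) := i3.add (i4.const_mul _)
      rw [← integral_const_mul, ← integral_const_mul, ← integral_add i3 (i4.const_mul _),
        ← integral_add i5 (i2.const_mul _)]
      exact integral_congr_ae (Eventually.of_forall fun y => by ring)
    rw [e1, hibp] at hw
    rw [e3, ← hw]
    linarith
  have hxI : x k ^ 2 ∈ I := ⟨by have := hbx.1; positivity, by nlinarith [hbx.1, hbx.2]⟩
  have hD := hasDerivAt_of_weak cu cv hweak hxI
  have hsqx : √(x k ^ 2) = x k := Real.sqrt_sq hbx.1.le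
  have dsq : HasDerivAt (fun s : ℝ => s ^ 2) (2 * x k) (x k) := by simpa using hasDerivAt_pow 2 (x k)
  have hD2 := HasDerivAt.comp (h := fun s : ℝ => s ^ 2) (x k) hD dsq
  have d0 : HasDerivAt (fun r : ℝ => r ^ (-2 * η k - 2))
      ((-2 * η k - 2) * x k ^ (-2 * η k - 2 - 1)) (x k) :=
    Real.hasDerivAt_rpow_const (Or.inl hbx.1.ne')
  -- with `y = r²`, `r^{-2η-1} ∂_k F = (1/2) r^{-2η-2} (4 y Φ'(y))`
  have hD3 := (d0.mul hD2).const_mul (1 / 2)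
  refine (hD3.congr_of_eventuallyEq ?_).congr_deriv ?_
  · filter_upwards [lt_mem_nhds hbx.1] with r hr
    have e : r ^ (-2 * η k - 1) = r ^ (-2 * η k - 2) * r := by
      rw [show -2 * η k - 1 = (-2 * η k - 2) + 1 by ring, Real.rpow_add_one hr.ne']
    simp only [Pi.mul_apply, Function.comp, Φ', Real.sqrt_sq hr.le, e]
    field_simp
    ring
  · have e1 : x k ^ (-2 * η k - 1) = x k ^ (-2 * η k - 2) * x k := by
      rw [show -2 * η k - 1 = (-2 * η k - 2) + 1 by ring, Real.rpow_add_one hbx.1.ne']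
    have e2 : x k ^ (-2 * η k - 2 - 1) = x k ^ (-2 * η k - 2) / x k :=
      Real.rpow_sub_one hbx.1.ne' _
    have hne := hbx.1.ne'
    simp only [Function.comp, Φ', hsqx, Function.update_eq_self, e1, e2]
    field_simp
    ring

end Ode

/-! ### Mixed partial derivatives and linearity of the inverse operator -/

section Mixed

variable {n : ℕ} {b α η lam : Fin n → ℝ}

/-- `F` has all mixed partial derivatives in pairwise distinct variables on the box, and they are
continuous. -/
def HasMixedPd (b : Fin n → ℝ) (F : (Fin n → ℝ) → ℝ) : Prop :=
  ∀ L : List (Fin n), L.Nodup → ContinuousOn (L.foldr pd F) (box b) ∧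
    ∀ k, k ∉ L → ∀ x ∈ box b, HasPd k (L.foldr pd F) x

/-- The mixed partial derivatives do not depend on the order of differentiation. -/
theorem HasMixedPd.foldr_perm {F : (Fin n → ℝ) → ℝ} (hF : HasMixedPd b F) {L L' : List (Fin n)}
    (h : L.Perm L') (hL : L.Nodup) : EqOn (L.foldr pd F) (L'.foldr pd F) (box b) := by
  induction h with
  | nil => exact fun _ _ => rfl
  | cons k _ ih => exact pd_congr (ih (List.nodup_cons.1 hL).2) k
  | swap i j l =>
    intro x hx
    simp only [List.nodup_cons, List.mem_cons, not_or] at hL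
    obtain ⟨⟨hji, hj⟩, hi, hl⟩ := hL
    have hjl : (j :: l).Nodup := List.nodup_cons.2 ⟨hj, hl⟩
    have hijl : (i :: j :: l).Nodup := List.nodup_cons.2 ⟨by simp [hi, Ne.symm hji], hjl⟩
    exact (hasDerivAt_pd_comm (Ne.symm hji) ((hF l hl).2 j hj) ((hF l hl).2 i hi)
      ((hF _ hjl).2 i (by simp [hi, Ne.symm hji])) (hF _ hjl).1 (hF _ hijl).1 hx).deriv
  | trans h₁ _ ih₁ ih₂ => exact (ih₁ hL).trans (ih₂ (h₁.nodup_iff.1 hL))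

theorem HasMixedPd.congr {F G : (Fin n → ℝ) → ℝ} (hF : HasMixedPd b F) (h : EqOn F G (box b)) :
    HasMixedPd b G := fun L hL =>
  ⟨(hF L hL).1.congr (foldr_pd_congr h L).symm,
    fun k hk x hx => ((hF L hL).2 k hk x hx).congr (foldr_pd_congr h L) hx⟩

theorem HasMixedPd.foldr_add {F G : (Fin n → ℝ) → ℝ} (hF : HasMixedPd b F)
    (hG : HasMixedPd b G) {L : List (Fin n)} (hL : L.Nodup) :
    EqOn (L.foldr pd (F + G)) (L.foldr pd F + L.foldr pd G) (box b) := by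
  induction L with
  | nil => exact fun _ _ => rfl
  | cons k L ih =>
    obtain ⟨hk, hL⟩ := List.nodup_cons.1 hL
    intro x hx
    rw [List.foldr_cons, pd_congr (ih hL) k hx,
      pd_add ((hF L hL).2 k hk x hx) ((hG L hL).2 k hk x hx)]
    rfl

theorem foldr_pd_smul (c : ℝ) (F : (Fin n → ℝ) → ℝ) (L : List (Fin n)) :
    L.foldr pd (c • F) = c • L.foldr pd F := by
  induction L with
  | nil => rfl
  | cons k L ih => rw [List.foldr_cons, ih]; exact funext fun x => pd_smul c

theorem HasMixedPd.add {F G : (Fin n → ℝ) → ℝ} (hF : HasMixedPd b F) (hG : HasMixedPd b G) :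
    HasMixedPd b (F + G) := fun L hL => by
  have e := hF.foldr_add hG hL
  exact ⟨((hF L hL).1.add (hG L hL).1).congr e, fun k hk x hx =>
    (((hF L hL).2 k hk x hx).add ((hG L hL).2 k hk x hx)).congr e.symm hx⟩

theorem HasMixedPd.smul {F : (Fin n → ℝ) → ℝ} (hF : HasMixedPd b F) (c : ℝ) :
    HasMixedPd b (c • F) := fun L hL => by
  rw [foldr_pd_smul]
  exact ⟨(hF L hL).1.const_smul c, fun k hk x hx => ((hF L hL).2 k hk x hx).smul c⟩

theorem kernelInt_congr {f g : (Fin n → ℝ) → ℝ} (h : EqOn f g (box b)) :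
    EqOn (kernelInt α η lam f) (kernelInt α η lam g) (box b) := fun x hx =>
  setIntegral_congr_fun measurableSet_box fun t ht => by
    simp only [h (box_subset_box hx ht)]

theorem Applicable.congr {f g : (Fin n → ℝ) → ℝ} (hf : Applicable b α η lam f)
    (h : EqOn f g (box b)) : Applicable b α η lam g := by
  refine ⟨fun x hx => (hf.1 x hx).congr_fun (fun t ht => ?_) measurableSet_box,
    HasMixedPd.congr hf.2 (kernelInt_congr h)⟩
  simp only [h (box_subset_box hx ht)]

theorem kernelInt_add {f g : (Fin n → ℝ) → ℝ} (hf : Applicable b α η lam f)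
    (hg : Applicable b α η lam g) :
    EqOn (kernelInt α η lam (f + g)) (kernelInt α η lam f + kernelInt α η lam g) (box b) :=
  fun x hx => by
    simp only [kernelInt, Pi.add_apply, mul_add]
    exact integral_add (hf.1 x hx) (hg.1 x hx)

theorem kernelInt_smul (c : ℝ) (f : (Fin n → ℝ) → ℝ) :
    kernelInt α η lam (c • f) = c • kernelInt α η lam f := by
  funext x
  simp only [kernelInt, Pi.smul_apply, smul_eq_mul, ← integral_const_mul]
  exact integral_congr_ae (Eventually.of_forall fun t => by ring)

theorem Applicable.add {f g : (Fin n → ℝ) → ℝ} (hf : Applicable b α η lam f)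
    (hg : Applicable b α η lam g) : Applicable b α η lam (f + g) := by
  refine ⟨fun x hx => ((hf.1 x hx).add (hg.1 x hx)).congr_fun (fun t _ => ?_) measurableSet_box,
    (HasMixedPd.add hf.2 hg.2).congr (kernelInt_add hf hg).symm⟩
  simp only [Pi.add_apply, mul_add]

theorem Applicable.smul {f : (Fin n → ℝ) → ℝ} (hf : Applicable b α η lam f) (c : ℝ) :
    Applicable b α η lam (c • f) := by
  refine ⟨fun x hx => IntegrableOn.congr_fun ((hf.1 x hx).const_mul c) (fun t _ => ?_)
      measurableSet_box,
    (HasMixedPd.smul hf.2 c).congr fun x _ => by rw [kernelInt_smul]⟩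
  simp only [Pi.smul_apply, smul_eq_mul]
  ring

theorem applicable_zero : Applicable b α η lam 0 := by
  have h0 : ∀ L : List (Fin n), L.foldr pd (kernelInt α η lam 0) = 0 := by
    intro L
    have := kernelInt_smul (α := α) (η := η) (lam := lam) 0 0
    rw [zero_smul, zero_smul] at this
    have h2 := foldr_pd_smul (0 : ℝ) 0 L
    rw [zero_smul, zero_smul] at h2
    rw [this, h2]
  refine ⟨fun x _ => by simp, fun L _ => ?_⟩
  rw [h0]
  exact ⟨continuousOn_const, fun k _ x _ => differentiableAt_const _⟩

/-- The factors `x_k^{-2η_k-1} / Γ(1-α_k)` can be pulled out of the composed operators, because the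
`k`-th one depends on `x_k` only. -/
theorem foldr_coeff_mul_pd (F : (Fin n → ℝ) → ℝ) {L : List (Fin n)} (hL : L.Nodup) :
    L.foldr (fun k φ => fun x => x k ^ (-2 * η k) / Real.Gamma (1 - α k) * (1 / x k * pd k φ x)) F =
      fun x => (L.map fun k => x k ^ (-2 * η k) / Real.Gamma (1 - α k) * (1 / x k)).prod *
        L.foldr pd F x := by
  induction L with
  | nil => simp
  | cons k L ih =>
    obtain ⟨hk, hL⟩ := List.nodup_cons.1 hL
    funext x
    rw [List.foldr_cons, ih hL, List.map_cons, List.prod_cons, List.foldr_cons]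
    have e : pd k (fun x => (L.map fun k => x k ^ (-2 * η k) / Real.Gamma (1 - α k) *
        (1 / x k)).prod * L.foldr pd F x) x = (L.map fun k => x k ^ (-2 * η k) /
        Real.Gamma (1 - α k) * (1 / x k)).prod * pd k (L.foldr pd F) x := by
      have e' : ∀ s : ℝ, (L.map fun j => Function.update x k s j ^ (-2 * η j) /
          Real.Gamma (1 - α j) * (1 / Function.update x k s j)) =
          L.map fun j => x j ^ (-2 * η j) / Real.Gamma (1 - α j) * (1 / x j) := fun s =>
        List.map_congr_left fun j hj => by
          have : j ≠ k := fun h => hk (h ▸ hj)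
          simp [this]
      simp only [pd, e']
      exact deriv_const_mul_field _
    rw [e]
    ring

theorem invEK_eq (f : (Fin n → ℝ) → ℝ) (x : Fin n → ℝ) :
    invEK α η lam f x = (∏ k, x k ^ (-2 * η k) / Real.Gamma (1 - α k) * (1 / x k)) *
      (List.finRange n).foldr pd (kernelInt α η lam f) x := by
  rw [invEK, foldr_coeff_mul_pd _ (List.nodup_finRange n), Fin.prod_univ_def]

theorem invEK_add {f g : (Fin n → ℝ) → ℝ} (hf : Applicable b α η lam f)
    (hg : Applicable b α η lam g) :
    EqOn (invEK α η lam (f + g)) (invEK α η lam f + invEK α η lam g) (box b) := fun x hx => by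
  rw [Pi.add_apply, invEK_eq, invEK_eq, invEK_eq, foldr_pd_congr (kernelInt_add hf hg) _ hx,
    HasMixedPd.foldr_add hf.2 hg.2 (List.nodup_finRange n) hx, Pi.add_apply, mul_add]

theorem invEK_smul (c : ℝ) (f : (Fin n → ℝ) → ℝ) :
    invEK α η lam (c • f) = c • invEK α η lam f := by
  funext x
  rw [Pi.smul_apply, invEK_eq, invEK_eq, kernelInt_smul, foldr_pd_smul, Pi.smul_apply, smul_eq_mul,
    smul_eq_mul]
  ring

theorem invEK_zero : invEK α η lam 0 = 0 := by
  have := invEK_smul (α := α) (η := η) (lam := lam) 0 0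
  rwa [zero_smul, zero_smul] at this

end Mixed

/-! ### The intertwining relation of first order -/

section Step

variable {n : ℕ} {b α η lam : Fin n → ℝ}

/-- The differential equation for `F` is inherited by the mixed partial derivatives of `F` in the
other variables. -/
theorem hasDerivAt_rpow_mul_foldr {k : Fin n} {e c : ℝ} {F G : (Fin n → ℝ) → ℝ}
    (hF : HasMixedPd b F) (hG : HasMixedPd b G)
    (h : ∀ x ∈ box b, HasDerivAt (fun r => r ^ e * pd k F (Function.update x k r))
      (x k ^ e * (G x + c * F x)) (x k)) {L : List (Fin n)} (hkL : (k :: L).Nodup)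
    {x : Fin n → ℝ} (hx : x ∈ box b) :
    HasDerivAt (fun r => r ^ e * (k :: L).foldr pd F (Function.update x k r))
      (x k ^ e * (L.foldr pd G x + c * L.foldr pd F x)) (x k) := by
  induction L generalizing x with
  | nil => exact h x hx
  | cons j L ih =>
    have hperm : (k :: j :: L).Perm (j :: k :: L) := List.Perm.swap j k L
    have hjkL : (j :: k :: L).Nodup := hperm.nodup_iff.1 hkL
    obtain ⟨hj, hkL'⟩ := List.nodup_cons.1 hjkL
    obtain ⟨hjk, hjL⟩ : j ≠ k ∧ j ∉ L := by simpa using hj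
    obtain ⟨hkL1, hL⟩ := List.nodup_cons.1 hkL'
    let u : (Fin n → ℝ) → ℝ := fun y => y k ^ e * pd k (L.foldr pd F) y
    let w : (Fin n → ℝ) → ℝ := fun y => y k ^ e * (L.foldr pd G y + c * L.foldr pd F y)
    have hu : ∀ y ∈ box b, HasDerivAt (fun r => u (Function.update y k r)) (w y) (y k) := by
      intro y hy
      simpa [u] using ih hkL' hy
    have epu : EqOn (pd k u) w (box b) := fun y hy => (hu y hy).deriv
    have hGL := fun y hy => ((hG L hL).2 j hjL y hy).hasDerivAt
    have hFL := fun y hy => ((hF L hL).2 j hjL y hy).hasDerivAt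
    have hwj : ∀ y ∈ box b, HasDerivAt (fun r => w (Function.update y j r))
        (y k ^ e * (pd j (L.foldr pd G) y + c * pd j (L.foldr pd F) y)) (y j) := by
      intro y hy
      have := ((hGL y hy).add ((hFL y hy).const_mul c)).const_mul (y k ^ e)
      simpa [w, hjk.symm] using this
    have huj : ∀ y, (fun r => u (Function.update y j r)) =
        fun r => y k ^ e * pd k (L.foldr pd F) (Function.update y j r) := fun y => by
      funext r; simp [u, hjk.symm]
    have hpw : EqOn (pd j w)
        (fun y => y k ^ e * (pd j (L.foldr pd G) y + c * pd j (L.foldr pd F) y)) (box b) :=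
      fun y hy => (hwj y hy).deriv
    have ck : ContinuousOn (fun y : Fin n → ℝ => y k ^ e) (box b) :=
      (continuous_apply k).continuousOn.rpow_const fun y hy => Or.inl (mem_box.1 hy k).1.ne'
    have hjL' : (j :: L).Nodup := List.nodup_cons.2 ⟨hjL, hL⟩
    -- Schwarz's theorem for `u` allows differentiating the equation `∂_k u = w` in `x_j`
    have hmain := hasDerivAt_pd_comm (b := b) (u := u) hjk
      (fun y hy => (hu y hy).differentiableAt)
      (fun y hy => by
        simp only [HasPd, huj]
        exact DifferentiableAt.const_mul ((hF _ hkL').2 j hj y hy) _)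
      (fun y hy => HasPd.congr epu.symm hy (hwj y hy).differentiableAt)
      ((ck.mul ((hG L hL).1.add (continuousOn_const.mul (hF L hL).1))).congr epu)
      ((ck.mul ((hG _ hjL').1.add (continuousOn_const.mul (hF _ hjL').1))).congr
        fun y hy => (pd_congr epu j hy).trans (hpw hy)) hx
    rw [pd_congr epu j hx, hpw hx] at hmain
    refine hmain.congr_of_eventuallyEq ?_
    filter_upwards [eventually_update_mem_box hx k] with r hr
    rw [hF.foldr_perm hperm hkL hr]
    simp only [pd, huj]
    rw [deriv_const_mul_field, Function.update_self]
    rfl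

/-- The intertwining relation for the first power of the Bessel operator. -/
theorem bessel_invEK (hα : ∀ k, 0 < α k ∧ α k < 1) (hη : ∀ k, -1 / 2 ≤ η k) {k : Fin n}
    {f : (Fin n → ℝ) → ℝ} (hf : TwicePd (box b) k f) (hflux : VanishingFlux b (η k + α k) k f)
    (hF : Applicable b α η lam f) (hBF : Applicable b α η lam (bessel (η k + α k) k f)) :
    TwicePd (box b) k (invEK α η lam f) ∧
      EqOn (bessel (η k) k (invEK α η lam f))
        (invEK α η lam (bessel (η k + α k) k f) + lam k ^ 2 • invEK α η lam f) (box b) := by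
  set F := kernelInt α η lam f with hFdef
  set G := kernelInt α η lam (bessel (η k + α k) k f) with hGdef
  have mF : HasMixedPd b F := hF.2
  have mG : HasMixedPd b G := hBF.2
  set L := (List.finRange n).erase k with hL
  have hperm : (List.finRange n).Perm (k :: L) := List.perm_cons_erase (List.mem_finRange k)
  have hnd : (k :: L).Nodup := hperm.nodup_iff.1 (List.nodup_finRange n)
  obtain ⟨hkL, hLnd⟩ := List.nodup_cons.1 hnd
  -- `E` collects the coefficients that do not depend on `x_k`
  let E : (Fin n → ℝ) → ℝ := fun x => 1 / Real.Gamma (1 - α k) *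
    ∏ j ∈ Finset.univ.erase k, (x j ^ (-2 * η j) / Real.Gamma (1 - α j) * (1 / x j))
  have hE : ∀ x r, E (Function.update x k r) = E x := fun x r => by
    simp only [E]
    congr 1
    exact Finset.prod_congr rfl fun j hj => by simp [Finset.ne_of_mem_erase hj]
  have hinv : ∀ h : (Fin n → ℝ) → ℝ, HasMixedPd b (kernelInt α η lam h) → ∀ x ∈ box b,
      invEK α η lam h x = E x * (x k ^ (-2 * η k - 1) *
        (k :: L).foldr pd (kernelInt α η lam h) x) := by
    intro h hh x hx
    have hxk := (mem_box.1 hx k).1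
    rw [invEK_eq, hh.foldr_perm hperm (List.nodup_finRange n) hx,
      ← Finset.mul_prod_erase _ _ (Finset.mem_univ k), Real.rpow_sub_one hxk.ne']
    simp only [E]
    ring
  let W : (Fin n → ℝ) → ℝ := fun x => L.foldr pd G x + lam k ^ 2 * L.foldr pd F x
  have hd1 : ∀ x ∈ box b, HasDerivAt (fun r => invEK α η lam f (Function.update x k r))
      (E x * (x k ^ (-2 * η k - 1) * W x)) (x k) := by
    intro x hx
    have := (hasDerivAt_rpow_mul_foldr mF mG (fun y hy =>
      hasDerivAt_rpow_mul_pd_kernelInt hα hη hf hflux hF hBF hy) hnd hx).const_mul (E x)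
    refine this.congr_of_eventuallyEq ?_
    filter_upwards [eventually_update_mem_box hx k] with r hr
    rw [hinv f mF _ hr, hE, Function.update_self]
  have e1 : EqOn (pd k (invEK α η lam f)) (fun x => E x * (x k ^ (-2 * η k - 1) * W x)) (box b) :=
    fun x hx => (hd1 x hx).deriv
  have hd2 : ∀ x ∈ box b, HasDerivAt
      (fun r => (fun x => E x * (x k ^ (-2 * η k - 1) * W x)) (Function.update x k r))
      (E x * ((-2 * η k - 1) * x k ^ (-2 * η k - 1 - 1) * W x + x k ^ (-2 * η k - 1) *
        ((k :: L).foldr pd G x + lam k ^ 2 * (k :: L).foldr pd F x))) (x k) := by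
    intro x hx
    have hxk := (mem_box.1 hx k).1
    have d0 : HasDerivAt (fun r : ℝ => r ^ (-2 * η k - 1))
        ((-2 * η k - 1) * x k ^ (-2 * η k - 1 - 1)) (x k) :=
      Real.hasDerivAt_rpow_const (Or.inl hxk.ne')
    have d1 := ((mG L hLnd).2 k hkL x hx).hasDerivAt
    have d2 := ((mF L hLnd).2 k hkL x hx).hasDerivAt
    have := (d0.mul (d1.add (d2.const_mul (lam k ^ 2)))).const_mul (E x)
    simp only [hE, Function.update_self, W]
    simpa using this
  refine ⟨fun x hx => ⟨(hd1 x hx).differentiableAt,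
    HasPd.congr e1.symm hx (hd2 x hx).differentiableAt⟩, fun x hx => ?_⟩
  have hxk := (mem_box.1 hx k).1
  rw [bessel, pd_congr e1 k hx, pd_eq_of_hasDerivAt (hd2 x hx), e1 hx, Pi.add_apply, Pi.smul_apply,
    smul_eq_mul, hinv f mF x hx, hinv _ mG x hx, Real.rpow_sub_one hxk.ne' (-2 * η k - 1)]
  simp only [W, ← hFdef, ← hGdef]
  field_simp
  ring

end Step

/-! ### Vanishing flux for mixed Bessel operators -/

section Flux

/-- If solutions `z m` of `(r^μ z')' = r^μ y` tend to `0` almost everywhere while the right-hand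
sides `y m` converge almost everywhere and are dominated, then the limit of the right-hand sides
vanishes: the `z m` converge to a solution of the limit equation, which can only be `0`. -/
theorem limit_eq_zero_of_tendsto_zero {μ a d : ℝ} (ha : 0 < a) {z z' y : ℕ → ℝ → ℝ}
    {c Y : ℝ → ℝ} (hz : ∀ m, ∀ r ∈ Icc a d, HasDerivAt (z m) (z' m r) r)
    (hz' : ∀ m, ∀ r ∈ Icc a d, HasDerivAt (fun r => r ^ μ * z' m r) (r ^ μ * y m r) r)
    (hy : ∀ m, ContinuousOn (y m) (Icc a d)) (hY : IntegrableOn Y (Ioo a d))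
    (hlim : ∀ᵐ r ∂volume.restrict (Ioo a d), Tendsto (fun m => z m r) atTop (𝓝 0) ∧
      Tendsto (fun m => y m r) atTop (𝓝 (c r)) ∧ ∀ m, |y m r| ≤ Y r) :
    ∀ᵐ r ∂volume.restrict (Ioo a d), c r = 0 := by
  rcases le_or_gt d a with hda | had
  · simp [Ioo_eq_empty (not_lt.2 hda)]
  have hpos : ∀ r ∈ Icc a d, 0 < r := fun r hr => ha.trans_le hr.1
  have cμ : ∀ e : ℝ, ContinuousOn (fun r : ℝ => r ^ e) (Icc a d) := fun e =>
    continuousOn_id.rpow_const fun r hr => Or.inl (hpos r hr).ne'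
  have hsub : ∀ t ∈ Icc a d, uIcc a t ⊆ Icc a d := fun t ht => by
    rw [uIcc_of_le ht.1]; exact Icc_subset_Icc_right ht.2
  have hsub' : ∀ t ∈ Icc a d, uIoc a t ⊆ Ioc a d := fun t ht => by
    rw [uIoc_of_le ht.1]; exact Ioc_subset_Ioc_right ht.2
  have hres : (volume : Measure ℝ).restrict (Ioo a d) = volume.restrict (Ioc a d) :=
    Measure.restrict_congr_set Ioo_ae_eq_Ioc
  rw [hres] at hlim ⊢
  rw [← integrableOn_Ioc_iff_integrableOn_Ioo] at hY
  have hlim' := (ae_restrict_iff' measurableSet_Ioc).1 hlim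
  have cy : ∀ m, ContinuousOn (fun r => r ^ μ * y m r) (Icc a d) := fun m => (cμ μ).mul (hy m)
  -- the dominating function of `r^μ y`
  obtain ⟨M, hM⟩ := isCompact_Icc.exists_bound_of_continuousOn (cμ μ)
  have hM0 : 0 ≤ M := (norm_nonneg _).trans (hM a ⟨le_rfl, had.le⟩)
  have hYM : IntegrableOn (fun r => M * Y r) (Ioc a d) := hY.const_mul M
  have hYMi : ∀ t ∈ Icc a d, IntervalIntegrable (fun r => M * Y r) volume a t := fun t ht =>
    (intervalIntegrable_iff_integrableOn_Ioc_of_le ht.1).2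
      (hYM.mono_set (Ioc_subset_Ioc_right ht.2))
  have hbound : ∀ m, ∀ t ∈ Icc a d, ∀ᵐ r, r ∈ uIoc a t → ‖r ^ μ * y m r‖ ≤ M * Y r := by
    intro m t ht
    filter_upwards [hlim'] with r hr hrt
    have hr' := hsub' t ht hrt
    rw [norm_mul]
    exact mul_le_mul (hM r (Ioc_subset_Icc_self hr')) ((hr hr').2.2 m) (norm_nonneg _) hM0
  have hconv : ∀ t ∈ Icc a d, ∀ᵐ r, r ∈ uIoc a t →
      Tendsto (fun m => r ^ μ * y m r) atTop (𝓝 (r ^ μ * c r)) := by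
    intro t ht
    filter_upwards [hlim'] with r hr hrt
    exact ((hr (hsub' t ht hrt)).2.1).const_mul _
  let P : ℕ → ℝ → ℝ := fun m t => ∫ r in a..t, r ^ μ * y m r
  let Pc : ℝ → ℝ := fun t => ∫ r in a..t, r ^ μ * c r
  have hP : ∀ t ∈ Icc a d, Tendsto (fun m => P m t) atTop (𝓝 (Pc t)) := fun t ht =>
    intervalIntegral.tendsto_integral_filter_of_dominated_convergence _
      (Eventually.of_forall fun m => ((cy m).mono
        ((hsub' t ht).trans Ioc_subset_Icc_self)).aestronglyMeasurable measurableSet_uIoc)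
      (Eventually.of_forall fun m => hbound m t ht) (hYMi t ht) (hconv t ht)
  let K : ℝ := ∫ r in a..d, M * Y r
  have hPK : ∀ m, ∀ t ∈ Icc a d, ‖P m t‖ ≤ K := by
    intro m t ht
    refine (intervalIntegral.norm_integral_le_of_norm_le (g := fun r => M * Y r) ht.1 ?_
      (hYMi t ht)).trans ?_
    · filter_upwards [hbound m t ht] with r hr hrt
      exact hr (by rwa [uIoc_of_le ht.1])
    · refine intervalIntegral.integral_mono_interval le_rfl ht.1 ht.2 ?_ (hYMi d ⟨had.le, le_rfl⟩)
      filter_upwards [hlim] with r hr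
      exact mul_nonneg hM0 ((abs_nonneg _).trans (hr.2.2 0))
  -- integrating the equation twice
  have cP : ∀ m, ContinuousOn (P m) (Icc a d) := fun m => by
    have := intervalIntegral.continuousOn_primitive_interval' (a := a) (μ := volume)
      ((cy m).mono (hsub d ⟨had.le, le_rfl⟩)).intervalIntegrable (left_mem_uIcc)
    rwa [uIcc_of_le had.le] at this
  have hz'P : ∀ m, ∀ t ∈ Icc a d, z' m t = t ^ (-μ) * (a ^ μ * z' m a + P m t) := by
    intro m t ht
    have := intervalIntegral.integral_eq_sub_of_hasDerivAt
      (fun r hr => hz' m r (hsub t ht hr)) ((cy m).mono (hsub t ht)).intervalIntegrable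
    simp only [P]
    rw [this, Real.rpow_neg (hpos t ht).le]
    have := (Real.rpow_pos_of_pos (hpos t ht) μ).ne'
    field_simp
    ring
  let κ : ℕ → ℝ := fun m => a ^ μ * z' m a
  let τ : ℝ → ℝ := fun t => ∫ r in a..t, r ^ (-μ)
  let G : ℕ → ℝ → ℝ := fun m t => ∫ r in a..t, r ^ (-μ) * P m r
  let Gc : ℝ → ℝ := fun t => ∫ r in a..t, r ^ (-μ) * Pc r
  have hzG : ∀ m, ∀ t ∈ Icc a d, z m t = z m a + κ m * τ t + G m t := by
    intro m t ht
    have i1 : IntervalIntegrable (fun r : ℝ => r ^ (-μ)) volume a t :=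
      ((cμ (-μ)).mono (hsub t ht)).intervalIntegrable
    have i2 : IntervalIntegrable (fun r : ℝ => r ^ (-μ) * P m r) volume a t :=
      (((cμ (-μ)).mul (cP m)).mono (hsub t ht)).intervalIntegrable
    have e : ∀ r ∈ uIcc a t, κ m * r ^ (-μ) + r ^ (-μ) * P m r = z' m r := fun r hr => by
      rw [hz'P m r (hsub t ht hr)]; simp only [κ]; ring
    have := intervalIntegral.integral_eq_sub_of_hasDerivAt
      (fun r hr => hz m r (hsub t ht hr))
      (((i1.const_mul (κ m)).add i2).congr_uIoo fun r hr => e r (uIoo_subset_uIcc_self hr))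
    rw [← intervalIntegral.integral_congr e, intervalIntegral.integral_add (i1.const_mul _) i2,
      intervalIntegral.integral_const_mul] at this
    simp only [τ, G]
    linarith
  obtain ⟨M', hM'⟩ := isCompact_Icc.exists_bound_of_continuousOn (cμ (-μ))
  have hM'0 : 0 ≤ M' := (norm_nonneg _).trans (hM' a ⟨le_rfl, had.le⟩)
  have hG : ∀ t ∈ Icc a d, Tendsto (fun m => G m t) atTop (𝓝 (Gc t)) := fun t ht =>
    intervalIntegral.tendsto_integral_filter_of_dominated_convergence (fun _ => M' * K)
      (Eventually.of_forall fun m => (((cμ (-μ)).mul (cP m)).mono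
        ((hsub' t ht).trans Ioc_subset_Icc_self)).aestronglyMeasurable measurableSet_uIoc)
      (Eventually.of_forall fun m => Eventually.of_forall fun r hr => by
        have hr' := Ioc_subset_Icc_self (hsub' t ht hr)
        rw [norm_mul]
        exact mul_le_mul (hM' r hr') (hPK m r hr') (norm_nonneg _) hM'0)
      (by simp)
      (Eventually.of_forall fun r hr =>
        (hP r (Ioc_subset_Icc_self (hsub' t ht hr))).const_mul _)
  -- two points of convergence determine the constants of integration
  have hne : ∀ u v, a ≤ u → u < v → v ≤ d → ∃ t ∈ Ioo u v, Tendsto (fun m => z m t) atTop (𝓝 0) := by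
    intro u v hau huv hvd
    by_contra hcon
    push Not at hcon
    have h0 : volume (Ioo u v) = 0 := by
      refine measure_mono_null (fun t ht => ?_) (ae_iff.1 hlim')
      intro h
      exact hcon t ht (h ⟨hau.trans_lt ht.1, ht.2.le.trans hvd⟩).1
    simp at h0
    linarith
  obtain ⟨t0, ht0, hz0⟩ := hne a ((a + d) / 2) le_rfl (by linarith) (by linarith)
  obtain ⟨t1, ht1, hz1⟩ := hne ((a + d) / 2) d (by linarith) (by linarith) le_rfl
  have ht0I : t0 ∈ Icc a d := ⟨ht0.1.le, by linarith [ht0.2]⟩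
  have ht1I : t1 ∈ Icc a d := ⟨by linarith [ht1.1], ht1.2.le⟩
  have hτ : 0 < τ t1 - τ t0 := by
    have i0 : IntervalIntegrable (fun r : ℝ => r ^ (-μ)) volume a t0 :=
      ((cμ (-μ)).mono (hsub t0 ht0I)).intervalIntegrable
    have i1 : IntervalIntegrable (fun r : ℝ => r ^ (-μ)) volume a t1 :=
      ((cμ (-μ)).mono (hsub t1 ht1I)).intervalIntegrable
    simp only [τ]
    rw [intervalIntegral.integral_interval_sub_left i1 i0]
    exact intervalIntegral.intervalIntegral_pos_of_pos_on (i0.symm.trans i1)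
      (fun r hr => Real.rpow_pos_of_pos (by linarith [hr.1, ht0.1]) _) (by linarith [ht0.2, ht1.1])
  obtain ⟨κc, hκ⟩ : ∃ κc, Tendsto κ atTop (𝓝 κc) := by
    refine ⟨_, (((hz1.sub hz0).sub ((hG t1 ht1I).sub (hG t0 ht0I))).div_const
      (τ t1 - τ t0)).congr fun m => ?_⟩
    rw [hzG m t1 ht1I, hzG m t0 ht0I, div_eq_iff hτ.ne']
    ring
  obtain ⟨A, hA⟩ : ∃ A, Tendsto (fun m => z m a) atTop (𝓝 A) := by
    refine ⟨_, ((hz0.sub (hκ.mul_const (τ t0))).sub (hG t0 ht0I)).congr fun m => ?_⟩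
    rw [hzG m t0 ht0I]
    ring
  have hc_int : ∀ t ∈ Icc a d, IntervalIntegrable (fun r => r ^ μ * c r) volume a t := by
    have : IntegrableOn (fun r => r ^ μ * c r) (Ioc a d) := by
      refine hYM.mono' ?_ ?_
      · refine aestronglyMeasurable_of_tendsto_ae atTop (f := fun m r => r ^ μ * y m r)
          (fun m => ((cy m).mono Ioc_subset_Icc_self).aestronglyMeasurable measurableSet_Ioc) ?_
        filter_upwards [hlim] with r hr using hr.2.1.const_mul _
      · filter_upwards [hlim, ae_restrict_mem measurableSet_Ioc] with r hr hrm
        rw [norm_mul]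
        refine mul_le_mul (hM r (Ioc_subset_Icc_self hrm)) ?_ (norm_nonneg _) hM0
        exact le_of_tendsto hr.2.1.abs (Eventually.of_forall hr.2.2)
    exact fun t ht => (intervalIntegrable_iff_integrableOn_Ioc_of_le ht.1).2
      (this.mono_set (Ioc_subset_Ioc_right ht.2))
  have cPc : ContinuousOn Pc (Icc a d) := by
    have := intervalIntegral.continuousOn_primitive_interval' (a := a)
      (hc_int d ⟨had.le, le_rfl⟩) left_mem_uIcc
    rwa [uIcc_of_le had.le] at this
  let H : ℝ → ℝ := fun t => A + κc * τ t + Gc t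
  have hH : ∀ t ∈ Ioo a d, HasDerivAt H (t ^ (-μ) * (κc + Pc t)) t := by
    intro t ht
    have htI := Ioo_subset_Icc_self ht
    have d1 : HasDerivAt τ (t ^ (-μ)) t := intervalIntegral.integral_hasDerivAt_right
      ((cμ (-μ)).mono (hsub t htI)).intervalIntegrable
      (((cμ (-μ)).mono Ioo_subset_Icc_self).stronglyMeasurableAtFilter isOpen_Ioo t ht)
      ((cμ (-μ)).continuousAt (Icc_mem_nhds ht.1 ht.2))
    have cc := (cμ (-μ)).mul cPc
    have d2 : HasDerivAt Gc (t ^ (-μ) * Pc t) t := intervalIntegral.integral_hasDerivAt_right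
      (cc.mono (hsub t htI)).intervalIntegrable
      ((cc.mono Ioo_subset_Icc_self).stronglyMeasurableAtFilter isOpen_Ioo t ht)
      (cc.continuousAt (Icc_mem_nhds ht.1 ht.2))
    refine (((d1.const_mul κc).const_add A).add d2).congr_deriv ?_
    ring
  have hH0 : EqOn H (fun _ => 0) (Ioo a d) := by
    refine Measure.eqOn_open_of_ae_eq (μ := (volume : Measure ℝ)) ?_ isOpen_Ioo
      (fun t ht => (hH t ht).continuousAt.continuousWithinAt) continuousOn_const
    rw [hres]
    filter_upwards [hlim, ae_restrict_mem measurableSet_Ioc] with t ht htm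
    have htI := Ioc_subset_Icc_self htm
    have h1 := (hA.add (hκ.mul_const (τ t))).add (hG t htI)
    have h2 := ht.1.congr fun m => hzG m t htI
    exact tendsto_nhds_unique h1 h2
  have hP0 : ∀ t ∈ Ioo a d, Pc t = -κc := by
    intro t ht
    have h0 : HasDerivAt H 0 t := (hasDerivAt_const t (0 : ℝ)).congr_of_eventuallyEq
      (hH0.eventuallyEq_of_mem (isOpen_Ioo.mem_nhds ht))
    have h1 := (hH t ht).unique h0
    rcases mul_eq_zero.1 h1 with h2 | h2
    · exact absurd h2 (Real.rpow_pos_of_pos (hpos t (Ioo_subset_Icc_self ht)) _).ne'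
    · linarith
  rw [← hres, ae_restrict_iff' measurableSet_Ioo]
  filter_upwards [(hc_int d ⟨had.le, le_rfl⟩).ae_hasDerivAt_integral] with r hr hrm
  have hrI := Ioo_subset_Icc_self hrm
  have h1 := hr (by rwa [uIcc_of_le had.le]) a left_mem_uIcc
  have h0 : HasDerivAt Pc 0 r := (hasDerivAt_const r (-κc)).congr_of_eventuallyEq (by
    filter_upwards [isOpen_Ioo.mem_nhds hrm] with t ht using hP0 t ht)
  rcases mul_eq_zero.1 (h1.unique h0) with h2 | h2
  · exact absurd h2 (Real.rpow_pos_of_pos (hpos r hrI) _).ne'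
  · exact h2

variable {n : ℕ} {b α η lam : Fin n → ℝ}

/-- Integrability against the kernel implies integrability against its weight: the other factors
are bounded below. -/
theorem integrableOn_prod_rpow_mul (hα : ∀ k, 0 < α k ∧ α k < 1) {h : (Fin n → ℝ) → ℝ}
    {x : Fin n → ℝ} (hx : x ∈ box b) (hc : ContinuousOn h (box b))
    (hi : IntegrableOn (fun t => kernel α η lam x t * h t) (box x)) :
    IntegrableOn (fun t => (∏ i, t i ^ (2 * (η i + α i) + 1)) * h t) (box x) := by
  have hm : AEStronglyMeasurable (fun t : Fin n → ℝ => (∏ i, t i ^ (2 * (η i + α i) + 1)) * h t)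
      (volume.restrict (box x)) := by
    refine ContinuousOn.aestronglyMeasurable (ContinuousOn.mul ?_ (hc.mono (box_subset_box hx)))
      measurableSet_box
    exact continuousOn_finsetProd _ fun i _ => (continuous_apply i).continuousOn.rpow_const
      fun t ht => Or.inl (mem_box.1 ht i).1.ne'
  set D := ∏ i, (x i ^ 2) ^ (-α i) with hD
  have hDpos : 0 < D := Finset.prod_pos fun i _ => by have := (mem_box.1 hx i).1; positivity
  refine (hi.norm.const_mul D⁻¹).mono' hm ?_
  filter_upwards [ae_restrict_mem measurableSet_box] with t ht
  have htp := mem_box.1 ht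
  have h1 : D * ∏ i, t i ^ (2 * (η i + α i) + 1) ≤ kernel α η lam x t := by
    rw [hD, ← Finset.prod_mul_distrib, kernel]
    refine Finset.prod_le_prod (fun i _ => ?_) fun i _ => ?_
    · have h1 := (mem_box.1 hx i).1
      have h2 := (htp i).1
      positivity
    · have h2 := (htp i).1
      have hs : 0 < x i ^ 2 - t i ^ 2 := by nlinarith [(htp i).2]
      have h3 := rpow_neg_le_kap (lam := lam i) (hα i).1 (hα i).2 hs
        (by nlinarith : x i ^ 2 - t i ^ 2 ≤ x i ^ 2)
      rw [kap_of_pos hs] at h3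
      rw [mul_comm, mul_assoc]
      exact mul_le_mul_of_nonneg_left h3 (by positivity)
  have h0 : 0 ≤ ∏ i, t i ^ (2 * (η i + α i) + 1) :=
    Finset.prod_nonneg fun i _ => Real.rpow_nonneg (htp i).1.le _
  rw [norm_mul, norm_mul, Real.norm_of_nonneg h0, ← mul_assoc]
  refine mul_le_mul_of_nonneg_right ?_ (norm_nonneg _)
  rw [le_inv_mul_iff₀ hDpos]
  exact h1.trans (le_abs_self _)

/-- Vanishing of the flux in `x_k` is inherited by `B_j f` for `j ≠ k`, as soon as `B_k B_j f` is
integrable with the weight of the kernel: by integrability the flux of `B_j f` has a limit almost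
everywhere, and `B_j` of the flux of `f`, which tends to `0`, can only tend to `0`. -/
theorem VanishingFlux.bessel_of_ne (hα : ∀ k, 0 < α k ∧ α k < 1) {j k : Fin n} (hjk : j ≠ k)
    {f : (Fin n → ℝ) → ℝ} (hf : ContDiffOn ℝ ((4 : ℕ)) f (box b))
    (hflux : VanishingFlux b (η k + α k) k f)
    (hint : ∀ x ∈ box b, IntegrableOn (fun t => kernel α η lam x t *
      bessel (η k + α k) k (bessel (η j + α j) j f) t) (box x)) :
    VanishingFlux b (η k + α k) k (bessel (η j + α j) j f) := by
  intro x hx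
  set μk := 2 * (η k + α k) + 1 with hμk
  set μj := 2 * (η j + α j) + 1 with hμj
  set g := bessel (η j + α j) j f with hg
  set h := bessel (η k + α k) k g with hh
  have hxk := mem_box.1 hx k
  have hxj := mem_box.1 hx j
  -- `∂_k` and `B_j` commute on the `C⁴` function `f`, and all derivatives below are continuous
  have cg : ContDiffOn ℝ ((2 : ℕ)) g (box b) := contDiffOn_bessel (m := 2) hf j
  have ch : ContinuousOn h (box b) := (contDiffOn_bessel (m := 0) cg k).continuousOn
  have tg : TwicePd (box b) k g := twicePd_of_contDiffOn le_rfl cg k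
  have cgk : ContinuousOn (pd k g) (box b) := (contDiffOn_pd (m := 1) cg k).continuousOn
  have cfk : ContDiffOn ℝ ((3 : ℕ)) (pd k f) (box b) := contDiffOn_pd (m := 3) hf k
  have tfk : TwicePd (box b) j (pd k f) := twicePd_of_contDiffOn (by norm_num) cfk j
  have ecomm : EqOn (pd k g) (bessel (η j + α j) j (pd k f)) (box b) :=
    pd_bessel_comm (hf.of_le (by norm_cast)) hjk
  have hmem : ∀ t ∈ box x, ∀ s ∈ Ioc 0 (x k), Function.update t k s ∈ box b := fun t ht s hs =>
    update_mem_box (box_subset_box hx ht) hs.1 (hs.2.trans_lt hxk.2)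
  -- the flux of `g = B_j f`
  let y : ℝ → (Fin n → ℝ) → ℝ := fun s t => s ^ μk * pd k g (Function.update t k s)
  have dy : ∀ t ∈ box x, ∀ s ∈ Ioc 0 (x k),
      HasDerivAt (fun s => y s t) (s ^ μk * h (Function.update t k s)) s := by
    intro t ht s hs
    have d0 : HasDerivAt (fun s : ℝ => s ^ μk) (μk * s ^ (μk - 1)) s :=
      Real.hasDerivAt_rpow_const (Or.inl hs.1.ne')
    refine (d0.mul (tg _ (hmem t ht s hs)).2.hasDerivAt_update).congr_deriv ?_
    have := hs.1.ne'
    rw [hh, bessel, Function.update_self, Real.rpow_sub_one this, ← hμk]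
    field_simp
    ring
  -- `s^μ B_k g`, the derivative of the flux, is integrable on almost every line
  have hΦ := integrableOn_prod_rpow_mul hα hx ch (hint x hx)
  have hprod : ∀ t ∈ box x, ∀ s, (∏ i, Function.update t k s i ^ (2 * (η i + α i) + 1)) =
      s ^ μk * ∏ i ∈ Finset.univ.erase k, t i ^ (2 * (η i + α i) + 1) := by
    intro t _ s
    rw [← Finset.mul_prod_erase _ _ (Finset.mem_univ k), Function.update_self, ← hμk]
    congr 1
    exact Finset.prod_congr rfl fun i hi => by simp [Finset.ne_of_mem_erase hi]
  have hprodpos : ∀ t ∈ box x, 0 < ∏ i ∈ Finset.univ.erase k, t i ^ (2 * (η i + α i) + 1) :=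
    fun t ht => Finset.prod_pos fun i _ => Real.rpow_pos_of_pos (mem_box.1 ht i).1 _
  let N : (Fin n → ℝ) → ℝ := fun t => ∫ s in Ioo 0 (x k), ‖s ^ μk * h (Function.update t k s)‖
  have hline : ∀ᵐ t ∂volume.restrict (box x),
      IntegrableOn (fun s => s ^ μk * h (Function.update t k s)) (Ioo 0 (x k)) := by
    filter_upwards [ae_integrableOn_update hxk.1 hΦ, ae_restrict_mem measurableSet_box]
      with t ht htx
    refine (IntegrableOn.congr_fun (Integrable.const_mul ht
      (∏ i ∈ Finset.univ.erase k, t i ^ (2 * (η i + α i) + 1))⁻¹) (fun s _ => ?_)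
      measurableSet_Ioo)
    simp only [hprod t htx]
    have := (hprodpos t htx).ne'
    field_simp
  have hN : IntegrableOn (fun t => (∏ i ∈ Finset.univ.erase k, t i ^ (2 * (η i + α i) + 1)) * N t)
      (box x) := by
    refine (integrable_update hxk.1 hΦ).norm.integral_prod_left.congr ?_
    filter_upwards [ae_restrict_mem measurableSet_box] with t htx
    simp only [N]
    rw [← integral_const_mul]
    refine integral_congr_ae (Eventually.of_forall fun s => ?_)
    simp only [hprod t htx]
    rw [mul_comm (s ^ μk), mul_assoc, norm_mul, Real.norm_of_nonneg (hprodpos t htx).le]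
  -- the flux has a limit, and is dominated
  let c : (Fin n → ℝ) → ℝ := fun t =>
    y (x k) t - ∫ s in Ioo 0 (x k), s ^ μk * h (Function.update t k s)
  have hyint : ∀ t ∈ box x, IntegrableOn (fun s => s ^ μk * h (Function.update t k s))
      (Ioo 0 (x k)) → ∀ s ∈ Ioo 0 (x k),
      y s t = y (x k) t - ∫ s in s..(x k), s ^ μk * h (Function.update t k s) := by
    intro t htx hti s hs
    have hsub : ∀ r ∈ uIcc s (x k), r ∈ Ioc 0 (x k) := fun r hr => by
      rw [uIcc_of_le hs.2.le] at hr
      exact ⟨hs.1.trans_le hr.1, hr.2⟩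
    rw [intervalIntegral.integral_eq_sub_of_hasDerivAt (f := fun s => y s t)
      (fun r hr => dy t htx r (hsub r hr))
      ((intervalIntegrable_iff_integrableOn_Ioo_of_le hs.2.le).2
        (hti.mono_set (Ioo_subset_Ioo_left hs.1.le)))]
    ring
  have hylim : ∀ t ∈ box x, IntegrableOn (fun s => s ^ μk * h (Function.update t k s))
      (Ioo 0 (x k)) → Tendsto (fun s => y s t) (𝓝[>] 0) (𝓝 (c t)) := by
    intro t htx hti
    have hii : IntervalIntegrable (fun s => s ^ μk * h (Function.update t k s)) volume 0 (x k) :=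
      (intervalIntegrable_iff_integrableOn_Ioo_of_le hxk.1.le).2 hti
    have hcont := intervalIntegral.continuousOn_primitive_interval' (a := x k) hii right_mem_uIcc
    rw [uIcc_of_le hxk.1.le] at hcont
    have h1 := (hcont 0 ⟨le_rfl, hxk.1.le⟩).tendsto.mono_left
      (nhdsWithin_mono 0 (Ioo_subset_Icc_self : Ioo 0 (x k) ⊆ Icc 0 (x k)))
    rw [nhdsWithin_Ioo_eq_nhdsGT hxk.1] at h1
    have h2 := h1.const_add (y (x k) t)
    have e : y (x k) t + ∫ s in (x k)..0, s ^ μk * h (Function.update t k s) = c t := by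
      rw [intervalIntegral.integral_symm, intervalIntegral.integral_of_le hxk.1.le,
        integral_Ioc_eq_integral_Ioo]
      simp only [c]
      ring
    rw [e] at h2
    refine h2.congr' ?_
    filter_upwards [Ioo_mem_nhdsGT hxk.1] with s hs
    rw [hyint t htx hti s hs, intervalIntegral.integral_symm s (x k)]
    ring
  have hybd : ∀ t ∈ box x, IntegrableOn (fun s => s ^ μk * h (Function.update t k s))
      (Ioo 0 (x k)) → ∀ s ∈ Ioo 0 (x k), |y s t| ≤ |y (x k) t| + N t := by
    intro t htx hti s hs
    rw [hyint t htx hti s hs]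
    refine (abs_sub _ _).trans (add_le_add le_rfl ?_)
    rw [intervalIntegral.integral_of_le hs.2.le, integral_Ioc_eq_integral_Ioo,
      ← Real.norm_eq_abs]
    refine (norm_integral_le_integral_norm _).trans ?_
    exact setIntegral_mono_set hti.norm (Eventually.of_forall fun _ => norm_nonneg _)
      (Ioo_subset_Ioo_left hs.1.le).eventuallyLE
  -- a sequence tending to `0`
  let σ : ℕ → ℝ := fun m => x k / (m + 2)
  have hσ : ∀ m, σ m ∈ Ioo 0 (x k) := fun m => by
    have : (1 : ℝ) < m + 2 := by linarith [(Nat.cast_nonneg m : (0 : ℝ) ≤ m)]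
    exact ⟨div_pos hxk.1 (by linarith), div_lt_self hxk.1 this⟩
  have hσlim : Tendsto σ atTop (𝓝[>] 0) := by
    refine tendsto_nhdsWithin_iff.2 ⟨?_, Eventually.of_forall fun m => (hσ m).1⟩
    exact tendsto_const_nhds.div_atTop (tendsto_atTop_add_const_right _ _ tendsto_natCast_atTop_atTop)
  -- `c` has a measurable version `c'`, for which vanishing can be tested line by line
  have hcm : AEMeasurable c (volume.restrict (box x)) := by
    refine aemeasurable_of_tendsto_metrizable_ae atTop (f := fun m => y (σ m)) (fun m => ?_) ?_
    · have : ContinuousOn (fun t => y (σ m) t) (box x) := continuousOn_const.mul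
        (cgk.comp (by fun_prop) fun t ht => hmem t ht _ ⟨(hσ m).1, (hσ m).2.le⟩)
      exact (this.aestronglyMeasurable measurableSet_box).aemeasurable
    · filter_upwards [hline, ae_restrict_mem measurableSet_box] with t hti htx
      exact (hylim t htx hti).comp hσlim
  obtain ⟨c', hc'm, hc'⟩ := hcm
  have hA : MeasurableSet {t | c' t = 0} := hc'm (measurableSet_singleton 0)
  have hgood : ∀ᵐ t ∂volume.restrict (box x), t ∈ box x ∧
      IntegrableOn (fun s => s ^ μk * h (Function.update t k s)) (Ioo 0 (x k)) ∧
      Tendsto (fun s : ℝ => s ^ μk * pd k f (Function.update t k s)) (𝓝[>] 0) (𝓝 0) ∧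
      c t = c' t := by
    filter_upwards [ae_restrict_mem measurableSet_box, hline, hflux x hx, hc'] with t h1 h2 h3 h4
      using ⟨h1, h2, h3, h4⟩
  -- on lines parallel to the `x_j`-axis, `y (σ m)` is `B_j` applied to the flux of `f`
  have hzero : ∀ᵐ t ∂volume.restrict (box x), t ∈ {t | c' t = 0} := by
    refine ae_of_ae_ae_update hxj.1 hA ?_
    filter_upwards [ae_ae_update hxj.1 hgood, ae_integrableOn_update hxj.1 hN,
      ae_restrict_mem measurableSet_box] with t htg htN htx
    have hmem2 : ∀ s ∈ Ioc 0 (x k), ∀ r ∈ Ioo 0 (x j),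
        Function.update (Function.update t k s) j r ∈ box b := fun s hs r hr =>
      update_mem_box (hmem t htx s hs) hr.1 (hr.2.trans hxj.2)
    have hswap : ∀ s r, Function.update (Function.update t j r) k s =
        Function.update (Function.update t k s) j r := fun s r => Function.update_comm hjk _ _ _
    have hloc : ∀ a d, 0 < a → d < x j → ∀ᵐ r ∂volume.restrict (Ioo a d),
        c' (Function.update t j r) = 0 := by
      intro a d ha hd
      have hI : Icc a d ⊆ Ioo 0 (x j) := fun r hr => ⟨ha.trans_le hr.1, hr.2.trans_lt hd⟩
      have cline : ∀ φ : (Fin n → ℝ) → ℝ, ContinuousOn φ (box b) → ∀ s ∈ Ioc 0 (x k),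
          ContinuousOn (fun r => φ (Function.update (Function.update t k s) j r)) (Icc a d) :=
        fun φ hφ s hs => hφ.comp (by fun_prop) fun r hr => hmem2 s hs r (hI hr)
      refine limit_eq_zero_of_tendsto_zero (μ := μj) ha
        (z := fun m r => σ m ^ μk * pd k f (Function.update (Function.update t k (σ m)) j r))
        (z' := fun m r =>
          σ m ^ μk * pd j (pd k f) (Function.update (Function.update t k (σ m)) j r))
        (y := fun m r => y (σ m) (Function.update t j r))
        (Y := fun r => |y (x k) (Function.update t j r)| + N (Function.update t j r))
        (fun m r hr => ?_) (fun m r hr => ?_) (fun m => ?_) ?_ ?_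
      · exact ((tfk _ (hmem2 _ ⟨(hσ m).1, (hσ m).2.le⟩ r (hI hr))).1.hasDerivAt_update).const_mul _
      · have hp := hmem2 _ ⟨(hσ m).1, (hσ m).2.le⟩ r (hI hr)
        have hr0 : r ≠ 0 := (hI hr).1.ne'
        have d0 : HasDerivAt (fun s : ℝ => s ^ μj) (μj * r ^ (μj - 1)) r :=
          Real.hasDerivAt_rpow_const (Or.inl hr0)
        refine (d0.mul (((tfk _ hp).2.hasDerivAt_update).const_mul (σ m ^ μk))).congr_deriv ?_
        simp only [y]
        rw [hswap, ecomm hp, bessel, Function.update_self, Real.rpow_sub_one hr0, ← hμj]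
        field_simp
        ring
      · simp only [y, hswap]
        exact continuousOn_const.mul (cline _ cgk _ ⟨(hσ m).1, (hσ m).2.le⟩)
      · refine Integrable.add ?_ ?_
        · simp only [y, hswap]
          exact ((continuousOn_const.mul (cline _ cgk _ ⟨hxk.1, le_rfl⟩)).abs.integrableOn_Icc
            ).mono_set Ioo_subset_Icc_self
        · -- the other factors of the weight are bounded below on `[a, d]`
          set Q := ∏ i ∈ (Finset.univ.erase k).erase j, t i ^ (2 * (η i + α i) + 1) with hQ
          have hQpos : 0 < Q :=
            Finset.prod_pos fun i _ => Real.rpow_pos_of_pos (mem_box.1 htx i).1 _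
          have e : ∀ r, ∏ i ∈ Finset.univ.erase k, Function.update t j r i ^
              (2 * (η i + α i) + 1) = r ^ μj * Q := by
            intro r
            rw [← Finset.mul_prod_erase _ _ (Finset.mem_erase.2 ⟨hjk, Finset.mem_univ j⟩),
              Function.update_self, ← hμj]
            congr 1
            exact Finset.prod_congr rfl fun i hi => by simp [Finset.ne_of_mem_erase hi]
          have h1 : IntegrableOn (fun r => r ^ μj * Q * N (Function.update t j r)) (Icc a d) := by
            simp only [e] at htN
            exact htN.mono_set hI
          have h2 : ContinuousOn (fun r : ℝ => (r ^ μj * Q)⁻¹) (Icc a d) := by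
            refine ContinuousOn.inv₀ ((continuousOn_id.rpow_const fun r hr =>
              Or.inl (hI hr).1.ne').mul continuousOn_const) fun r hr => ?_
            exact (mul_pos (Real.rpow_pos_of_pos (hI hr).1 _) hQpos).ne'
          refine ((h1.continuousOn_mul h2 isCompact_Icc).congr_fun (fun r hr => ?_)
            measurableSet_Icc).mono_set Ioo_subset_Icc_self
          exact inv_mul_cancel_left₀ (mul_pos (Real.rpow_pos_of_pos (hI hr).1 μj) hQpos).ne' _
      · have := ae_restrict_of_ae_restrict_of_subset (Ioo_subset_Icc_self.trans hI) htg
        filter_upwards [this] with r hr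
        obtain ⟨h1, h2, h3, h4⟩ := hr
        refine ⟨?_, ?_, fun m => hybd _ h1 h2 _ (hσ m)⟩
        · have := h3.comp hσlim
          refine this.congr fun m => ?_
          simp only [Function.comp, hswap]
        · rw [← h4]
          exact (hylim _ h1 h2).comp hσlim
    rw [ae_restrict_iff' measurableSet_Ioo, ae_iff]
    refine measure_null_of_locally_null _ fun r hr => ?_
    simp only [mem_ofPred_eq, Classical.not_imp] at hr
    obtain ⟨a, ha0, har⟩ := exists_between hr.1.1
    obtain ⟨d, hrd, hdx⟩ := exists_between hr.1.2
    refine ⟨_ ∩ Ioo a d, inter_mem_nhdsWithin _ (Ioo_mem_nhds har hrd), ?_⟩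
    have := hloc a d ha0 hdx
    rw [ae_restrict_iff' measurableSet_Ioo, ae_iff] at this
    refine measure_mono_null (fun s hs => ?_) this
    simp only [mem_inter_iff, mem_ofPred_eq, Classical.not_imp] at hs ⊢
    exact ⟨hs.2, hs.1.2⟩
  filter_upwards [hgood, hzero] with t ht ht0
  have := hylim t ht.1 ht.2.1
  rwa [ht.2.2.2, ht0] at this

end Flux

/-! ### Products of Bessel operators -/

section Words

variable {n : ℕ} {b ν α η lam : Fin n → ℝ}

/-- The product `B_{k₁} ⋯ B_{kᵣ} f` of the Bessel operators in the variables listed in `L`. -/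
noncomputable def besselWord (ν : Fin n → ℝ) (L : List (Fin n)) (f : (Fin n → ℝ) → ℝ) :
    (Fin n → ℝ) → ℝ :=
  L.foldr (fun k => bessel (ν k) k) f

theorem besselWord_cons (k : Fin n) (L : List (Fin n)) (f : (Fin n → ℝ) → ℝ) :
    besselWord ν (k :: L) f = bessel (ν k) k (besselWord ν L f) := rfl

theorem besselWord_append (L L' : List (Fin n)) (f : (Fin n → ℝ) → ℝ) :
    besselWord ν (L ++ L') f = besselWord ν L (besselWord ν L' f) := List.foldr_append

theorem besselWord_replicate (k : Fin n) (l : ℕ) (f : (Fin n → ℝ) → ℝ) :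
    besselWord ν (List.replicate l k) f = (bessel (ν k) k)^[l] f := by
  induction l with
  | zero => rfl
  | succ l ih =>
    rw [List.replicate_succ, besselWord_cons, ih, Function.iterate_succ_apply']

theorem contDiffOn_besselWord {m : ℕ} {L : List (Fin n)} {f : (Fin n → ℝ) → ℝ}
    (hf : ContDiffOn ℝ ((m + 2 * L.length : ℕ)) f (box b)) :
    ContDiffOn ℝ m (besselWord ν L f) (box b) := by
  induction L generalizing m with
  | nil => simpa [besselWord] using hf
  | cons k L ih =>
    refine contDiffOn_bessel (ih (m := m + 2) ?_) k
    have e : m + 2 * (k :: L).length = m + 2 + 2 * L.length := by simp; ring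
    rwa [e] at hf

theorem besselWord_add {L : List (Fin n)} {f g : (Fin n → ℝ) → ℝ}
    (hf : ContDiffOn ℝ ((2 * L.length : ℕ)) f (box b))
    (hg : ContDiffOn ℝ ((2 * L.length : ℕ)) g (box b)) :
    EqOn (besselWord ν L (f + g)) (besselWord ν L f + besselWord ν L g) (box b) := by
  induction L with
  | nil => exact fun _ _ => rfl
  | cons k L ih =>
    have e : 2 * (k :: L).length = 2 + 2 * L.length := by simp; ring
    rw [e] at hf hg
    have hle : ((2 * L.length : ℕ) : WithTop ℕ∞) ≤ ((2 + 2 * L.length : ℕ) : WithTop ℕ∞) := by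
      norm_cast; omega
    exact (bessel_congr (ih (hf.of_le hle) (hg.of_le hle)) k).trans
      (bessel_add (twicePd_of_contDiffOn le_rfl (contDiffOn_besselWord hf) k)
        (twicePd_of_contDiffOn le_rfl (contDiffOn_besselWord hg) k))

theorem besselWord_smul (c : ℝ) (L : List (Fin n)) (f : (Fin n → ℝ) → ℝ) :
    besselWord ν L (c • f) = c • besselWord ν L f := by
  induction L with
  | nil => rfl
  | cons k L ih => rw [besselWord_cons, ih, bessel_smul, besselWord_cons]

theorem besselWord_perm {L L' : List (Fin n)} (h : L.Perm L') {f : (Fin n → ℝ) → ℝ}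
    (hf : ContDiffOn ℝ ((2 * L.length : ℕ)) f (box b)) :
    EqOn (besselWord ν L f) (besselWord ν L' f) (box b) := by
  induction h with
  | nil => exact fun _ _ => rfl
  | cons k _ ih =>
    refine bessel_congr (ih (hf.of_le ?_)) k
    norm_cast
    simp
  | swap i j l =>
    by_cases hij : i = j
    · rw [hij]
      exact fun _ _ => rfl
    · have e : 2 * (j :: i :: l).length = 4 + 2 * l.length := by simp; ring
      rw [e] at hf
      exact bessel_bessel_comm (contDiffOn_besselWord hf) hij
  | trans h₁ _ ih₁ ih₂ => exact (ih₁ hf).trans (ih₂ (by rwa [← h₁.length_eq]))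

theorem VanishingFlux.congr {e : ℝ} {k : Fin n} {f g : (Fin n → ℝ) → ℝ}
    (hf : VanishingFlux b e k f) (h : EqOn f g (box b)) : VanishingFlux b e k g := by
  intro x hx
  have hxk := mem_box.1 hx k
  filter_upwards [hf x hx, ae_restrict_mem measurableSet_box] with t ht htx
  refine ht.congr' ?_
  filter_upwards [Ioo_mem_nhdsGT hxk.1] with s hs
  rw [pd_congr h k (update_mem_box (box_subset_box hx htx) hs.1 (hs.2.trans hxk.2))]

theorem VanishingFlux.add {e : ℝ} {k : Fin n} {f g : (Fin n → ℝ) → ℝ}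
    (hf : VanishingFlux b e k f) (hg : VanishingFlux b e k g) (hf' : TwicePd (box b) k f)
    (hg' : TwicePd (box b) k g) : VanishingFlux b e k (f + g) := by
  intro x hx
  have hxk := mem_box.1 hx k
  filter_upwards [hf x hx, hg x hx, ae_restrict_mem measurableSet_box] with t ht ht' htx
  have := ht.add ht'
  rw [add_zero] at this
  refine this.congr' ?_
  filter_upwards [Ioo_mem_nhdsGT hxk.1] with s hs
  have hm := update_mem_box (box_subset_box hx htx) hs.1 (hs.2.trans hxk.2)
  rw [pd_add (hf' _ hm).1 (hg' _ hm).1]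
  ring

theorem VanishingFlux.smul {e : ℝ} {k : Fin n} {f : (Fin n → ℝ) → ℝ}
    (hf : VanishingFlux b e k f) (c : ℝ) : VanishingFlux b e k (c • f) := by
  intro x hx
  filter_upwards [hf x hx] with t ht
  have := ht.const_mul c
  rw [mul_zero] at this
  refine this.congr fun s => ?_
  rw [pd_smul]
  ring

/-- If the flux in `x_k` vanishes for all powers of `B_k`, it vanishes for all products of Bessel
operators: commute the powers of `B_k` to the right and apply the others one by one. -/
theorem vanishingFlux_besselWord (hα : ∀ k, 0 < α k ∧ α k < 1) {p : ℕ} {g : (Fin n → ℝ) → ℝ}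
    (hg : ContDiffOn ℝ ((2 * p : ℕ)) g (box b))
    (happ : ∀ L : List (Fin n), L.length ≤ p →
      Applicable b α η lam (besselWord (fun k => η k + α k) L g)) {k : Fin n}
    (hflux : ∀ l < p, VanishingFlux b (η k + α k) k ((bessel (η k + α k) k)^[l] g))
    {L : List (Fin n)} (hL : L.length < p) :
    VanishingFlux b (η k + α k) k (besselWord (fun k => η k + α k) L g) := by
  have key : ∀ (l : ℕ) (A : List (Fin n)), k ∉ A → A.length + l < p →
      VanishingFlux b (η k + α k) k
        (besselWord (fun k => η k + α k) (A ++ List.replicate l k) g) := by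
    intro l A
    induction A with
    | nil =>
      intro _ hl
      rw [List.nil_append, besselWord_replicate]
      exact hflux l (by simpa using hl)
    | cons j A ih =>
      intro hkA hl
      obtain ⟨hkj, hkA⟩ : k ≠ j ∧ k ∉ A := by simpa using hkA
      simp only [List.length_cons] at hl
      rw [List.cons_append, besselWord_cons]
      refine (ih hkA (by omega)).bessel_of_ne hα (Ne.symm hkj)
        (contDiffOn_besselWord (hg.of_le ?_)) (happ (k :: j :: (A ++ List.replicate l k)) ?_).1
      · norm_cast
        simp only [List.length_append, List.length_replicate]
        omega
      · simp only [List.length_cons, List.length_append, List.length_replicate]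
        omega
  have hperm : L.Perm (L.filter (· ≠ k) ++ List.replicate (L.count k) k) := by
    have h1 := List.filter_append_perm (fun i => decide (i ≠ k)) L
    have h2 : L.filter (fun i => !decide (i ≠ k)) = List.replicate (L.count k) k := by
      rw [← List.filter_eq]
      simp
    rw [h2] at h1
    exact h1.symm
  have hlen := hperm.length_eq
  rw [List.length_append, List.length_replicate] at hlen
  exact (key (L.count k) (L.filter (· ≠ k)) (by simp) (by omega)).congr
    (besselWord_perm hperm (hg.of_le (by norm_cast; omega))).symm

/-- The conditions on `f` that make the intertwining relations hold up to order `m` in the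
variables from `S`. -/
structure Admissible (S : Finset (Fin n)) (b α η lam : Fin n → ℝ) (m : ℕ)
    (f : (Fin n → ℝ) → ℝ) : Prop where
  contDiffOn : ContDiffOn ℝ ((2 * m : ℕ)) f (box b)
  applicable : ∀ L : List (Fin n), (∀ k ∈ L, k ∈ S) → L.length ≤ m →
    Applicable b α η lam (besselWord (fun k => η k + α k) L f)
  vanishingFlux : ∀ L : List (Fin n), (∀ k ∈ L, k ∈ S) → L.length < m → ∀ k ∈ S,
    VanishingFlux b (η k + α k) k (besselWord (fun k => η k + α k) L f)

variable {S : Finset (Fin n)} {m : ℕ} {f g : (Fin n → ℝ) → ℝ}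

theorem Admissible.add (hf : Admissible S b α η lam m f) (hg : Admissible S b α η lam m g) :
    Admissible S b α η lam m (f + g) := by
  have hle : ∀ L : List (Fin n), L.length ≤ m →
      ((2 * L.length : ℕ) : WithTop ℕ∞) ≤ ((2 * m : ℕ) : WithTop ℕ∞) := fun L hL => by
    norm_cast; omega
  refine ⟨hf.contDiffOn.add hg.contDiffOn, fun L hS hL => ?_, fun L hS hL k hk => ?_⟩
  · exact ((hf.applicable L hS hL).add (hg.applicable L hS hL)).congr
      (besselWord_add (hf.contDiffOn.of_le (hle L hL)) (hg.contDiffOn.of_le (hle L hL))).symm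
  · have hle2 : ((2 + 2 * L.length : ℕ) : WithTop ℕ∞) ≤ ((2 * m : ℕ) : WithTop ℕ∞) := by
      norm_cast; omega
    have tw : ∀ {h : (Fin n → ℝ) → ℝ}, ContDiffOn ℝ ((2 * m : ℕ)) h (box b) →
        TwicePd (box b) k (besselWord (fun k => η k + α k) L h) := fun hh =>
      twicePd_of_contDiffOn le_rfl (contDiffOn_besselWord (hh.of_le hle2)) k
    exact ((hf.vanishingFlux L hS hL k hk).add (hg.vanishingFlux L hS hL k hk)
      (tw hf.contDiffOn) (tw hg.contDiffOn)).congr (besselWord_add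
        (hf.contDiffOn.of_le (hle L hL.le)) (hg.contDiffOn.of_le (hle L hL.le))).symm

theorem Admissible.smul (hf : Admissible S b α η lam m f) (c : ℝ) :
    Admissible S b α η lam m (c • f) := by
  refine ⟨hf.contDiffOn.const_smul c, fun L hS hL => ?_, fun L hS hL k hk => ?_⟩
  · rw [besselWord_smul]; exact (hf.applicable L hS hL).smul c
  · rw [besselWord_smul]; exact (hf.vanishingFlux L hS hL k hk).smul c

theorem Admissible.mono (hf : Admissible S b α η lam (m + 1) f) : Admissible S b α η lam m f :=
  ⟨hf.contDiffOn.of_le (by norm_cast; omega), fun L hS hL => hf.applicable L hS (by omega),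
    fun L hS hL => hf.vanishingFlux L hS (by omega)⟩

theorem Admissible.bessel (hf : Admissible S b α η lam (m + 1) f) {k : Fin n} (hk : k ∈ S) :
    Admissible S b α η lam m (bessel (η k + α k) k f) := by
  have hS' : ∀ L : List (Fin n), (∀ i ∈ L, i ∈ S) → ∀ i ∈ L ++ [k], i ∈ S := by
    intro L hS i hi
    rcases List.mem_append.1 hi with h | h
    · exact hS i h
    · rw [List.mem_singleton.1 h]; exact hk
  have e : ∀ L : List (Fin n), besselWord (fun k => η k + α k) (L ++ [k]) f =
      besselWord (fun k => η k + α k) L (ErdelyiKober.bessel (η k + α k) k f) := fun L =>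
    besselWord_append L [k] f
  refine ⟨contDiffOn_bessel (m := 2 * m) hf.contDiffOn k, fun L hS hL => ?_,
    fun L hS hL j hj => ?_⟩
  · rw [← e]; exact hf.applicable _ (hS' L hS) (by simpa using hL)
  · rw [← e]; exact hf.vanishingFlux _ (hS' L hS) (by simpa using hL) j hj

theorem Admissible.sum {ι : Type*} {s : Finset ι} {φ : ι → (Fin n → ℝ) → ℝ}
    (hφ : ∀ i ∈ s, Admissible S b α η lam m (φ i)) (h0 : Admissible S b α η lam m f) :
    Admissible S b α η lam m (∑ i ∈ s, φ i) := by
  classical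
  induction s using Finset.induction_on with
  | empty => simpa using h0.smul 0
  | insert i s hi ih =>
    rw [Finset.sum_insert hi]
    exact (hφ i (Finset.mem_insert_self i s)).add
      (ih fun j hj => hφ j (Finset.mem_insert_of_mem hj))

end Words

/-! ### Powers of the intertwined operators -/

section Powers

variable {n : ℕ} {b α η lam : Fin n → ℝ} {S : Finset (Fin n)}

theorem applicable_sum {ι : Type*} {s : Finset ι} {φ : ι → (Fin n → ℝ) → ℝ}
    (hφ : ∀ i ∈ s, Applicable b α η lam (φ i)) :
    Applicable b α η lam (∑ i ∈ s, φ i) ∧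
      EqOn (invEK α η lam (∑ i ∈ s, φ i)) (∑ i ∈ s, invEK α η lam (φ i)) (box b) := by
  classical
  induction s using Finset.induction_on with
  | empty => exact ⟨by simpa using applicable_zero, fun x _ => by simp [invEK_zero]⟩
  | insert i s hi ih =>
    obtain ⟨h1, h2⟩ := ih fun j hj => hφ j (Finset.mem_insert_of_mem hj)
    have h3 := hφ i (Finset.mem_insert_self i s)
    rw [Finset.sum_insert hi, Finset.sum_insert hi]
    refine ⟨h3.add h1, fun x hx => ?_⟩
    rw [invEK_add h3 h1 hx, Pi.add_apply, Pi.add_apply, h2 hx]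

/-- The operator `∑_{k ∈ S} B_{η_k} - c` on the left-hand side of the intertwining relation.
A single variable gives `B_{η_k} - c`; for `η = -1/2`, all variables and `c = 0` it is the
Laplacian. -/
noncomputable def besselSum (S : Finset (Fin n)) (η : Fin n → ℝ) (c : ℝ)
    (f : (Fin n → ℝ) → ℝ) : (Fin n → ℝ) → ℝ :=
  ∑ k ∈ S, bessel (η k) k f - c • f

/-- The operator `∑_{k ∈ S} (B_{η_k+α_k} + λ_k²) - c` on the right-hand side of the intertwining
relation. -/
noncomputable def shiftedBesselSum (S : Finset (Fin n)) (α η lam : Fin n → ℝ) (c : ℝ)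
    (f : (Fin n → ℝ) → ℝ) : (Fin n → ℝ) → ℝ :=
  ∑ k ∈ S, (bessel (η k + α k) k f + lam k ^ 2 • f) - c • f

theorem besselSum_congr {c : ℝ} {f g : (Fin n → ℝ) → ℝ} (h : EqOn f g (box b)) :
    EqOn (besselSum S η c f) (besselSum S η c g) (box b) := fun x hx => by
  simp only [besselSum, Pi.sub_apply, Finset.sum_apply, Pi.smul_apply, h hx]
  rw [Finset.sum_congr rfl fun k _ => bessel_congr h k hx]

theorem besselSum_iterate_congr {c : ℝ} {f g : (Fin n → ℝ) → ℝ} (h : EqOn f g (box b)) (l : ℕ) :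
    EqOn ((besselSum S η c)^[l] f) ((besselSum S η c)^[l] g) (box b) := by
  induction l with
  | zero => exact h
  | succ l ih =>
    rw [Function.iterate_succ_apply', Function.iterate_succ_apply']
    exact besselSum_congr ih

theorem Admissible.shiftedBesselSum {m : ℕ} {c : ℝ} {f : (Fin n → ℝ) → ℝ}
    (hf : Admissible S b α η lam (m + 1) f) :
    Admissible S b α η lam m (shiftedBesselSum S α η lam c f) := by
  have h := (Admissible.sum (s := S) (fun k hk => (hf.bessel hk).add (hf.mono.smul (lam k ^ 2)))
    hf.mono).add (hf.mono.smul (-c))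
  rwa [neg_smul, ← sub_eq_add_neg] at h

/-- The intertwining relation of first order, summed over the variables in `S`. -/
theorem besselSum_invEK (hα : ∀ k, 0 < α k ∧ α k < 1) (hη : ∀ k, -1 / 2 ≤ η k) {m : ℕ} {c : ℝ}
    {f : (Fin n → ℝ) → ℝ} (hf : Admissible S b α η lam (m + 1) f) :
    (∀ k ∈ S, TwicePd (box b) k (invEK α η lam f)) ∧
      EqOn (besselSum S η c (invEK α η lam f)) (invEK α η lam (shiftedBesselSum S α η lam c f))
        (box b) := by
  have h0 : Applicable b α η lam f := hf.applicable [] (by simp) (by simp)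
  have hB : ∀ k ∈ S, Applicable b α η lam (bessel (η k + α k) k f) := fun k hk =>
    hf.applicable [k] (by simpa using hk) (by simp)
  have hstep := fun k hk => bessel_invEK hα hη
    (twicePd_of_contDiffOn (by omega) hf.contDiffOn k)
    (hf.vanishingFlux [] (by simp) (by simp) k hk) h0 (hB k hk)
  refine ⟨fun k hk => (hstep k hk).1, fun x hx => ?_⟩
  obtain ⟨a1, e1⟩ := applicable_sum (s := S)
    (φ := fun k => bessel (η k + α k) k f + lam k ^ 2 • f)
    fun k hk => (hB k hk).add (h0.smul _)
  have e2 : shiftedBesselSum S α η lam c f =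
      ∑ k ∈ S, (bessel (η k + α k) k f + lam k ^ 2 • f) + (-c) • f := by
    rw [shiftedBesselSum, neg_smul, sub_eq_add_neg]
  rw [e2, invEK_add a1 (h0.smul _) hx, Pi.add_apply, e1 hx, invEK_smul, besselSum, Pi.sub_apply,
    Finset.sum_apply, Finset.sum_apply, neg_smul, Pi.neg_apply, sub_eq_add_neg]
  congr 1
  refine Finset.sum_congr rfl fun k hk => ?_
  rw [(hstep k hk).2 hx, invEK_add (hB k hk) (h0.smul _) hx, invEK_smul]

/-- The intertwining relation for powers, by iterating the one of first order. -/
theorem besselSum_iterate_invEK (hα : ∀ k, 0 < α k ∧ α k < 1) (hη : ∀ k, -1 / 2 ≤ η k) {c : ℝ}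
    {m : ℕ} {f : (Fin n → ℝ) → ℝ} (hf : Admissible S b α η lam m f) :
    (∀ l < m, ∀ k ∈ S, TwicePd (box b) k ((besselSum S η c)^[l] (invEK α η lam f))) ∧
      Applicable b α η lam ((shiftedBesselSum S α η lam c)^[m] f) ∧
      EqOn ((besselSum S η c)^[m] (invEK α η lam f))
        (invEK α η lam ((shiftedBesselSum S α η lam c)^[m] f)) (box b) := by
  induction m generalizing f with
  | zero => exact ⟨by simp, hf.applicable [] (by simp) (by simp), fun _ _ => rfl⟩
  | succ m ih =>
    obtain ⟨t1, e1⟩ := besselSum_invEK (c := c) hα hη hf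
    obtain ⟨t2, a2, e2⟩ := ih (hf.shiftedBesselSum (c := c))
    refine ⟨fun l hl k hk => ?_, a2, ?_⟩
    · cases l with
      | zero => exact t1 k hk
      | succ l =>
        rw [Function.iterate_succ_apply]
        exact (t2 l (by omega) k hk).congr (besselSum_iterate_congr e1.symm l)
    · rw [Function.iterate_succ_apply, Function.iterate_succ_apply]
      exact (besselSum_iterate_congr e1 m).trans e2

/-- In a single variable, the products of Bessel operators are the powers of one of them. -/
theorem admissible_singleton {p : ℕ} {g : (Fin n → ℝ) → ℝ} {k : Fin n}
    (hg : ContDiffOn ℝ ((2 * p : ℕ)) g (box b))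
    (hflux : ∀ l < p, VanishingFlux b (η k + α k) k ((bessel (η k + α k) k)^[l] g))
    (happ : ∀ l ≤ p, Applicable b α η lam ((bessel (η k + α k) k)^[l] g)) :
    Admissible {k} b α η lam p g := by
  have e : ∀ L : List (Fin n), (∀ i ∈ L, i ∈ ({k} : Finset (Fin n))) →
      besselWord (fun k => η k + α k) L g = (bessel (η k + α k) k)^[L.length] g := by
    intro L hL
    have : L = List.replicate L.length k :=
      List.eq_replicate_iff.2 ⟨rfl, fun i hi => Finset.mem_singleton.1 (hL i hi)⟩
    conv_lhs => rw [this]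
    exact besselWord_replicate k _ g
  refine ⟨hg, fun L hS hL => ?_, fun L hS hL j hj => ?_⟩
  · rw [e L hS]; exact happ _ hL
  · rw [e L hS, Finset.mem_singleton.1 hj]; exact hflux _ hL

end Powers

end ErdelyiKober

theorem theorem7 {n : ℕ} (p : ℕ) (b α η lam : Fin n → ℝ)
    (hb : ∀ k, 0 < b k) (hα : ∀ k, 0 < α k ∧ α k < 1) (hη : ∀ k, -1 / 2 ≤ η k)
    (g : (Fin n → ℝ) → ℝ)
    (hg : ContDiffOn ℝ ((2 * p : ℕ) : WithTop ℕ∞) g (ErdelyiKober.box b))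
    (hint : ∀ k, ∀ l < p, ∀ x ∈ ErdelyiKober.box b,
      MeasureTheory.IntegrableOn
        (fun t => ErdelyiKober.pd k ((ErdelyiKober.bessel (η k + α k) k)^[l] g)
          (Function.update x k t)) (Set.Ioo 0 (x k)))
    (hlim : ∀ k, ∀ l < p, ∀ x ∈ ErdelyiKober.box b,
      Filter.Tendsto
        (fun t : ℝ => t ^ (2 * (η k + α k) + 1) *
          ErdelyiKober.pd k ((ErdelyiKober.bessel (η k + α k) k)^[l] g) (Function.update x k t))
        (nhdsWithin 0 (Set.Ioi 0)) (nhds 0)) :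
    -- the two forms of the intertwining relation, for general `lam`
    (∀ k, (∀ l ≤ p, ErdelyiKober.Applicable b α η lam
        ((ErdelyiKober.bessel (η k + α k) k)^[l] g)) →
      ((∀ l < p, ErdelyiKober.TwicePd (ErdelyiKober.box b) k
          ((fun f => ErdelyiKober.bessel (η k) k f - lam k ^ 2 • f)^[l]
            (ErdelyiKober.invEK α η lam g))) ∧
        ∀ x ∈ ErdelyiKober.box b,
          (fun f => ErdelyiKober.bessel (η k) k f - lam k ^ 2 • f)^[p]
              (ErdelyiKober.invEK α η lam g) x =
            ErdelyiKober.invEK α η lam ((ErdelyiKober.bessel (η k + α k) k)^[p] g) x) ∧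
      ((∀ l < p, ErdelyiKober.TwicePd (ErdelyiKober.box b) k
          ((ErdelyiKober.bessel (η k) k)^[l] (ErdelyiKober.invEK α η lam g))) ∧
        ErdelyiKober.Applicable b α η lam
          ((fun f => ErdelyiKober.bessel (η k + α k) k f + lam k ^ 2 • f)^[p] g) ∧
        ∀ x ∈ ErdelyiKober.box b,
          (ErdelyiKober.bessel (η k) k)^[p] (ErdelyiKober.invEK α η lam g) x =
            ErdelyiKober.invEK α η lam
              ((fun f => ErdelyiKober.bessel (η k + α k) k f + lam k ^ 2 • f)^[p] g) x)) ∧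
    -- the case where all the parameters `lam k` are zero
    (∀ k, (∀ l ≤ p, ErdelyiKober.Applicable b α η 0
        ((ErdelyiKober.bessel (η k + α k) k)^[l] g)) →
      (∀ l < p, ErdelyiKober.TwicePd (ErdelyiKober.box b) k
          ((ErdelyiKober.bessel (η k) k)^[l] (ErdelyiKober.invEK α η 0 g))) ∧
        ∀ x ∈ ErdelyiKober.box b,
          (ErdelyiKober.bessel (η k) k)^[p] (ErdelyiKober.invEK α η 0 g) x =
            ErdelyiKober.invEK α η 0 ((ErdelyiKober.bessel (η k + α k) k)^[p] g) x) ∧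
    -- the powers of the Laplacian, for `lam = 0` and `η = -1/2`
    (η = (fun _ => -1 / 2) →
      (∀ L : List (Fin n), L.length ≤ p → ErdelyiKober.Applicable b α η 0
        (L.foldr (fun k => ErdelyiKober.bessel (α k - 1 / 2) k) g)) →
      (∀ l < p, ∀ k, ErdelyiKober.TwicePd (ErdelyiKober.box b) k
          (ErdelyiKober.laplacian^[l] (ErdelyiKober.invEK α η 0 g))) ∧
        ErdelyiKober.Applicable b α η 0
          ((ErdelyiKober.besselLaplacian (fun k => α k - 1 / 2))^[p] g) ∧
        ∀ x ∈ ErdelyiKober.box b,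
          ErdelyiKober.laplacian^[p] (ErdelyiKober.invEK α η 0 g) x =
            ErdelyiKober.invEK α η 0
              ((ErdelyiKober.besselLaplacian (fun k => α k - 1 / 2))^[p] g) x) := by
  have hflux : ∀ k, ∀ l < p, ErdelyiKober.VanishingFlux b (η k + α k) k
      ((ErdelyiKober.bessel (η k + α k) k)^[l] g) := by
    intro k l hl x hx
    filter_upwards [MeasureTheory.ae_restrict_mem ErdelyiKober.measurableSet_box] with t ht
    exact hlim k l hl t (ErdelyiKober.box_subset_box hx ht)
  refine ⟨fun k happ => ?_, fun k happ => ?_, ?_⟩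
  · have hadm := ErdelyiKober.admissible_singleton hg (hflux k) happ
    -- the constant `c` is `λ_k²` for the first form of the relation and `0` for the second
    obtain ⟨t1, -, e1⟩ := ErdelyiKober.besselSum_iterate_invEK (c := lam k ^ 2) hα hη hadm
    obtain ⟨t2, a2, e2⟩ := ErdelyiKober.besselSum_iterate_invEK (c := 0) hα hη hadm
    have o1 : ErdelyiKober.besselSum {k} η (lam k ^ 2) =
        fun f => ErdelyiKober.bessel (η k) k f - lam k ^ 2 • f := by
      funext f; simp [ErdelyiKober.besselSum]
    have o2 : ErdelyiKober.shiftedBesselSum {k} α η lam (lam k ^ 2) =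
        ErdelyiKober.bessel (η k + α k) k := by
      funext f; simp [ErdelyiKober.shiftedBesselSum]
    have o3 : ErdelyiKober.besselSum {k} η 0 = ErdelyiKober.bessel (η k) k := by
      funext f; simp [ErdelyiKober.besselSum]
    have o4 : ErdelyiKober.shiftedBesselSum {k} α η lam 0 =
        fun f => ErdelyiKober.bessel (η k + α k) k f + lam k ^ 2 • f := by
      funext f; simp [ErdelyiKober.shiftedBesselSum]
    rw [o1] at t1 e1
    rw [o2] at e1
    rw [o3] at t2 e2
    rw [o4] at a2 e2
    exact ⟨⟨fun l hl => t1 l hl k (Finset.mem_singleton_self k), fun x hx => e1 hx⟩,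
      fun l hl => t2 l hl k (Finset.mem_singleton_self k), a2, fun x hx => e2 hx⟩
  · have hadm := ErdelyiKober.admissible_singleton hg (hflux k) happ
    obtain ⟨t, -, e⟩ := ErdelyiKober.besselSum_iterate_invEK (c := 0) hα hη hadm
    have o1 : ErdelyiKober.besselSum {k} η 0 = ErdelyiKober.bessel (η k) k := by
      funext f; simp [ErdelyiKober.besselSum]
    have o2 : ErdelyiKober.shiftedBesselSum {k} α η 0 0 =
        ErdelyiKober.bessel (η k + α k) k := by
      funext f; simp [ErdelyiKober.shiftedBesselSum]
    rw [o1] at t e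
    rw [o2] at e
    exact ⟨fun l hl => t l hl k (Finset.mem_singleton_self k), fun x hx => e hx⟩
  · intro hη' happ
    have hν : (fun k => α k - 1 / 2) = fun k => η k + α k := by
      funext k; rw [hη']; ring
    have happ' : ∀ L : List (Fin n), L.length ≤ p → ErdelyiKober.Applicable b α η 0
        (ErdelyiKober.besselWord (fun k => η k + α k) L g) := by
      rw [← hν]; exact happ
    have hadm : ErdelyiKober.Admissible Finset.univ b α η 0 p g :=
      ⟨hg, fun L _ hL => happ' L hL, fun L _ hL k _ =>
        ErdelyiKober.vanishingFlux_besselWord hα hg happ' (hflux k) hL⟩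
    obtain ⟨t, a, e⟩ := ErdelyiKober.besselSum_iterate_invEK (c := 0) hα hη hadm
    have o1 : ErdelyiKober.besselSum Finset.univ η 0 = ErdelyiKober.laplacian := by
      funext f x
      simp only [ErdelyiKober.besselSum, ErdelyiKober.laplacian, ErdelyiKober.bessel, hη',
        zero_smul, sub_zero, Finset.sum_apply]
      norm_num
    have o2 : ErdelyiKober.shiftedBesselSum Finset.univ α η 0 0 =
        ErdelyiKober.besselLaplacian fun k => α k - 1 / 2 := by
      rw [hν]
      funext f x
      simp [ErdelyiKober.shiftedBesselSum, ErdelyiKober.besselLaplacian]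
    rw [o1] at t e
    rw [o2] at a e
    exact ⟨fun l hl k => t l hl k (Finset.mem_univ k), a, fun x hx => e hx⟩
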